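/- Let $\Bbbk$ be a field of characteristic zero; all dg categories are small and $\Bbbk$-linear, and modules are right modules. A dg module $M$ over a dg category $\mathscr A$ is \emph{perfect} if it is a compact object of the derived category $\mathbf D(\mathscr A)=[\mathrm{dgMod}\,\mathscr A]/[\mathrm{Ac}\,\mathscr A]$ (the homotopy category of dg modules modulo the acyclic ones), i.e. if $\mathrm{Hom}_{\mathbf D(\mathscr A)}(M,-)$ commutes with arbitrary direct sums. A dg $(\mathscr A,\mathscr B)$-bimodule is a dg module $\phi$ over $\mathscr B\otimes_\Bbbk\mathscr A^{\mathrm{op}}$; it is \emph{right perfect} if the dg $\mathscr B$-module $\phi(-,A)$ is perfect for every object $A$ of $\mathscr A$. The dg category $\mathscr A$ is \emph{smooth} if its diagonal bimodule $(A,A')\mapsto\mathscr A(A,A')$ is perfect, and \emph{proper} if for all objects $A,A'$ the complex $\mathscr A(A,A')$ is a perfect dg $\Bbbk$-module. Let $n\ge 0$ and let $\mathscr C$ be a directed dg category, that is, a dg category with full dg subcategories $\mathscr A_0,\dots,\mathscr A_{n-1}$ such that $\mathrm{Obj}\,\mathscr C=\bigsqcup_{i}\mathrm{Obj}\,\mathscr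 A_i$ and $\mathscr C(X,Y)=0$ whenever $X\in\mathscr A_i$, $Y\in\mathscr A_j$ and $i>j$. For $i>j$ let $\phi_{ij}$ be the dg $(\mathscr A_i,\mathscr A_j)$-bimodule $(A_j,A_i)\mapsto\mathscr C(A_j,A_i)$, so that $$\mathscr C=\begin{pmatrix}\mathscr A_0&0&\cdots&0\\ \phi_{10}&\mathscr A_1&\cdots&0\\ \vdots&\vdots&\ddots&\vdots\\ \phi_{n-1,0}&\phi_{n-1,1}&\cdots&\mathscr A_{n-1}\end{pmatrix}.$$ \textbf{Proposition.} Assume that the dg categories $\mathscr A_i$ are smooth and that the dg bimodules $\phi_{ij}$ ($i>j$) are right perfect. Then $\mathscr C$ is smooth. Moreover, if the $\mathscr A_i$ are proper, then so is $\mathscr C$. -/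

import Mathlib

open CategoryTheory CategoryTheory.Limits
open scoped TensorProduct DirectSum

universe u

noncomputable section

/-! ### Signs and tensor products of graded vector spaces -/

/-- The sign `(-1)^n`, as an element of the field `k`. -/
def koszulSign (k : Type u) [Field k] (n : ℤ) : k := ((n.negOnePow : ℤ) : k)

section Sign

variable {k : Type u} [Field k]

theorem koszulSign_mul (m n : ℤ) :
    koszulSign k m * koszulSign k n = koszulSign k (m + n) := by
  simp [koszulSign, Int.negOnePow_add]

theorem koszulSign_zero : koszulSign k 0 = 1 := by simp [koszulSign]

theorem koszulSign_congr {m n : ℤ} (h : Even (m - n)) : koszulSign k m = koszulSign k n := by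
  unfold koszulSign
  rw [(Int.negOnePow_eq_iff m n).2 h]

theorem koszulSign_succ (n : ℤ) : koszulSign k (n + 1) = -koszulSign k n := by
  simp [koszulSign, Int.negOnePow_succ]

end Sign

section GTensor

variable {k : Type u} [Field k]
  (V : ℤ → Type u) [∀ n, AddCommGroup (V n)] [∀ n, Module k (V n)]
  (W : ℤ → Type u) [∀ n, AddCommGroup (W n)] [∀ n, Module k (W n)]

/-- The degree `n` part of the tensor product of two graded vector spaces,
`⨁_{p + q = n} V p ⊗ W q`. -/
def GTensor (k : Type u) [Field k]
    (V : ℤ → Type u) [∀ n, AddCommGroup (V n)] [∀ n, Module k (V n)]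
    (W : ℤ → Type u) [∀ n, AddCommGroup (W n)] [∀ n, Module k (W n)] (n : ℤ) : Type u :=
  ⨁ i : {i : ℤ × ℤ // i.1 + i.2 = n}, V i.1.1 ⊗[k] W i.1.2

instance (n : ℤ) : AddCommGroup (GTensor k V W n) :=
  inferInstanceAs (AddCommGroup
    (⨁ i : {i : ℤ × ℤ // i.1 + i.2 = n}, V i.1.1 ⊗[k] W i.1.2))

instance (n : ℤ) : Module k (GTensor k V W n) :=
  inferInstanceAs (Module k
    (⨁ i : {i : ℤ × ℤ // i.1 + i.2 = n}, V i.1.1 ⊗[k] W i.1.2))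

variable {V W}

/-- The element `v ⊗ w` of degree `p + q = n`, for `v` of degree `p` and `w` of degree `q`. -/
def GTensor.mk {p q n : ℤ} (h : p + q = n) : V p →ₗ[k] W q →ₗ[k] GTensor k V W n :=
  (TensorProduct.mk k (V p) (W q)).compr₂
    (DirectSum.lof k {i : ℤ × ℤ // i.1 + i.2 = n} (fun i => V i.1.1 ⊗[k] W i.1.2) ⟨(p, q), h⟩)

/-- The universal property of the tensor product of graded vector spaces. -/
def GTensor.lift {n : ℤ} {M : Type u} [AddCommGroup M] [Module k M]
    (φ : ∀ p q : ℤ, p + q = n → V p →ₗ[k] W q →ₗ[k] M) : GTensor k V W n →ₗ[k] M :=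
  DirectSum.toModule k _ M (fun i => TensorProduct.lift (φ i.1.1 i.1.2 i.2))

theorem GTensor.lift_mk {n : ℤ} {M : Type u} [AddCommGroup M] [Module k M]
    (φ : ∀ p q : ℤ, p + q = n → V p →ₗ[k] W q →ₗ[k] M) {p q : ℤ} (h : p + q = n)
    (v : V p) (w : W q) : GTensor.lift φ (GTensor.mk h v w) = φ p q h v w :=
  (DirectSum.toModule_lof k (φ := fun i : {i : ℤ × ℤ // i.1 + i.2 = n} =>
    TensorProduct.lift (φ i.1.1 i.1.2 i.2)) ⟨(p, q), h⟩ (v ⊗ₜ[k] w)).trans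
      (TensorProduct.lift.tmul _ _)

theorem GTensor.induction {n : ℤ} {P : GTensor k V W n → Prop}
    (hmk : ∀ (p q : ℤ) (h : p + q = n) (v : V p) (w : W q), P (GTensor.mk h v w))
    (hadd : ∀ x y, P x → P y → P (x + y)) (x : GTensor k V W n) : P x := by
  have h0 : P 0 := by
    have := hmk 0 n (by simp) 0 0
    simpa using this
  induction x using DirectSum.induction_on with
  | zero => exact h0
  | of i x =>
    obtain ⟨⟨p, q⟩, h⟩ := i
    induction x using TensorProduct.induction_on with
    | zero => rw [map_zero]; exact h0
    | tmul v w => exact hmk p q h v w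
    | add x y hx hy => rw [map_add]; exact hadd _ _ hx hy
  | add x y hx hy => exact hadd _ _ hx hy

end GTensor

/-! ### Dg categories -/

/-- A (small) dg category over the field `k`: objects, graded vector spaces of morphisms with a
differential of degree `1`, and associative unital composition satisfying the graded Leibniz rule.
Here `comp h g f` is the composition `g ∘ f`, where `g` has degree `p`, `f` has degree `q`, and
`h : p + q = n`. -/
structure DGCat (k : Type u) [Field k] : Type (u + 1) where
  Obj : Type u
  Hom : Obj → Obj → ℤ → Type u
  [addCommGroup : ∀ X Y n, AddCommGroup (Hom X Y n)]
  [module : ∀ X Y n, Module k (Hom X Y n)]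
  d : ∀ {X Y : Obj} {p q : ℤ}, p + 1 = q → Hom X Y p →ₗ[k] Hom X Y q
  id : ∀ X : Obj, Hom X X 0
  comp : ∀ {X Y Z : Obj} {p q n : ℤ}, p + q = n →
    Hom Y Z p →ₗ[k] Hom X Y q →ₗ[k] Hom X Z n
  d_d : ∀ {X Y : Obj} {p q r : ℤ} (h : p + 1 = q) (h' : q + 1 = r) (f : Hom X Y p),
    d h' (d h f) = 0
  id_comp : ∀ {X Y : Obj} {p : ℤ} (h : 0 + p = p) (f : Hom X Y p), comp h (id Y) f = f
  comp_id : ∀ {X Y : Obj} {p : ℤ} (h : p + 0 = p) (f : Hom X Y p), comp h f (id X) = f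
  assoc : ∀ {X Y Z T : Obj} {p q r pq qr n : ℤ} (hpq : p + q = pq) (hqr : q + r = qr)
    (h : pq + r = n) (h' : p + qr = n) (f : Hom Z T p) (g : Hom Y Z q) (e : Hom X Y r),
    comp h (comp hpq f g) e = comp h' f (comp hqr g e)
  leibniz : ∀ {X Y Z : Obj} {p q n p' q' n' : ℤ} (h : p + q = n) (hn : n + 1 = n')
    (hp : p + 1 = p') (hq : q + 1 = q') (h₁ : p' + q = n') (h₂ : p + q' = n')
    (f : Hom Y Z p) (g : Hom X Y q),
    d hn (comp h f g) = comp h₁ (d hp f) g + koszulSign k p • comp h₂ f (d hq g)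

attribute [instance] DGCat.addCommGroup DGCat.module

/-- A dg functor between dg categories. -/
structure DGFunctor {k : Type u} [Field k] (A B : DGCat.{u} k) : Type u where
  obj : A.Obj → B.Obj
  map : ∀ {X Y : A.Obj} {p : ℤ}, A.Hom X Y p →ₗ[k] B.Hom (obj X) (obj Y) p
  map_d : ∀ {X Y : A.Obj} {p q : ℤ} (h : p + 1 = q) (f : A.Hom X Y p),
    map (A.d h f) = B.d h (map f)
  map_id : ∀ X : A.Obj, map (A.id X) = B.id (obj X)
  map_comp : ∀ {X Y Z : A.Obj} {p q n : ℤ} (h : p + q = n) (f : A.Hom Y Z p) (g : A.Hom X Y q),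
    map (A.comp h f g) = B.comp h (map f) (map g)

namespace DGCat

variable {k : Type u} [Field k]

/-- The identity dg functor. -/
def idFunctor (A : DGCat.{u} k) : DGFunctor A A where
  obj X := X
  map := LinearMap.id
  map_d _ _ := rfl
  map_id _ := rfl
  map_comp _ _ _ := rfl

/-- The full dg subcategory on the objects satisfying `P`. -/
abbrev full (A : DGCat.{u} k) (P : A.Obj → Prop) : DGCat.{u} k where
  Obj := {X : A.Obj // P X}
  Hom X Y n := A.Hom X.1 Y.1 n
  d h := A.d h
  id X := A.id X.1
  comp h := A.comp h
  d_d := A.d_d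
  id_comp := A.id_comp
  comp_id := A.comp_id
  assoc := A.assoc
  leibniz := A.leibniz

/-- The inclusion of a full dg subcategory. -/
def fullIncl (A : DGCat.{u} k) (P : A.Obj → Prop) : DGFunctor (A.full P) A where
  obj X := X.1
  map := LinearMap.id
  map_d _ _ := rfl
  map_id _ := rfl
  map_comp _ _ _ := rfl

/-- The opposite dg category, with composition `g ∘ᵒᵖ f = (-1)^{|g||f|} f ∘ g`. -/
abbrev op (A : DGCat.{u} k) : DGCat.{u} k where
  Obj := A.Obj
  Hom X Y n := A.Hom Y X n
  d h := A.d h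
  id X := A.id X
  comp {X Y Z} {p q n} h :=
    koszulSign k (p * q) • (A.comp (X := Z) (Y := Y) (Z := X) ((add_comm q p).trans h)).flip
  d_d := A.d_d
  id_comp h f := by simp [koszulSign_zero, A.comp_id]
  comp_id h f := by simp [koszulSign_zero, A.id_comp]
  assoc {X Y Z T} {p q r pq qr n} hpq hqr h h' f g e := by
    subst hpq hqr
    simp only [LinearMap.smul_apply, LinearMap.flip_apply, map_smul, smul_smul, koszulSign_mul]
    rw [← A.assoc (pq := q + r) (qr := p + q) (by omega) (by omega) (by omega) (by omega) e g f]
    congr 2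
    ring
  leibniz {X Y Z} {p q n p' q' n'} h hn hp hq h₁ h₂ f g := by
    simp only [LinearMap.smul_apply, LinearMap.flip_apply, map_smul, smul_smul, koszulSign_mul]
    rw [A.leibniz _ hn hq hp (by omega) (by omega) g f, smul_add, smul_smul, koszulSign_mul,
      add_comm]
    subst hp hq
    congr 2
    · congr 1; ring
    · refine koszulSign_congr ⟨-p, by ring⟩

/-- The differential on morphisms of the tensor product of two dg categories:
`d (f ⊗ g) = d f ⊗ g + (-1)^{|f|} f ⊗ d g`. -/
def tensorD (A B : DGCat.{u} k) (X Y : A.Obj × B.Obj) {n n' : ℤ} (hn : n + 1 = n') :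
    GTensor k (A.Hom X.1 Y.1) (B.Hom X.2 Y.2) n →ₗ[k]
      GTensor k (A.Hom X.1 Y.1) (B.Hom X.2 Y.2) n' :=
  GTensor.lift fun p q h =>
    (GTensor.mk (by omega : (p + 1) + q = n')).comp (A.d rfl) +
      koszulSign k p • (GTensor.mk (by omega : p + (q + 1) = n')).compl₂ (B.d rfl)

theorem tensorD_mk (A B : DGCat.{u} k) (X Y : A.Obj × B.Obj) {n n' p q p' q' : ℤ}
    (hn : n + 1 = n') (h : p + q = n) (hp : p + 1 = p') (hq : q + 1 = q')
    (h₁ : p' + q = n') (h₂ : p + q' = n') (f : A.Hom X.1 Y.1 p) (g : B.Hom X.2 Y.2 q) :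
    A.tensorD B X Y hn (GTensor.mk h f g) =
      GTensor.mk h₁ (A.d hp f) g + koszulSign k p • GTensor.mk h₂ f (B.d hq g) := by
  subst hp hq
  simp [tensorD, GTensor.lift_mk]

/-- Composition in the tensor product of two dg categories:
`(f ⊗ g) ∘ (f' ⊗ g') = (-1)^{|g||f'|} (f ∘ f') ⊗ (g ∘ g')`. -/
def tensorComp (A B : DGCat.{u} k) (X Y Z : A.Obj × B.Obj) {m n l : ℤ} (hl : m + n = l) :
    GTensor k (A.Hom Y.1 Z.1) (B.Hom Y.2 Z.2) m →ₗ[k]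
      GTensor k (A.Hom X.1 Y.1) (B.Hom X.2 Y.2) n →ₗ[k]
        GTensor k (A.Hom X.1 Z.1) (B.Hom X.2 Z.2) l :=
  GTensor.lift fun p q h => LinearMap.mk₂ k
    (fun f g => GTensor.lift fun p' q' h' => koszulSign k (q * p') •
      (GTensor.mk (by omega : (p + p') + (q + q') = l)).compl₁₂ (A.comp rfl f) (B.comp rfl g))
    (fun f₁ f₂ g => by
      refine LinearMap.ext fun x => ?_
      induction x using GTensor.induction with
      | hmk p' q' h' v w => simp [GTensor.lift_mk]
      | hadd x y hx hy =>
        exact (LinearMap.map_add _ x y).trans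
          ((congrArg₂ (· + ·) hx hy).trans (LinearMap.map_add _ x y).symm))
    (fun c f g => by
      refine LinearMap.ext fun x => ?_
      induction x using GTensor.induction with
      | hmk p' q' h' v w => simp [GTensor.lift_mk, smul_comm c]
      | hadd x y hx hy =>
        exact (LinearMap.map_add _ x y).trans
          ((congrArg₂ (· + ·) hx hy).trans (LinearMap.map_add _ x y).symm))
    (fun f g₁ g₂ => by
      refine LinearMap.ext fun x => ?_
      induction x using GTensor.induction with
      | hmk p' q' h' v w => simp [GTensor.lift_mk]
      | hadd x y hx hy =>
        exact (LinearMap.map_add _ x y).trans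
          ((congrArg₂ (· + ·) hx hy).trans (LinearMap.map_add _ x y).symm))
    (fun c f g => by
      refine LinearMap.ext fun x => ?_
      induction x using GTensor.induction with
      | hmk p' q' h' v w => simp [GTensor.lift_mk, smul_comm c]
      | hadd x y hx hy =>
        exact (LinearMap.map_add _ x y).trans
          ((congrArg₂ (· + ·) hx hy).trans (LinearMap.map_add _ x y).symm))

theorem tensorComp_mk (A B : DGCat.{u} k) (X Y Z : A.Obj × B.Obj)
    {m n l p q p' q' p'' q'' : ℤ} (hl : m + n = l) (h : p + q = m) (h' : p' + q' = n)
    (hp : p + p' = p'') (hq : q + q' = q'') (h'' : p'' + q'' = l)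
    (f : A.Hom Y.1 Z.1 p) (g : B.Hom Y.2 Z.2 q) (f' : A.Hom X.1 Y.1 p') (g' : B.Hom X.2 Y.2 q') :
    A.tensorComp B X Y Z hl (GTensor.mk h f g) (GTensor.mk h' f' g') =
      koszulSign k (q * p') • GTensor.mk h'' (A.comp hp f f') (B.comp hq g g') := by
  subst hp hq
  simp [tensorComp, GTensor.lift_mk]

/-- The tensor product `A ⊗ B` of two dg categories: objects are pairs, and the complex of
morphisms from `X` to `Y` is the tensor product of the complexes `A(X.1, Y.1)` and
`B(X.2, Y.2)`. -/
abbrev tensor (A B : DGCat.{u} k) : DGCat.{u} k where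
  Obj := A.Obj × B.Obj
  Hom X Y n := GTensor k (A.Hom X.1 Y.1) (B.Hom X.2 Y.2) n
  d {X Y} _ _ h := A.tensorD B X Y h
  id X := GTensor.mk (add_zero 0) (A.id X.1) (B.id X.2)
  comp {X Y Z} _ _ _ h := A.tensorComp B X Y Z h
  d_d {X Y} {n n' n''} hn hn' x := by
    subst hn hn'
    induction x using GTensor.induction with
    | hmk p q h v w =>
      rw [A.tensorD_mk B X Y _ _ rfl rfl (by omega) (by omega), map_add, map_smul,
        A.tensorD_mk B X Y _ _ rfl rfl (by omega) (by omega),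
        A.tensorD_mk B X Y _ _ rfl rfl (by omega) (by omega)]
      simp only [A.d_d, B.d_d, koszulSign_succ, map_zero, LinearMap.zero_apply, smul_zero,
        zero_add, add_zero]
      rw [neg_smul, neg_add_cancel]
    | hadd x y hx hy => simp only [map_add, hx, hy, add_zero]
  id_comp {X Y} {n} hn x := by
    induction x using GTensor.induction with
    | hmk p q h v w =>
      rw [A.tensorComp_mk B X Y Y hn _ h (zero_add p) (zero_add q) h, A.id_comp, B.id_comp]
      simp [koszulSign_zero]
    | hadd x y hx hy => simp only [map_add, hx, hy]
  comp_id {X Y} {n} hn x := by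
    induction x using GTensor.induction with
    | hmk p q h v w =>
      rw [A.tensorComp_mk B X X Y hn h _ (add_zero p) (add_zero q) h, A.comp_id, B.comp_id]
      simp [koszulSign_zero]
    | hadd x y hx hy => simp only [map_add, LinearMap.add_apply, hx, hy]
  assoc {X Y Z T} {a b c ab bc n} hab hbc hn hn' x y z := by
    induction x using GTensor.induction with
    | hadd x x' hx hx' => simp only [map_add, LinearMap.add_apply, hx, hx']
    | hmk p₁ q₁ h₁ v₁ w₁ =>
      induction y using GTensor.induction with
      | hadd y y' hy hy' => simp only [map_add, LinearMap.add_apply, hy, hy']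
      | hmk p₂ q₂ h₂ v₂ w₂ =>
        induction z using GTensor.induction with
        | hadd z z' hz hz' => simp only [map_add, hz, hz']
        | hmk p₃ q₃ h₃ v₃ w₃ =>
          rw [A.tensorComp_mk B Y Z T hab h₁ h₂ rfl rfl (by omega),
            A.tensorComp_mk B X Y Z hbc h₂ h₃ rfl rfl (by omega)]
          simp only [map_smul, LinearMap.smul_apply]
          rw [A.tensorComp_mk B X Y T hn _ h₃ rfl rfl (by omega),
            A.tensorComp_mk B X Z T hn' h₁ _ (add_assoc p₁ p₂ p₃).symm (add_assoc q₁ q₂ q₃).symm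
              (by omega),
            A.assoc rfl rfl rfl (by omega), B.assoc rfl rfl rfl (by omega),
            smul_smul, smul_smul, koszulSign_mul, koszulSign_mul]
          congr 2
          ring
  leibniz {X Y Z} {a b n a' b' n'} h hn ha hb h₁ h₂ x y := by
    induction x using GTensor.induction with
    | hadd x x' hx hx' =>
      simp only [map_add, LinearMap.add_apply, hx, hx', smul_add]; abel
    | hmk p q h v w =>
      induction y using GTensor.induction with
      | hadd y y' hy hy' => simp only [map_add, hy, hy', smul_add]; abel
      | hmk p' q' h' v' w' =>
        rw [A.tensorComp_mk B X Y Z _ h h' rfl rfl (by omega), map_smul,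
          A.tensorD_mk B X Z hn _ rfl rfl (by omega) (by omega),
          A.tensorD_mk B Y Z ha h rfl rfl (by omega) (by omega),
          A.tensorD_mk B X Y hb h' rfl rfl (by omega) (by omega),
          A.leibniz rfl rfl rfl rfl (by omega) (by omega),
          B.leibniz rfl rfl rfl rfl (by omega) (by omega)]
        simp only [map_add, map_smul, LinearMap.add_apply, LinearMap.smul_apply, smul_add,
          smul_smul]
        rw [A.tensorComp_mk B X Y Z h₁ _ h' (p'' := p + p' + 1) (q'' := q + q')
            (by omega) rfl (by omega),
          A.tensorComp_mk B X Y Z h₁ _ h' (p'' := p + p') (q'' := q + q' + 1)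
            rfl (by omega) (by omega),
          A.tensorComp_mk B X Y Z h₂ h _ (p'' := p + p' + 1) (q'' := q + q')
            (by omega) rfl (by omega),
          A.tensorComp_mk B X Y Z h₂ h _ (p'' := p + p') (q'' := q + q' + 1)
            rfl (by omega) (by omega)]
        have hs : koszulSign k a = koszulSign k (p + q) := by rw [h]
        simp only [smul_smul, hs, koszulSign_mul]
        rw [koszulSign_congr (k := k) (m := p + (q + 1) * p') (n := q * p' + (p + p'))
            ⟨0, by ring⟩,
          koszulSign_congr (k := k) (m := p + q + q * (p' + 1)) (n := q * p' + p)
            ⟨q, by ring⟩,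
          koszulSign_congr (k := k) (m := p + q + p' + q * p') (n := q * p' + (p + p' + q))
            ⟨0, by ring⟩]
        rw [add_add_add_comm]

end DGCat

/-! ### Dg modules, the homotopy category and the derived category -/

/-- A (right) dg module over the dg category `A`, that is, a dg functor from `Aᵒᵖ` to the dg
category of complexes: a complex `X a` for each object `a`, together with an action
`act h m f = m · f` of morphisms `f` of `A` that is compatible with composition and satisfies
the graded Leibniz rule. -/
structure DGModule {k : Type u} [Field k] (A : DGCat.{u} k) : Type (u + 1) where
  X : A.Obj → ℤ → Type u
  [addCommGroup : ∀ a n, AddCommGroup (X a n)]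
  [module : ∀ a n, Module k (X a n)]
  d : ∀ {a : A.Obj} {p q : ℤ}, p + 1 = q → X a p →ₗ[k] X a q
  act : ∀ {a b : A.Obj} {p q n : ℤ}, p + q = n → X b p →ₗ[k] A.Hom a b q →ₗ[k] X a n
  d_d : ∀ {a : A.Obj} {p q r : ℤ} (h : p + 1 = q) (h' : q + 1 = r) (m : X a p),
    d h' (d h m) = 0
  act_id : ∀ {a : A.Obj} {p : ℤ} (h : p + 0 = p) (m : X a p), act h m (A.id a) = m
  act_act : ∀ {a b c : A.Obj} {p q r pq qr n : ℤ} (hpq : p + q = pq) (hqr : q + r = qr)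
    (h : pq + r = n) (h' : p + qr = n) (m : X c p) (f : A.Hom b c q) (g : A.Hom a b r),
    act h (act hpq m f) g = act h' m (A.comp hqr f g)
  leibniz : ∀ {a b : A.Obj} {p q n p' q' n' : ℤ} (h : p + q = n) (hn : n + 1 = n')
    (hp : p + 1 = p') (hq : q + 1 = q') (h₁ : p' + q = n') (h₂ : p + q' = n')
    (m : X b p) (f : A.Hom a b q),
    d hn (act h m f) = act h₁ (d hp m) f + koszulSign k p • act h₂ m (A.d hq f)

attribute [instance] DGModule.addCommGroup DGModule.module

namespace DGModule

variable {k : Type u} [Field k] {A : DGCat.{u} k}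

/-- A closed morphism of degree zero between dg modules. -/
@[ext]
structure Hom (M N : DGModule A) : Type u where
  app : ∀ (a : A.Obj) (p : ℤ), M.X a p →ₗ[k] N.X a p
  app_d : ∀ {a : A.Obj} {p q : ℤ} (h : p + 1 = q) (m : M.X a p),
    app a q (M.d h m) = N.d h (app a p m)
  app_act : ∀ {a b : A.Obj} {p q n : ℤ} (h : p + q = n) (m : M.X b p) (f : A.Hom a b q),
    app a n (M.act h m f) = N.act h (app b p m) f

namespace Hom

variable {M N : DGModule A}

instance : Zero (Hom M N) := ⟨⟨fun _ _ => 0, by simp, by simp⟩⟩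

instance : Add (Hom M N) :=
  ⟨fun f g => ⟨fun a p => f.app a p + g.app a p, by simp [f.app_d, g.app_d],
    by simp [f.app_act, g.app_act]⟩⟩

instance : Neg (Hom M N) :=
  ⟨fun f => ⟨fun a p => -f.app a p, by simp [f.app_d], by simp [f.app_act]⟩⟩

instance : AddCommGroup (Hom M N) where
  add_assoc f g h := by ext a p m; exact add_assoc (f.app a p m) _ _
  zero_add f := by ext a p m; exact zero_add (f.app a p m)
  add_zero f := by ext a p m; exact add_zero (f.app a p m)
  add_comm f g := by ext a p m; exact add_comm (f.app a p m) _
  neg_add_cancel f := by ext a p m; exact neg_add_cancel (f.app a p m)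
  nsmul := nsmulRec
  zsmul := zsmulRec

end Hom

/-- The category of dg `A`-modules, with the closed morphisms of degree zero. -/
instance : Category (DGModule A) where
  Hom M N := Hom M N
  id M := ⟨fun _ _ => LinearMap.id, fun _ _ => rfl, fun _ _ _ => rfl⟩
  comp f g := ⟨fun a p => g.app a p ∘ₗ f.app a p, by simp [f.app_d, g.app_d],
    by simp [f.app_act, g.app_act]⟩

instance : Preadditive (DGModule A) where
  homGroup M N := inferInstanceAs (AddCommGroup (Hom M N))
  add_comp _ _ _ f f' g := Hom.ext (by
    funext a p; exact LinearMap.comp_add (f.app a p) (f'.app a p) (g.app a p))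
  comp_add _ _ _ f g g' := Hom.ext (by
    funext a p; exact LinearMap.add_comp (f.app a p) (g'.app a p) (g.app a p))

theorem add_app {M N : DGModule A} (f g : M ⟶ N) (a : A.Obj) (p : ℤ) (m : M.X a p) :
    (f + g).app a p m = f.app a p m + g.app a p m := rfl

theorem neg_app {M N : DGModule A} (f : M ⟶ N) (a : A.Obj) (p : ℤ) (m : M.X a p) :
    (-f).app a p m = -f.app a p m := rfl

theorem zero_app {M N : DGModule A} (a : A.Obj) (p : ℤ) (m : M.X a p) :
    (0 : M ⟶ N).app a p m = 0 := rfl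

theorem sub_app {M N : DGModule A} (f g : M ⟶ N) (a : A.Obj) (p : ℤ) (m : M.X a p) :
    (f - g).app a p m = f.app a p m - g.app a p m := by
  rw [sub_eq_add_neg, add_app, neg_app, sub_eq_add_neg]

theorem comp_app {M N P : DGModule A} (f : M ⟶ N) (g : N ⟶ P) (a : A.Obj) (p : ℤ)
    (m : M.X a p) : (f ≫ g).app a p m = g.app a p (f.app a p m) := rfl

theorem id_app {M : DGModule A} (a : A.Obj) (p : ℤ) (m : M.X a p) :
    Hom.app (𝟙 M) a p m = m := rfl

/-- A morphism `s` of degree `-1` between dg modules (not necessarily closed). -/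
@[ext]
structure DegNegOne (M N : DGModule A) : Type u where
  app : ∀ (a : A.Obj) {p q : ℤ}, q + 1 = p → M.X a p →ₗ[k] N.X a q
  app_act : ∀ {a b : A.Obj} {p q n p' n' : ℤ} (h : p + q = n) (hp : p' + 1 = p)
    (hn : n' + 1 = n) (h' : p' + q = n') (m : M.X b p) (f : A.Hom a b q),
    app a hn (M.act h m f) = N.act h' (app b hp m) f

/-- `f` is null-homotopic if it is a boundary `d s + s d` in the complex of morphisms. -/
def IsNullHomotopic {M N : DGModule A} (f : M ⟶ N) : Prop :=
  ∃ s : DegNegOne M N, ∀ (a : A.Obj) {p q r : ℤ} (hq : q + 1 = p) (hr : p + 1 = r) (m : M.X a p),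
    f.app a p m = N.d hq (s.app a hq m) + s.app a hr (M.d hr m)

namespace IsNullHomotopic

variable {M N P : DGModule A}

theorem zero : IsNullHomotopic (0 : M ⟶ N) :=
  ⟨⟨fun _ _ _ _ => 0, by simp⟩, by simp [zero_app]⟩

theorem add {f g : M ⟶ N} (hf : IsNullHomotopic f) (hg : IsNullHomotopic g) :
    IsNullHomotopic (f + g) := by
  obtain ⟨s, hs⟩ := hf
  obtain ⟨t, ht⟩ := hg
  refine ⟨⟨fun a _ _ h => s.app a h + t.app a h, ?_⟩, ?_⟩
  · intro a b p q n p' n' h hp hn h' m x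
    simp [s.app_act h hp hn h', t.app_act h hp hn h']
  · intro a p q r hq hr m
    rw [add_app, hs a hq hr, ht a hq hr]
    simp only [LinearMap.add_apply, map_add]
    abel

theorem neg {f : M ⟶ N} (hf : IsNullHomotopic f) : IsNullHomotopic (-f) := by
  obtain ⟨s, hs⟩ := hf
  refine ⟨⟨fun a _ _ h => -s.app a h, ?_⟩, ?_⟩
  · intro a b p q n p' n' h hp hn h' m x
    simp [s.app_act h hp hn h']
  · intro a p q r hq hr m
    rw [neg_app, hs a hq hr]
    simp only [LinearMap.neg_apply, map_neg]
    abel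

theorem comp_left (f : M ⟶ N) {g : N ⟶ P} (hg : IsNullHomotopic g) :
    IsNullHomotopic (f ≫ g) := by
  obtain ⟨s, hs⟩ := hg
  refine ⟨⟨fun a p _ h => s.app a h ∘ₗ f.app a p, ?_⟩, ?_⟩
  · intro a b p q n p' n' h hp hn h' m x
    simp [f.app_act, s.app_act h hp hn h']
  · intro a p q r hq hr m
    rw [comp_app, hs a hq hr]
    simp [f.app_d]

theorem comp_right {f : M ⟶ N} (g : N ⟶ P) (hf : IsNullHomotopic f) :
    IsNullHomotopic (f ≫ g) := by
  obtain ⟨s, hs⟩ := hf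
  refine ⟨⟨fun a _ q h => g.app a q ∘ₗ s.app a h, ?_⟩, ?_⟩
  · intro a b p q n p' n' h hp hn h' m x
    simp [g.app_act, s.app_act h hp hn h']
  · intro a p q r hq hr m
    rw [comp_app, hs a hq hr]
    simp [g.app_d]

end IsNullHomotopic

/-- Two closed morphisms of degree zero are homotopic if their difference is a boundary. -/
def homotopic (A : DGCat.{u} k) : HomRel (DGModule A) :=
  fun _ _ f g => IsNullHomotopic (f - g)

instance : Congruence (homotopic A) where
  equivalence :=
    { refl := fun f => by simpa [homotopic] using IsNullHomotopic.zero
      symm := fun {f g} h => by simpa [homotopic] using h.neg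
      trans := fun {f g e} h h' => by simpa [homotopic] using h.add h' }
  comp_left f _ _ h := by simpa [homotopic, Preadditive.comp_sub] using h.comp_left f
  comp_right g h := by simpa [homotopic, Preadditive.sub_comp] using h.comp_right g

/-- `f` is a quasi-isomorphism: for every object `a` and every degree it induces a surjective
and injective map on the cohomology (cocycles modulo coboundaries) of the complexes at `a`. -/
structure IsQuasiIso {M N : DGModule A} (f : M ⟶ N) : Prop where
  surj : ∀ (a : A.Obj) {p q r : ℤ} (hq : q + 1 = p) (hr : p + 1 = r) (y : N.X a p),
    N.d hr y = 0 → ∃ (x : M.X a p) (z : N.X a q), M.d hr x = 0 ∧ y = f.app a p x + N.d hq z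
  inj : ∀ (a : A.Obj) {p q r : ℤ} (hq : q + 1 = p) (hr : p + 1 = r) (x : M.X a p) (z : N.X a q),
    M.d hr x = 0 → f.app a p x = N.d hq z → ∃ w : M.X a q, x = M.d hq w

end DGModule

/-- The homotopy category `[dgMod A]`: its objects are the dg `A`-modules, and its morphisms are
the homotopy classes of closed morphisms of degree zero. -/
def DGCat.HomotopyCat {k : Type u} [Field k] (A : DGCat.{u} k) : Type (u + 1) :=
  CategoryTheory.Quotient (DGModule.homotopic A)

namespace DGModule

variable {k : Type u} [Field k] {A : DGCat.{u} k}

instance : Category A.HomotopyCat :=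
  inferInstanceAs (Category (CategoryTheory.Quotient (homotopic A)))

/-- The functor from the category of dg modules to the homotopy category. -/
def toHomotopyCat (A : DGCat.{u} k) : DGModule A ⥤ A.HomotopyCat :=
  CategoryTheory.Quotient.functor (homotopic A)

theorem homotopic_add ⦃M N : DGModule A⦄ (f₁ f₂ g₁ g₂ : M ⟶ N) (hf : homotopic A f₁ f₂)
    (hg : homotopic A g₁ g₂) : homotopic A (f₁ + g₁) (f₂ + g₂) := by
  have := hf.add hg
  rwa [show f₁ - f₂ + (g₁ - g₂) = f₁ + g₁ - (f₂ + g₂) by abel] at this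

instance : Preadditive A.HomotopyCat :=
  CategoryTheory.Quotient.preadditive (homotopic A) homotopic_add

instance : (toHomotopyCat A).Additive where
  map_add := rfl

theorem toHomotopyCat_map_eq_iff {M N : DGModule A} (f g : M ⟶ N) :
    (toHomotopyCat A).map f = (toHomotopyCat A).map g ↔ IsNullHomotopic (f - g) :=
  CategoryTheory.Quotient.functor_map_eq_iff (homotopic A) f g

/-- The class of quasi-isomorphisms in the homotopy category. -/
def quasiIso (A : DGCat.{u} k) : MorphismProperty A.HomotopyCat :=
  fun M N f => ∃ g : M.as ⟶ N.as, f = (toHomotopyCat A).map g ∧ IsQuasiIso g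

namespace IsQuasiIso

theorem id (M : DGModule A) : IsQuasiIso (𝟙 M) where
  surj a p q r hq hr y hy := ⟨y, 0, hy, by simp [id_app]⟩
  inj a p q r hq hr x z hx h := ⟨z, h⟩

theorem comp {M N P : DGModule A} {f : M ⟶ N} {g : N ⟶ P} (hf : IsQuasiIso f)
    (hg : IsQuasiIso g) : IsQuasiIso (f ≫ g) where
  surj a p q r hq hr y hy := by
    obtain ⟨x, z, hx, rfl⟩ := hg.surj a hq hr y hy
    obtain ⟨x', z', hx', rfl⟩ := hf.surj a hq hr x hx
    refine ⟨x', g.app a q z' + z, hx', ?_⟩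
    simp only [comp_app, map_add, g.app_d]
    abel
  inj a p q r hq hr x z hx h := by
    obtain ⟨w, hw⟩ := hg.inj a hq hr (f.app a p x) z (by rw [← f.app_d, hx, map_zero]) h
    exact hf.inj a hq hr x w hx hw

end IsQuasiIso

section Calculus

variable {M' M N : DGModule A}

/-- `f.app a p` with values in degree `q = p`. -/
def Hom.appCast (f : Hom M N) (a : A.Obj) {p q : ℤ} (h : p = q) : M.X a p →ₗ[k] N.X a q :=
  h ▸ f.app a p

theorem Hom.appCast_rfl (f : Hom M N) (a : A.Obj) (p : ℤ) : f.appCast a (rfl : p = p) = f.app a p :=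
  rfl

theorem Hom.appCast_act (f : Hom M N) {a b : A.Obj} {p q n p' n' : ℤ} (h : p + q = n)
    (hp : p = p') (hn : n = n') (h' : p' + q = n') (m : M.X b p) (x : A.Hom a b q) :
    f.appCast a hn (M.act h m x) = N.act h' (f.appCast b hp m) x := by
  subst hp hn
  exact f.app_act h m x

/-- The homotopy pushout of `f : M' ⟶ N` and `s : M' ⟶ M`. -/
def hoPushout (f : Hom M' N) (s : Hom M' M) : DGModule A where
  X a p := M'.X a (p + 1) × M.X a p × N.X a p
  d {a p q} h :=
    { toFun := fun x => (-M'.d (by omega) x.1,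
        M.d h x.2.1 + s.appCast a h x.1, N.d h x.2.2 - f.appCast a h x.1)
      map_add' := fun x y => by
        ext <;> simp only [Prod.fst_add, Prod.snd_add, map_add] <;> abel
      map_smul' := fun c x => by
        ext <;> simp [smul_add, smul_sub] }
  act {a b p q n} h := LinearMap.mk₂ k
    (fun x y => (M'.act (by omega) x.1 y, M.act h x.2.1 y, N.act h x.2.2 y))
    (by intros; ext <;> simp) (by intros; ext <;> simp) (by intros; ext <;> simp)
    (by intros; ext <;> simp)
  d_d {a p q r} h h' x := by
    subst h h'
    ext
    · simp [M'.d_d]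
    · simp [M.d_d, s.app_d, Hom.appCast_rfl]
    · simp [N.d_d, f.app_d, Hom.appCast_rfl]
  act_id h x := by
    ext <;> simp [M'.act_id, M.act_id, N.act_id]
  act_act hpq hqr h h' m f g := by
    ext
    · exact M'.act_act _ _ _ _ _ _ _
    · exact M.act_act _ _ _ _ _ _ _
    · exact N.act_act _ _ _ _ _ _ _
  leibniz {a b p q n p' q' n'} h hn hp hq h₁ h₂ m x := by
    ext
    · simp only [LinearMap.coe_mk, AddHom.coe_mk, LinearMap.mk₂_apply, Prod.fst_add,
        Prod.smul_fst]
      rw [M'.leibniz (p' := p' + 1) _ _ (by omega) hq (by omega) (by omega), koszulSign_succ]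
      simp only [map_neg, LinearMap.neg_apply, neg_smul]
      abel
    · simp only [LinearMap.coe_mk, AddHom.coe_mk, LinearMap.mk₂_apply, Prod.snd_add, Prod.fst_add,
        Prod.smul_snd, Prod.smul_fst, map_add, LinearMap.add_apply]
      rw [M.leibniz h hn hp hq h₁ h₂, s.appCast_act _ hp hn h₁]
      abel
    · simp only [LinearMap.coe_mk, AddHom.coe_mk, LinearMap.mk₂_apply, Prod.snd_add,
        Prod.smul_snd, map_sub, LinearMap.sub_apply]
      rw [N.leibniz h hn hp hq h₁ h₂, f.appCast_act _ hp hn h₁]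
      abel

/-- The canonical morphism from `N` to the homotopy pushout. -/
def hoPushoutInr (f : Hom M' N) (s : Hom M' M) : N ⟶ hoPushout f s :=
  Hom.mk (fun _ _ => LinearMap.inr k _ _ ∘ₗ LinearMap.inr k _ _)
    (fun {a p q} h m => Prod.ext (show (0 : M'.X a (q + 1)) = -M'.d _ 0 by simp)
      (Prod.ext (show (0 : M.X a q) = M.d h 0 + s.appCast a h 0 by simp)
        (show N.d h m = N.d h m - f.appCast a h 0 by simp)))
    (fun {a b p q n} h m x => Prod.ext
      (show (0 : M'.X a (n + 1)) = M'.act (by omega) (0 : M'.X b (p + 1)) x by simp)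
      (Prod.ext (show (0 : M.X a n) = M.act h 0 x by simp) rfl))

/-- The canonical morphism from `M` to the homotopy pushout. -/
def hoPushoutInl (f : Hom M' N) (s : Hom M' M) : M ⟶ hoPushout f s :=
  Hom.mk (fun _ _ => LinearMap.inr k _ _ ∘ₗ LinearMap.inl k _ _)
    (fun {a p q} h m => Prod.ext (show (0 : M'.X a (q + 1)) = -M'.d _ 0 by simp)
      (Prod.ext (show M.d h m = M.d h m + s.appCast a h 0 by simp)
        (show (0 : N.X a q) = N.d h 0 - f.appCast a h 0 by simp)))
    (fun {a b p q n} h m x => Prod.ext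
      (show (0 : M'.X a (n + 1)) = M'.act (by omega) (0 : M'.X b (p + 1)) x by simp)
      (Prod.ext rfl (show (0 : N.X a n) = N.act h 0 x by simp)))

theorem hoPushout_comm (f : M' ⟶ N) (s : M' ⟶ M) :
    IsNullHomotopic (s ≫ hoPushoutInl f s - f ≫ hoPushoutInr f s) := by
  refine ⟨⟨fun a p q h => LinearMap.inl k _ _ ∘ₗ
    (Hom.appCast (𝟙 M') a h.symm : M'.X a p →ₗ[k] M'.X a (q + 1)), ?_⟩, ?_⟩
  · intro a b p q n p' n' h hp hn h' m x
    subst hp hn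
    exact Prod.ext rfl (Prod.ext (show (0 : M.X a n') = M.act h' 0 x by simp)
      (show (0 : N.X a n') = N.act h' 0 x by simp))
  · intro a p q r hq hr m
    subst hq hr
    rw [sub_app]
    refine Prod.ext ?_ (Prod.ext ?_ ?_)
    · show (0 : M'.X a (q + 1 + 1)) - 0 = -M'.d rfl m + M'.d rfl m
      simp
    · show s.app a _ m - 0 = M.d rfl 0 + s.app a _ m + 0
      simp
    · show 0 - f.app a _ m = N.d rfl 0 - f.app a _ m + 0
      simp

theorem isQuasiIso_hoPushoutInr (f : M' ⟶ N) {s : M' ⟶ M} (hs : IsQuasiIso s) :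
    IsQuasiIso (hoPushoutInr f s) where
  surj a p q r hq hr y hy := by
    subst hq hr
    obtain ⟨x', x, y⟩ := y
    have h₁ : -M'.d rfl x' = 0 := congrArg Prod.fst hy
    have h₂ : M.d rfl x + s.app a _ x' = 0 := congrArg (fun t => t.2.1) hy
    have h₃ : N.d rfl y - f.app a _ x' = 0 := congrArg (fun t => t.2.2) hy
    rw [neg_eq_zero] at h₁
    obtain ⟨v, hv⟩ := hs.inj a rfl rfl x' (-x) h₁ (by
      rw [map_neg]; exact eq_neg_of_add_eq_zero_right h₂)
    obtain ⟨u, w, hu, hw⟩ := hs.surj a rfl rfl (x + s.app a _ v) (by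
      rw [map_add, ← s.app_d, ← hv, h₂])
    refine ⟨y + f.app a _ (u - v), (u - v, w, 0), ?_, ?_⟩
    · rw [map_add, ← f.app_d, map_sub, hu, ← hv, zero_sub, map_neg, ← sub_eq_add_neg, h₃]
    · refine Prod.ext ?_ (Prod.ext ?_ ?_)
      · show x' = 0 + -M'.d rfl (u - v)
        rw [map_sub, hu, ← hv]
        abel
      · show x = 0 + (M.d rfl w + s.app a _ (u - v))
        rw [eq_sub_of_add_eq hw, map_sub]
        abel
      · show y = y + f.app a _ (u - v) + (N.d rfl 0 - f.app a _ (u - v))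
        rw [map_zero]
        abel
  inj a p q r hq hr y z hy h := by
    subst hq hr
    obtain ⟨x', x, z⟩ := z
    have h₁ : 0 = -M'.d rfl x' := congrArg Prod.fst h
    have h₂ : 0 = M.d rfl x + s.app a _ x' := congrArg (fun t => t.2.1) h
    have h₃ : y = N.d rfl z - f.app a _ x' := congrArg (fun t => t.2.2) h
    obtain ⟨b, hb⟩ := hs.inj a rfl rfl x' (-x) (by simpa using h₁.symm) (by
      rw [map_neg]; exact eq_neg_of_add_eq_zero_right h₂.symm)
    refine ⟨z - f.app a _ b, ?_⟩
    rw [map_sub, ← f.app_d, ← hb, h₃]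

/-- The cone of the morphism from the cone of `s` to `N` given by `f` and a homotopy `h` from
`0` to `f ∘ s`. -/
def hoCone (s : Hom M' M) (f : Hom M N) (t : DegNegOne M' N)
    (ht : ∀ (a : A.Obj) {p q r : ℤ} (hq : q + 1 = p) (hr : p + 1 = r) (m : M'.X a p),
      f.app a p (s.app a p m) = N.d hq (t.app a hq m) + t.app a hr (M'.d hr m)) :
    DGModule A where
  X a p := M'.X a (p + 1 + 1) × M.X a (p + 1) × N.X a p
  d {a p q} h :=
    { toFun := fun x => (M'.d (by omega) x.1,
        -M.d (by omega) x.2.1 - s.appCast a (by omega) x.1,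
        N.d h x.2.2 + f.appCast a h x.2.1 + t.app a (by omega) x.1)
      map_add' := fun x y => by
        ext <;> simp only [Prod.fst_add, Prod.snd_add, map_add] <;> abel
      map_smul' := fun c x => by
        ext <;> simp [smul_add, smul_sub] }
  act {a b p q n} h := LinearMap.mk₂ k
    (fun x y => (M'.act (by omega) x.1 y, M.act (by omega) x.2.1 y, N.act h x.2.2 y))
    (by intros; ext <;> simp) (by intros; ext <;> simp) (by intros; ext <;> simp)
    (by intros; ext <;> simp)
  d_d {a p q r} h h' x := by
    subst h h'
    ext
    · simp [M'.d_d]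
    · simp [M.d_d, s.app_d, Hom.appCast_rfl]
    · simp [N.d_d, f.app_d, Hom.appCast_rfl, ht a rfl rfl x.1]
      abel
  act_id h x := by
    ext <;> simp [M'.act_id, M.act_id, N.act_id]
  act_act hpq hqr h h' m f g := by
    ext
    · exact M'.act_act _ _ _ _ _ _ _
    · exact M.act_act _ _ _ _ _ _ _
    · exact N.act_act _ _ _ _ _ _ _
  leibniz {a b p q n p' q' n'} h hn hp hq h₁ h₂ m x := by
    ext
    · simp only [LinearMap.coe_mk, AddHom.coe_mk, LinearMap.mk₂_apply, Prod.fst_add,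
        Prod.smul_fst]
      rw [M'.leibniz (p' := p' + 1 + 1) _ _ (by omega) hq (by omega) (by omega), koszulSign_succ,
        koszulSign_succ, neg_neg]
    · simp only [LinearMap.coe_mk, AddHom.coe_mk, LinearMap.mk₂_apply, Prod.snd_add, Prod.fst_add,
        Prod.smul_snd, Prod.smul_fst, map_sub, map_neg, LinearMap.sub_apply, LinearMap.neg_apply]
      rw [M.leibniz (p' := p' + 1) _ _ (by omega) hq (by omega) (by omega), koszulSign_succ,
        s.appCast_act (p' := p' + 1) _ (by omega) _ (by omega), neg_smul]
      abel
    · simp only [LinearMap.coe_mk, AddHom.coe_mk, LinearMap.mk₂_apply, Prod.snd_add,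
        Prod.smul_snd, map_add, LinearMap.add_apply]
      rw [N.leibniz h hn hp hq h₁ h₂, f.appCast_act _ hp hn h₁,
        t.app_act _ (by omega : p' + 1 = p + 1 + 1) _ h₁]
      abel

section

variable (s : Hom M' M) (f : Hom M N) (t : DegNegOne M' N)
  (ht : ∀ (a : A.Obj) {p q r : ℤ} (hq : q + 1 = p) (hr : p + 1 = r) (m : M'.X a p),
    f.app a p (s.app a p m) = N.d hq (t.app a hq m) + t.app a hr (M'.d hr m))

/-- The canonical morphism from `N` to the cone. -/
def hoConeInr : N ⟶ hoCone s f t ht :=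
  Hom.mk (fun _ _ => LinearMap.inr k _ _ ∘ₗ LinearMap.inr k _ _)
    (fun {a p q} h m => Prod.ext (show (0 : M'.X a (q + 1 + 1)) = M'.d _ 0 by simp)
      (Prod.ext (show (0 : M.X a (q + 1)) = -M.d _ 0 - s.appCast a _ 0 by simp)
        (show N.d h m = N.d h m + f.appCast a h 0 + t.app a _ 0 by simp)))
    (fun {a b p q n} h m x => Prod.ext
      (show (0 : M'.X a (n + 1 + 1)) = M'.act (by omega) (0 : M'.X b (p + 1 + 1)) x by simp)
      (Prod.ext (show (0 : M.X a (n + 1)) = M.act (by omega) (0 : M.X b (p + 1)) x by simp) rfl))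

theorem comp_hoConeInr : IsNullHomotopic (CategoryStruct.comp (X := M) (Y := N) f (hoConeInr s f t ht)) := by
  refine ⟨⟨fun a p q h => LinearMap.inr k _ _ ∘ₗ LinearMap.inl k _ _ ∘ₗ
    (Hom.appCast (𝟙 M) a h.symm : M.X a p →ₗ[k] M.X a (q + 1)), ?_⟩, ?_⟩
  · intro a b p q n p' n' h hp hn h' m x
    subst hp hn
    exact Prod.ext (show (0 : M'.X a (n' + 1 + 1)) =
        M'.act (by omega) (0 : M'.X b (p' + 1 + 1)) x by simp)
      (Prod.ext rfl (show (0 : N.X a n') = N.act h' 0 x by simp))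
  · intro a p q r hq hr m
    subst hq hr
    refine Prod.ext ?_ (Prod.ext ?_ ?_)
    · show (0 : M'.X a (q + 1 + 1 + 1)) = M'.d rfl 0 + 0
      simp
    · show (0 : M.X a (q + 1 + 1)) = -M.d rfl m - s.app a _ 0 + M.d rfl m
      simp
    · show f.app a _ m = N.d rfl 0 + f.app a _ m + t.app a rfl 0 + 0
      simp

theorem isQuasiIso_hoConeInr (hs : IsQuasiIso (M := M') (N := M) s) :
    IsQuasiIso (hoConeInr s f t ht) where
  surj a p q r hq hr y hy := by
    subst hq hr
    obtain ⟨x', x, y⟩ := y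
    have h₁ : M'.d rfl x' = 0 := congrArg Prod.fst hy
    have h₂ : -M.d rfl x - s.app a _ x' = 0 := congrArg (fun t => t.2.1) hy
    have h₃ : N.d rfl y + f.app a _ x + t.app a rfl x' = 0 := congrArg (fun t => t.2.2) hy
    have h₂' : s.app a _ x' = -M.d rfl x := (sub_eq_zero.1 h₂).symm
    obtain ⟨v, hv⟩ := hs.inj a rfl rfl x' (-x) h₁ (by rw [map_neg]; exact h₂')
    obtain ⟨u, w, hu, hw⟩ := hs.surj a rfl rfl (x + s.app a _ v) (by
      rw [map_add, ← s.app_d, ← hv, h₂', add_neg_cancel])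
    have hx : x = s.app a _ u + M.d rfl w - s.app a _ v := eq_sub_of_add_eq hw
    refine ⟨y + f.app a _ w - t.app a rfl (v - u), (v - u, -w, 0), ?_, ?_⟩
    · have e := ht a rfl rfl (v - u)
      simp only [map_sub, hu, ← hv, sub_zero] at e
      have e' : N.d rfl y = -(f.app a _ x + t.app a rfl x') :=
        eq_neg_of_add_eq_zero_left (by rw [← add_assoc]; exact h₃)
      simp only [map_sub, map_add, ← f.app_d, e', hx]
      rw [show N.d rfl (t.app a rfl v) - N.d rfl (t.app a rfl u) = _ - _ from
        eq_sub_of_add_eq e.symm]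
      abel
    · refine Prod.ext ?_ (Prod.ext ?_ ?_)
      · show x' = 0 + M'.d rfl (v - u)
        rw [map_sub, hu, ← hv]
        abel
      · show x = 0 + (-M.d rfl (-w) - s.app a _ (v - u))
        rw [map_sub, map_neg, hx]
        abel
      · show y = y + f.app a _ w - t.app a rfl (v - u) +
          (N.d rfl 0 + f.app a _ (-w) + t.app a rfl (v - u))
        rw [map_zero, map_neg]
        abel
  inj a p q r hq hr y z hy h := by
    subst hq hr
    obtain ⟨x', x, z⟩ := z
    have h₁ : 0 = M'.d rfl x' := congrArg Prod.fst h
    have h₂ : 0 = -M.d rfl x - s.app a _ x' := congrArg (fun t => t.2.1) h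
    have h₃ : y = N.d rfl z + f.app a _ x + t.app a rfl x' := congrArg (fun t => t.2.2) h
    have h₂' : s.app a _ x' = -M.d rfl x := (sub_eq_zero.1 h₂.symm).symm
    obtain ⟨b, hb⟩ := hs.inj a rfl rfl x' (-x) h₁.symm (by rw [map_neg]; exact h₂')
    obtain ⟨u, w, hu, hw⟩ := hs.surj a rfl rfl (x + s.app a _ b) (by
      rw [map_add, ← s.app_d, ← hb, h₂', add_neg_cancel])
    have hx : x = s.app a _ u + M.d rfl w - s.app a _ b := eq_sub_of_add_eq hw
    refine ⟨z + f.app a _ w - t.app a rfl (b - u), ?_⟩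
    have e := ht a rfl rfl (b - u)
    simp only [map_sub, hu, ← hb, sub_zero] at e
    rw [h₃, hx]
    simp only [map_sub, map_add, ← f.app_d]
    rw [show N.d rfl (t.app a rfl b) - N.d rfl (t.app a rfl u) = _ - _ from
      eq_sub_of_add_eq e.symm]
    abel

end

end Calculus

instance : (quasiIso A).IsMultiplicative where
  id_mem M := ⟨𝟙 M.as, rfl, .id _⟩
  comp_mem := by
    rintro M N P _ _ ⟨f, rfl, hf⟩ ⟨g, rfl, hg⟩
    exact ⟨f ≫ g, rfl, hf.comp hg⟩

instance : (quasiIso A).HasLeftCalculusOfFractions where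
  exists_leftFraction := by
    rintro ⟨M⟩ ⟨N⟩ φ
    obtain ⟨s, hs, hqs⟩ := φ.hs
    obtain ⟨f, hf⟩ : ∃ f : φ.X'.as ⟶ N, φ.f = (toHomotopyCat A).map f := by
      obtain ⟨f, hf⟩ := Quot.exists_rep φ.f
      exact ⟨f, hf.symm⟩
    refine ⟨⟨(toHomotopyCat A).map (hoPushoutInl f s), (toHomotopyCat A).map (hoPushoutInr f s),
      ⟨_, rfl, isQuasiIso_hoPushoutInr f hqs⟩⟩, ?_⟩
    rw [hs, hf]
    exact ((toHomotopyCat_map_eq_iff _ _).2 (hoPushout_comm f s)).symm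
  ext := by
    rintro ⟨M'⟩ ⟨M⟩ ⟨N⟩ f₁ f₂ _ ⟨s, rfl, hs⟩ h
    obtain ⟨f₁, rfl⟩ := Quot.exists_rep f₁
    obtain ⟨f₂, rfl⟩ := Quot.exists_rep f₂
    obtain ⟨t, ht⟩ : IsNullHomotopic (s ≫ (f₁ - f₂)) := by
      rw [Preadditive.comp_sub]
      exact (toHomotopyCat_map_eq_iff (s ≫ f₁) (s ≫ f₂)).1 h
    refine ⟨_, (toHomotopyCat A).map (hoConeInr s (f₁ - f₂) t ht),
      ⟨_, rfl, isQuasiIso_hoConeInr s (f₁ - f₂) t ht hs⟩, ?_⟩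
    refine (toHomotopyCat_map_eq_iff (f₁ ≫ _) (f₂ ≫ _)).2 ?_
    rw [← Preadditive.sub_comp]
    exact comp_hoConeInr s (f₁ - f₂) t ht

end DGModule

/-- The derived category `D(A) = [dgMod A] / [Ac A]`: the localization of the homotopy category at
the quasi-isomorphisms, which are the morphisms whose cone is acyclic. -/
def DGCat.Derived {k : Type u} [Field k] (A : DGCat.{u} k) : Type (u + 1) :=
  (DGModule.quasiIso A).Localization

section

variable {k : Type u} [Field k] {A : DGCat.{u} k}

instance : Category A.Derived :=
  inferInstanceAs (Category (DGModule.quasiIso A).Localization)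

instance : Preadditive A.Derived :=
  inferInstanceAs (Preadditive (DGModule.quasiIso A).Localization)

end

/-- The image of a dg module in the derived category. -/
def DGModule.toDerived {k : Type u} [Field k] {A : DGCat.{u} k} (M : DGModule A) : A.Derived :=
  (DGModule.quasiIso A).Q.obj ((DGModule.toHomotopyCat A).obj M)

open scoped Classical in
/-- An object `M` of an additive category is compact if `Hom(M, -)` commutes with direct sums:
for every coproduct `c` of a family `N` indexed by a set `J`, the canonical map
`⨁ j, Hom(M, N j) → Hom(M, c)` is bijective. -/
def IsCompactObject {D : Type (u + 1)} [Category.{u + 1} D] [Preadditive D] (M : D) : Prop :=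
  ∀ (J : Type u) (N : J → D) (c : Cofan N), Nonempty (IsColimit c) →
    Function.Bijective (DirectSum.toAddMonoid fun j => Preadditive.rightComp M (c.inj j))

/-- A dg module is perfect if its image in the derived category is compact. -/
def DGModule.IsPerfect {k : Type u} [Field k] {A : DGCat.{u} k} (M : DGModule A) : Prop :=
  IsCompactObject M.toDerived

/-! ### Bimodules, smoothness and properness -/

/-- A dg `(A, B)`-bimodule is a dg module over `B ⊗ Aᵒᵖ`, that is, a dg functor on `Bᵒᵖ ⊗ A`
(the contravariant variable comes first). -/
abbrev DGBimodule {k : Type u} [Field k] (A B : DGCat.{u} k) : Type (u + 1) :=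
  DGModule (B.tensor A.op)

theorem DGCat.d_id {k : Type u} [Field k] (A : DGCat.{u} k) (a : A.Obj) {q : ℤ} (h : 0 + 1 = q) :
    A.d h (A.id a) = 0 := by
  have := A.leibniz (add_zero 0) h h h (by omega : q + 0 = q) (by omega : 0 + q = q)
    (A.id a) (A.id a)
  rw [A.id_comp, A.comp_id, A.id_comp, koszulSign_zero, one_smul] at this
  exact left_eq_add.1 this

namespace DGBimodule

variable {k : Type u} [Field k] {A B C : DGCat.{u} k}

/-- The right dg `B`-module `φ(-, a)`. -/
def right (φ : DGBimodule A B) (a : A.Obj) : DGModule B where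
  X b n := φ.X (b, a) n
  d h := φ.d h
  act {b b' p q n} h :=
    (φ.act (a := (b, a)) (b := (b', a)) h).compl₂
      ((GTensor.mk (V := B.Hom b b') (W := A.op.Hom a a) (add_zero q)).flip (A.op.id a))
  d_d := φ.d_d
  act_id h m := φ.act_id h m
  act_act {b₁ b₂ b₃ p q r pq qr n} hpq hqr h h' m f g := by
    simp only [LinearMap.compl₂_apply, LinearMap.flip_apply]
    refine (φ.act_act hpq hqr h h' m _ _).trans ?_
    refine congrArg (φ.act h' m) ?_
    refine (B.tensorComp_mk A.op (b₁, a) (b₂, a) (b₃, a) hqr (add_zero q) (add_zero r) hqr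
      (add_zero 0) (add_zero qr) f (A.op.id a) g (A.op.id a)).trans ?_
    rw [zero_mul, koszulSign_zero, one_smul]
    exact congrArg (GTensor.mk (add_zero qr) _) (A.op.id_comp _ _)
  leibniz {b b' p q n p' q' n'} h hn hp hq h₁ h₂ m f := by
    simp only [LinearMap.compl₂_apply, LinearMap.flip_apply]
    refine (φ.leibniz h hn hp hq h₁ h₂ m _).trans ?_
    refine congrArg (fun t => _ + koszulSign k p • φ.act h₂ m t) ?_
    refine (B.tensorD_mk A.op (b, a) (b', a) hq (add_zero q) hq (zero_add 1) (add_zero q')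
      hq f (A.op.id a)).trans ?_
    rw [A.op.d_id, map_zero, smul_zero, add_zero]

/-- `φ` is right perfect if the right dg `B`-module `φ(-, a)` is perfect for every `a`. -/
def IsRightPerfect (φ : DGBimodule A B) : Prop :=
  ∀ a : A.Obj, (φ.right a).IsPerfect

/-- The action on the bimodule `(b, a) ↦ C(G b, F a)`:
`m · (f ⊗ g) = (-1)^{|g|(|m| + |f|)} F(g) ∘ m ∘ G(f)`. -/
def resAct (F : DGFunctor A C) (G : DGFunctor B C) (x y : B.Obj × A.Obj) {p q n : ℤ}
    (h : p + q = n) : C.Hom (G.obj y.1) (F.obj y.2) p →ₗ[k]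
      GTensor k (B.Hom x.1 y.1) (A.op.Hom x.2 y.2) q →ₗ[k] C.Hom (G.obj x.1) (F.obj x.2) n :=
  LinearMap.flip (GTensor.lift fun r s h' => LinearMap.mk₂ k
    (fun f g => koszulSign k (s * (p + r)) •
      (C.comp (show s + (p + r) = n by omega) (F.map (X := y.2) (Y := x.2) g)).comp
        ((C.comp rfl).flip (G.map f)))
    (fun f f' g => by ext m; simp) (fun c f g => by ext m; simp [smul_comm c])
    (fun f g g' => by ext m; simp) (fun c f g => by ext m; simp [smul_comm c]))

theorem resAct_mk (F : DGFunctor A C) (G : DGFunctor B C) (x y : B.Obj × A.Obj)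
    {p q n r s t : ℤ} (h : p + q = n) (h' : r + s = q) (ht : p + r = t) (hs : s + t = n)
    (m : C.Hom (G.obj y.1) (F.obj y.2) p) (f : B.Hom x.1 y.1 r) (g : A.op.Hom x.2 y.2 s) :
    resAct F G x y h m (GTensor.mk h' f g) = koszulSign k (s * (p + r)) •
      C.comp hs (F.map (X := y.2) (Y := x.2) g) (C.comp ht m (G.map f)) := by
  subst ht
  simp [resAct, GTensor.lift_mk]

/-- For dg functors `F : A ⥤ C` and `G : B ⥤ C`, the dg `(A, B)`-bimodule
`(b, a) ↦ C(G b, F a)` obtained by restricting the diagonal bimodule of `C`. -/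
def res (F : DGFunctor A C) (G : DGFunctor B C) : DGBimodule A B where
  X x n := C.Hom (G.obj x.1) (F.obj x.2) n
  d h := C.d h
  act {x y p q n} h := resAct F G x y h
  d_d := C.d_d
  act_id {x p} h m := by
    refine (resAct_mk F G x x h (add_zero 0) (add_zero p) (zero_add p) m _ _).trans ?_
    rw [zero_mul, koszulSign_zero, one_smul, G.map_id, C.comp_id]
    exact (congrArg (fun e => C.comp _ e m) (F.map_id x.2)).trans (C.id_comp _ _)
  act_act {x y z p q r pq qr n} hpq hqr h h' m f g := by
    induction f using GTensor.induction with
    | hadd f f' hf hf' => simp only [map_add, LinearMap.add_apply, hf, hf']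
    | hmk q₁ q₂ h₁ f₁ f₂ =>
      induction g using GTensor.induction with
      | hadd g g' hg hg' => simp only [map_add, hg, hg']
      | hmk r₁ r₂ h₂ g₁ g₂ =>
        rw [resAct_mk F G y z hpq h₁ rfl (by omega),
          B.tensorComp_mk A.op x y z hqr h₁ h₂ rfl rfl (by omega)]
        simp only [map_smul, LinearMap.smul_apply]
        rw [resAct_mk F G x y h h₂ rfl (by omega),
          resAct_mk F G x z h' _ rfl (by omega), G.map_comp]
        simp only [LinearMap.flip_apply, smul_smul, koszulSign_mul]
        rw [F.map_comp (by omega : r₂ + q₂ = q₂ + r₂),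
          C.assoc (p := r₂) (q := q₂) (qr := pq + r₁) _ (by omega) _ (by omega),
          C.assoc (p := q₂) (q := p + q₁) (r := r₁) (qr := p + (q₁ + r₁)) _ (by omega) _ (by omega),
          C.assoc (p := p) (q := q₁) _ rfl _ rfl]
        congr 1
        subst hpq
        rw [← h₁]
        refine koszulSign_congr ⟨-(q₂ * r₁), by ring⟩
  leibniz {x y p q n p' q' n'} h hn hp hq h₁ h₂ m f := by
    induction f using GTensor.induction with
    | hadd f f' hf hf' => simp only [map_add, hf, hf', smul_add]; abel
    | hmk r s h' f g =>
      rw [resAct_mk F G x y h h' rfl (by omega), map_smul,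
        C.leibniz _ hn rfl rfl (by omega) (by omega),
        C.leibniz rfl rfl hp rfl (by omega) (by omega),
        B.tensorD_mk A.op x y hq h' rfl rfl (by omega) (by omega)]
      simp only [map_add, map_smul, smul_add, smul_smul]
      rw [resAct_mk F G x y h₁ h' (t := p + r + 1) (by omega) (by omega),
        resAct_mk F G x y h₂ _ (t := p + r + 1) (by omega) (by omega),
        resAct_mk F G x y h₂ _ (t := p + r) rfl (by omega),
        ← F.map_d, ← G.map_d]
      subst hp
      simp only [smul_smul, koszulSign_mul]
      rw [koszulSign_congr (k := k) (m := p + r + (s + 1) * (p + r)) (n := s * (p + r))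
          ⟨p + r, by ring⟩,
        koszulSign_congr (k := k) (m := s * (p + 1 + r)) (n := s * (p + r) + s) ⟨0, by ring⟩,
        koszulSign_congr (k := k) (m := p + s * (p + (r + 1))) (n := s * (p + r) + (s + p))
          ⟨0, by ring⟩]
      rw [add_comm, add_assoc]

end DGBimodule

namespace DGCat

variable {k : Type u} [Field k]

/-- The diagonal dg `(A, A)`-bimodule `(a, a') ↦ A(a, a')`. -/
def diagonal (A : DGCat.{u} k) : DGBimodule A A :=
  DGBimodule.res A.idFunctor A.idFunctor

/-- A dg category is smooth if its diagonal bimodule is perfect. -/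
def IsSmooth (A : DGCat.{u} k) : Prop :=
  A.diagonal.IsPerfect

/-- The part of degree `n` of the field `k`, viewed as a graded vector space in degree `0`. -/
def unitHom (k : Type u) [Field k] (n : ℤ) : Submodule k k where
  carrier := {c | n ≠ 0 → c = 0}
  add_mem' ha hb h := by rw [ha h, hb h, add_zero]
  zero_mem' _ := rfl
  smul_mem' c x hx h := by rw [hx h, smul_zero]

/-- The field `k` as a dg category with one object, whose endomorphism algebra is `k` in
degree `0`. -/
abbrev unit (k : Type u) [Field k] : DGCat.{u} k where
  Obj := PUnit
  Hom _ _ n := unitHom k n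
  d _ := 0
  id _ := ⟨1, fun h => (h rfl).elim⟩
  comp {_ _ _ p q n} h := LinearMap.mk₂ k
    (fun a b => ⟨a.1 * b.1, fun hn => by
      by_cases hp : p = 0
      · rw [b.2 (by omega), mul_zero]
      · rw [a.2 hp, zero_mul]⟩)
    (fun a a' b => Subtype.ext (add_mul _ _ _))
    (fun c a b => Subtype.ext (mul_assoc _ _ _))
    (fun a b b' => Subtype.ext (mul_add _ _ _))
    (fun c a b => Subtype.ext (mul_left_comm _ _ _))
  d_d _ _ _ := rfl
  id_comp _ f := Subtype.ext (one_mul f.1)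
  comp_id _ f := Subtype.ext (mul_one f.1)
  assoc _ _ _ _ f g e := Subtype.ext (mul_assoc f.1 g.1 e.1)
  leibniz h hn hp hq h₁ h₂ f g := by
    simp only [LinearMap.zero_apply, map_zero, smul_zero, add_zero]

/-- The dg functor from `k` to `A` that corresponds to an object `a` of `A`. -/
def point (A : DGCat.{u} k) (a : A.Obj) : DGFunctor (unit k) A where
  obj _ := a
  map {_ _ p} :=
    if h : p = 0 then
      h ▸ (LinearMap.toSpanSingleton k (A.Hom a a 0) (A.id a)).comp (unitHom k 0).subtype
    else 0
  map_d {_ _ p q} h f := by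
    by_cases hp : p = 0
    · subst hp
      simp [A.d_id]
    · simp [hp]
  map_id _ := by simp
  map_comp {_ _ _ p q n} h f g := by
    by_cases hp : p = 0
    · subst hp
      by_cases hq : q = 0
      · subst hq
        obtain rfl : n = 0 := by omega
        simp [A.id_comp, mul_smul, smul_comm f.1]
      · rw [show g = 0 from Subtype.ext (g.2 hq)]
        simp only [map_zero]
    · rw [show f = 0 from Subtype.ext (f.2 hp)]
      simp only [map_zero, LinearMap.zero_apply]

end DGCat

/-- The restriction of a dg module along a dg functor. -/
def DGModule.restrict {k : Type u} [Field k] {A B : DGCat.{u} k} (M : DGModule B)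
    (F : DGFunctor A B) : DGModule A where
  X a n := M.X (F.obj a) n
  d h := M.d h
  act h := (M.act h).compl₂ F.map
  d_d := M.d_d
  act_id h m := by simp [F.map_id, M.act_id]
  act_act hpq hqr h h' m f g := by
    simp only [LinearMap.compl₂_apply, F.map_comp hqr]
    exact M.act_act hpq hqr h h' m _ _
  leibniz h hn hp hq h₁ h₂ m f := by
    simp only [LinearMap.compl₂_apply, F.map_d]
    exact M.leibniz h hn hp hq h₁ h₂ m _

namespace DGCat

variable {k : Type u} [Field k]

/-- The representable right dg module `h^a = A(-, a)`. -/
def representable (A : DGCat.{u} k) (a : A.Obj) : DGModule A where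
  X b n := A.Hom b a n
  d h := A.d h
  act h := A.comp h
  d_d := A.d_d
  act_id := A.comp_id
  act_act := A.assoc
  leibniz := A.leibniz

/-- The complex of morphisms `A(a, b)`, as a dg module over `k`. -/
def homComplex (A : DGCat.{u} k) (a b : A.Obj) : DGModule (unit k) :=
  (A.representable b).restrict (A.point a)

/-- A dg category is proper if all its complexes of morphisms are perfect over `k`. -/
def IsProper (A : DGCat.{u} k) : Prop :=
  ∀ a b : A.Obj, (A.homComplex a b).IsPerfect

end DGCat

/-! ### Directed dg categories -/

/-- A directed decomposition of a dg category `C` into `n` full dg subcategories: the objects of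
`C` are partitioned into blocks indexed by `0, …, n - 1`, and the complex of morphisms from an
object of block `i` to an object of block `j` vanishes if `i > j`. -/
structure DirectedDecomposition {k : Type u} [Field k] (C : DGCat.{u} k) (n : ℕ) : Type u where
  index : C.Obj → Fin n
  hom_eq_zero : ∀ X Y : C.Obj, index Y < index X → ∀ (p : ℤ) (f : C.Hom X Y p), f = 0

namespace DirectedDecomposition

variable {k : Type u} [Field k] {C : DGCat.{u} k} {n : ℕ} (D : DirectedDecomposition C n)

/-- The diagonal block `A_i`: the full dg subcategory on the objects of index `i`. -/
def block (i : Fin n) : DGCat.{u} k := C.full fun X => D.index X = i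

/-- The inclusion of the block `A_i`. -/
def incl (i : Fin n) : DGFunctor (D.block i) C := C.fullIncl fun X => D.index X = i

/-- The dg `(A_i, A_j)`-bimodule `φ_ij`, given by the complexes of morphisms of `C` from objects
of `A_j` to objects of `A_i`. -/
def bimodule (i j : Fin n) : DGBimodule (D.block i) (D.block j) :=
  DGBimodule.res (D.incl i) (D.incl j)

end DirectedDecomposition

end

/-! Write F^* for restriction of dg modules along a dg functor F and F_* for its right adjoint,
coinduction (`coindOne`). No derived tensor product is used: induction functors are replaced by
K-injective modules, by F_*, and by orthogonality (all closed degree zero maps null-homotopic).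

Foundations. For a family of dg functors F_t into E and an E-module N, iterating N ↦ ∏_t F_{t*}F_t^*
N produces the cobar complex of N (`cobar`). Evaluation at identities contracts its augmentation at
every object in the image of some F_t. If all restrictions of M are orthogonal to those of the terms
of the complex, then M is orthogonal to its total module, because a homotopy can be built one layer
at a time (`orthogonal_tot`). For the functors k → E given by the objects of E, acyclic complexes of
vector spaces are contractible, so the total module is K-injective. Hence K-injective resolutions
exist, morphisms in D(E) to a K-injective module are homotopy classes, direct sums of modules are
coproducts in D(E), and M is perfect exactly when every morphism from M to a direct sum in D(E) is a
finite sum of morphisms through single summands (`isPerfect_iff`).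

Smoothness. For a block A_i let F : A_i ⊗ C^op → C ⊗ C^op be the inclusion. Two restrictions are
perfect. First, F^* of the diagonal of C, that is (x, c) ↦ C(x, c) with x in A_i: it behaves as the
extension of the diagonal of A_i, since a morphism out of it in the derived category vanishes once
its restriction to A_i ⊗ A_i^op does (`isPerfect_halfDiagonal`). Second, F^* of the module
represented by (c, y), which is C(-, c) restricted to A_i, times the module represented by y; the
first factor is zero, representable, or some φ(-, c) with φ right perfect, according to the block of
c. By the second fact F_* of K-injective modules commutes with direct sums up to quasi-isomorphism,
so by the first fact every morphism from the diagonal of C to a direct sum of modules F_* I_j is a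
finite sum as above.

Now let the modules N_j be acyclic at all (x, y) with x in a block below i, and let I_j be a
K-injective resolution of F^* N_j. The homotopy fibre of N_j → F_* I_j is acyclic also at block i,
because F is fully faithful, and stays acyclic below i, because nothing maps from A_i to a lower
block, so that F_* I_j vanishes there. By the exact sequence of the fibre, the finiteness property
for the N_j follows from that for the fibres. Applying this to the blocks 0, 1, ..., n - 1 in turn
ends with acyclic modules, which are zero in the derived category.

Properness. C(a, b) is the restriction of the perfect module C(-, b)|A_i along the point a of its
block A_i. Restriction along a functor preserves perfect modules if it does so for representable
ones (`IsPerfect.restrict`), and for a point of A_i this is properness of A_i. -/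

noncomputable section

/-! ### Contractible complexes, restriction, homotopy fibres and K-injective modules. -/

namespace DGModule

variable {k : Type u} [Field k] {A B : DGCat.{u} k}

/-! ### Casts, acyclicity and contractibility -/

/-- Transport of elements along an equality of degrees. -/
def cast (M : DGModule A) (a : A.Obj) {p q : ℤ} (h : p = q) : M.X a p →ₗ[k] M.X a q :=
  h ▸ LinearMap.id

@[simp] theorem cast_rfl (M : DGModule A) (a : A.Obj) {p : ℤ} (h : p = p) (m : M.X a p) :
    M.cast a h m = m := rfl

@[simp] theorem cast_cast (M : DGModule A) (a : A.Obj) {p q r : ℤ} (h : p = q) (h' : q = r)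
    (m : M.X a p) : M.cast a h' (M.cast a h m) = M.cast a (h.trans h') m := by
  subst h h'; rfl

theorem d_cast (M : DGModule A) (a : A.Obj) {p q r : ℤ} (h : p = q) (h' : q + 1 = r)
    (m : M.X a p) : M.d h' (M.cast a h m) = M.d ((congrArg (· + 1) h).trans h') m := by
  subst h; rfl

theorem cast_d (M : DGModule A) (a : A.Obj) {p q r : ℤ} (h : p + 1 = q) (h' : q = r)
    (m : M.X a p) : M.cast a h' (M.d h m) = M.d (h.trans h') m := by
  subst h'; rfl

theorem act_cast (M : DGModule A) {a b : A.Obj} {p p' q n : ℤ} (h : p = p') (h' : p' + q = n)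
    (m : M.X b p) (f : A.Hom a b q) :
    M.act h' (M.cast b h m) f = M.act ((congrArg (· + q) h).trans h') m f := by
  subst h; rfl

theorem cast_act (M : DGModule A) {a b : A.Obj} {p q n n' : ℤ} (h : p + q = n) (h' : n = n')
    (m : M.X b p) (f : A.Hom a b q) :
    M.cast a h' (M.act h m f) = M.act (h.trans h') m f := by
  subst h'; rfl

/-- The complex `M(a)` is acyclic. -/
def IsAcyclicAt (M : DGModule A) (a : A.Obj) : Prop :=
  ∀ ⦃p q r : ℤ⦄ (hq : q + 1 = p) (hr : p + 1 = r) (x : M.X a p), M.d hr x = 0 →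
    ∃ w : M.X a q, x = M.d hq w

/-- All the complexes `M(a)` are acyclic. -/
def IsAcyclic (M : DGModule A) : Prop := ∀ a, M.IsAcyclicAt a

/-- Every closed morphism of degree zero from `M` to `N` is null-homotopic. -/
def Orthogonal (M N : DGModule A) : Prop := ∀ f : M ⟶ N, IsNullHomotopic f

/-- `N` is K-injective if every closed morphism from an acyclic module to `N` is
null-homotopic. -/
def IsKInj (N : DGModule A) : Prop := ∀ M : DGModule A, M.IsAcyclic → Orthogonal M N

/-- A homotopy contracting the complex of vector spaces `M(a)`. -/
structure Contraction (M : DGModule A) (a : A.Obj) : Type u where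
  s : ∀ {p q : ℤ}, q + 1 = p → M.X a p →ₗ[k] M.X a q
  eq : ∀ {p q r : ℤ} (hq : q + 1 = p) (hr : p + 1 = r) (m : M.X a p),
    M.d hq (s hq m) + s hr (M.d hr m) = m

/-- An acyclic complex of vector spaces is contractible. -/
theorem IsAcyclicAt.nonempty_contraction {M : DGModule A} {a : A.Obj} (h : M.IsAcyclicAt a) :
    Nonempty (M.Contraction a) := by
  -- A generalized inverse `t` of the differential, with `d t d = d`: a section of `d` over its
  -- image composed with a linear projection onto that image. Both exist over a field.
  have key : ∀ q : ℤ, ∃ t : M.X a (q + 1) →ₗ[k] M.X a q,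
      ∀ x : M.X a q, M.d rfl (t (M.d rfl x)) = M.d (rfl : q + 1 = q + 1) x := by
    intro q
    obtain ⟨t, ht⟩ := (M.d (a := a) (rfl : q + 1 = q + 1)).rangeRestrict.exists_rightInverse_of_surjective
      (LinearMap.range_rangeRestrict _)
    obtain ⟨π, hπ⟩ := (LinearMap.range (M.d (a := a) (rfl : q + 1 = q + 1))).subtype.exists_leftInverse_of_injective
      (Submodule.ker_subtype _)
    refine ⟨t ∘ₗ π, fun x => ?_⟩
    have h1 : π (M.d rfl x) = (M.d (a := a) (rfl : q + 1 = q + 1)).rangeRestrict x :=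
      LinearMap.congr_fun hπ ((M.d (a := a) (rfl : q + 1 = q + 1)).rangeRestrict x)
    have h2 := LinearMap.congr_fun ht ((M.d (a := a) (rfl : q + 1 = q + 1)).rangeRestrict x)
    have h3 := congrArg Subtype.val h2
    simp only [LinearMap.comp_apply, h1]
    exact h3
  choose t ht using key
  -- `1 - t d` takes values in cocycles, which are boundaries by acyclicity, and `d t` is the
  -- identity on boundaries.
  have hd : ∀ (q : ℤ) (x : M.X a (q + 1)), M.d rfl (t q (x - t (q + 1) (M.d rfl x))) =
      x - t (q + 1) (M.d (rfl : q + 1 + 1 = q + 1 + 1) x) := by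
    intro q x
    obtain ⟨w, hw⟩ := h (rfl : q + 1 = q + 1) rfl (x - t (q + 1) (M.d rfl x))
      (by rw [map_sub, ht, sub_self])
    rw [hw, ht]
  -- The homotopy is `s = t (1 - t d)`: then `d s = 1 - t d` by `hd`, and `s d = t d` because `d d =
  -- 0`.
  refine ⟨⟨fun {p q} hq => (t q ∘ₗ (LinearMap.id - t (q + 1) ∘ₗ M.d rfl)) ∘ₗ M.cast a hq.symm, ?_⟩⟩
  intro p q r hq hr m
  subst hq hr
  simp only [LinearMap.comp_apply, LinearMap.sub_apply, LinearMap.id_apply, cast_rfl, hd, M.d_d,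
    map_zero, sub_zero]
  exact sub_add_cancel _ _

theorem Contraction.isAcyclicAt {M : DGModule A} {a : A.Obj} (s : M.Contraction a) :
    M.IsAcyclicAt a := fun p q r hq hr x hx =>
  ⟨s.s hq x, by simpa [hx] using (s.eq hq hr x).symm⟩

/-! ### Restriction along dg functors -/

/-- The restriction of a morphism of dg modules. -/
def restrictMap (F : DGFunctor A B) {M N : DGModule B} (f : M ⟶ N) :
    M.restrict F ⟶ N.restrict F :=
  Hom.mk (fun a p => f.app (F.obj a) p) (fun h m => f.app_d h m)
    (fun h m x => f.app_act h m (F.map x))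

/-- Restriction of dg modules along a dg functor, as a functor. -/
def restrictFunctor (F : DGFunctor A B) : DGModule B ⥤ DGModule A where
  obj M := M.restrict F
  map f := restrictMap F f
  map_id _ := rfl
  map_comp _ _ := rfl

theorem IsNullHomotopic.restrict (F : DGFunctor A B) {M N : DGModule B} {f : M ⟶ N}
    (hf : IsNullHomotopic f) : IsNullHomotopic (restrictMap F f) := by
  obtain ⟨s, hs⟩ := hf
  exact ⟨⟨fun a _ _ h => s.app (F.obj a) h, fun h hp hn h' m x => s.app_act h hp hn h' m (F.map x)⟩,
    fun a _ _ _ hq hr m => hs (F.obj a) hq hr m⟩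

theorem IsQuasiIso.restrict (F : DGFunctor A B) {M N : DGModule B} {f : M ⟶ N}
    (hf : IsQuasiIso f) : IsQuasiIso (restrictMap F f) :=
  ⟨fun a _ _ _ hq hr y hy => hf.surj (F.obj a) hq hr y hy,
    fun a _ _ _ hq hr x z hx h => hf.inj (F.obj a) hq hr x z hx h⟩

theorem IsAcyclic.restrict (F : DGFunctor A B) {M : DGModule B} (hM : M.IsAcyclic) :
    (M.restrict F).IsAcyclic := fun a => hM (F.obj a)

section RestrictedMorphisms

variable {F : DGFunctor A B} {M : DGModule B} {L : DGModule A}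

/-- The components of a morphism out of a restricted module. -/
def resApp (b : M.restrict F ⟶ L) (x : A.Obj) (n : ℤ) : M.X (F.obj x) n →ₗ[k] L.X x n := b.app x n

theorem resApp_d (b : M.restrict F ⟶ L) (x : A.Obj) {p q : ℤ} (h : p + 1 = q)
    (m : M.X (F.obj x) p) : resApp b x q (M.d h m) = L.d h (resApp b x p m) := b.app_d h m

theorem resApp_act (b : M.restrict F ⟶ L) {x y : A.Obj} {p q n : ℤ} (h : p + q = n)
    (m : M.X (F.obj y) p) (f : A.Hom x y q) :
    resApp b x n (M.act h m (F.map f)) = L.act h (resApp b y p m) f := b.app_act h m f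

/-- Construction of morphisms out of a restricted module. -/
def ofRes (φ : ∀ (x : A.Obj) (n : ℤ), M.X (F.obj x) n →ₗ[k] L.X x n)
    (hd : ∀ (x : A.Obj) (p q : ℤ) (h : p + 1 = q) (m : M.X (F.obj x) p),
      φ x q (M.d h m) = L.d h (φ x p m))
    (hact : ∀ (x y : A.Obj) (p q n : ℤ) (h : p + q = n) (m : M.X (F.obj y) p) (f : A.Hom x y q),
      φ x n (M.act h m (F.map f)) = L.act h (φ y p m) f) : M.restrict F ⟶ L :=
  Hom.mk φ (fun h m => hd _ _ _ h m) (fun h m f => hact _ _ _ _ _ h m f)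

/-- A null-homotopy of a morphism out of a restricted module. -/
structure ResHomotopy (b : M.restrict F ⟶ L) : Type u where
  app : ∀ (x : A.Obj) {p q : ℤ}, q + 1 = p → M.X (F.obj x) p →ₗ[k] L.X x q
  app_act : ∀ {x y : A.Obj} {p q n p' n' : ℤ} (h : p + q = n) (hp : p' + 1 = p)
    (hn : n' + 1 = n) (h' : p' + q = n') (m : M.X (F.obj y) p) (f : A.Hom x y q),
    app x hn (M.act h m (F.map f)) = L.act h' (app y hp m) f
  eq : ∀ (x : A.Obj) {p q r : ℤ} (hq : q + 1 = p) (hr : p + 1 = r) (m : M.X (F.obj x) p),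
    resApp b x p m = L.d hq (app x hq m) + app x hr (M.d hr m)

theorem isNullHomotopic_iff_resHomotopy (b : M.restrict F ⟶ L) :
    IsNullHomotopic b ↔ Nonempty (ResHomotopy b) :=
  ⟨fun ⟨s, hs⟩ => ⟨⟨fun x _ _ h => s.app x h, s.app_act, hs⟩⟩,
    fun ⟨s⟩ => ⟨⟨fun x _ _ h => s.app x h, s.app_act⟩, s.eq⟩⟩

/-- A homotopy between the restrictions of two modules that contracts the family of maps `φ`. -/
structure ResHomotopy₂ (F : DGFunctor A B) {M X : DGModule B}
    (φ : ∀ (x : A.Obj) (n : ℤ), M.X (F.obj x) n →ₗ[k] X.X (F.obj x) n) : Type u where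
  app : ∀ (x : A.Obj) {p q : ℤ}, q + 1 = p → M.X (F.obj x) p →ₗ[k] X.X (F.obj x) q
  app_act : ∀ {x y : A.Obj} {p q n p' n' : ℤ} (h : p + q = n) (hp : p' + 1 = p)
    (hn : n' + 1 = n) (h' : p' + q = n') (m : M.X (F.obj y) p) (f : A.Hom x y q),
    app x hn (M.act h m (F.map f)) = X.act h' (app y hp m) (F.map f)
  eq : ∀ (x : A.Obj) {p q r : ℤ} (hq : q + 1 = p) (hr : p + 1 = r) (m : M.X (F.obj x) p),
    φ x p m = X.d hq (app x hq m) + app x hr (M.d hr m)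

/-- Orthogonality of the restrictions, rephrased so that the resulting homotopy is expressed through
the actions of the original modules on the morphisms `F.map f`. -/
theorem Orthogonal.nonempty_resHomotopy₂ {X : DGModule B}
    (H : Orthogonal (M.restrict F) (X.restrict F))
    (φ : ∀ (x : A.Obj) (n : ℤ), M.X (F.obj x) n →ₗ[k] X.X (F.obj x) n)
    (hd : ∀ (x : A.Obj) (p q : ℤ) (h : p + 1 = q) (m : M.X (F.obj x) p),
      φ x q (M.d h m) = X.d h (φ x p m))
    (hact : ∀ (x y : A.Obj) (p q n : ℤ) (h : p + q = n) (m : M.X (F.obj y) p) (f : A.Hom x y q),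
      φ x n (M.act h m (F.map f)) = X.act h (φ y p m) (F.map f)) :
    Nonempty (ResHomotopy₂ F φ) := by
  obtain ⟨s, hs⟩ := H (ofRes (L := X.restrict F) φ hd hact)
  exact ⟨⟨fun x _ _ h => s.app x h, s.app_act, hs⟩⟩

end RestrictedMorphisms

/-! ### Homotopies -/

theorem IsNullHomotopic.congr {M N : DGModule A} {f g : M ⟶ N} (h : IsNullHomotopic (f - g))
    (hg : IsNullHomotopic g) : IsNullHomotopic f := by
  simpa using h.add hg

theorem IsNullHomotopic.symm {M N : DGModule A} {f g : M ⟶ N} (h : IsNullHomotopic (f - g)) :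
    IsNullHomotopic (g - f) := by
  simpa using h.neg

/-! ### Homotopy fibres -/

/-- The homotopy fibre of a morphism of dg modules. -/
def fib {M N : DGModule A} (u : M ⟶ N) : DGModule A where
  X a p := M.X a p × N.X a (p - 1)
  d {a p q} h :=
    { toFun := fun x => (M.d h x.1, N.cast a (by omega) (u.app a p x.1) -
        N.d (by omega) x.2)
      map_add' := fun x y => by
        ext <;> simp only [Prod.fst_add, Prod.snd_add, map_add] <;> abel
      map_smul' := fun c x => by ext <;> simp [smul_sub] }
  act {a b p q n} h := LinearMap.mk₂ k
    (fun x y => (M.act h x.1 y, N.act (by omega) x.2 y))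
    (by intros; ext <;> simp) (by intros; ext <;> simp) (by intros; ext <;> simp)
    (by intros; ext <;> simp)
  d_d {a p q r} h h' x := by
    subst h h'
    ext
    · simp [M.d_d]
    · simp [N.d_d, u.app_d, d_cast, cast_d]
  act_id h x := by
    ext <;> simp [M.act_id, N.act_id]
  act_act hpq hqr h h' m f g := by
    ext
    · exact M.act_act _ _ _ _ _ _ _
    · exact N.act_act _ _ _ _ _ _ _
  leibniz {a b p q n p' q' n'} h hn hp hq h₁ h₂ m x := by
    ext
    · exact M.leibniz _ _ _ _ _ _ _ _
    · simp only [LinearMap.coe_mk, AddHom.coe_mk, LinearMap.mk₂_apply, Prod.snd_add,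
        Prod.smul_snd, map_sub, LinearMap.sub_apply]
      rw [N.leibniz (p' := p' - 1) _ _ (by omega) hq (by omega) (by omega), u.app_act, cast_act,
        act_cast, show koszulSign k p = - koszulSign k (p - 1) by
          rw [← koszulSign_succ, sub_add_cancel], neg_smul]
      abel

theorem fib_d {M N : DGModule A} (u : M ⟶ N) (a : A.Obj) {p q : ℤ} (h : p + 1 = q)
    (m : M.X a p) (n : N.X a (p - 1)) :
    (fib u).d h ((m, n) : M.X a p × N.X a (p - 1)) =
      ((M.d h m, N.cast a (by omega) (u.app a p m) - N.d (by omega) n) :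
        M.X a q × N.X a (q - 1)) := rfl

/-- The projection from the homotopy fibre. -/
def fibFst {M N : DGModule A} (u : M ⟶ N) : fib u ⟶ M :=
  Hom.mk (fun _ _ => LinearMap.fst k _ _) (fun _ _ => rfl) (fun _ _ _ => rfl)

/-- A null-homotopy of `f ≫ u` lifts `f` to the homotopy fibre of `u`. -/
theorem exists_lift_fib {M N P : DGModule A} (u : M ⟶ N) (f : P ⟶ M)
    (h : IsNullHomotopic (f ≫ u)) : ∃ g : P ⟶ fib u, g ≫ fibFst u = f := by
  obtain ⟨s, hs⟩ := h
  refine ⟨Hom.mk (fun a p => (f.app a p).prod (s.app a (by omega))) ?_ ?_, rfl⟩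
  · intro a p q h m
    subst h
    refine Prod.ext (f.app_d rfl m) ?_
    have e := hs a (sub_add_cancel p 1) rfl m
    rw [comp_app] at e
    show s.app a _ (P.d rfl m) = N.cast a _ (u.app a p (f.app a p m)) - N.d _ (s.app a _ m)
    rw [e, map_add, cast_d]
    generalize_proofs h1 h2 h3 h4 h5
    have : ∀ (q : ℤ) (e : p = q) (h' : q + 1 = p + 1) (y : P.X a (p + 1)),
      N.cast a e (s.app a rfl y) = s.app a h' y := by
        intro q e h' y; subst e; rfl
    rw [this _ _ h1]
    abel
  · intro a b p q n h m x
    exact Prod.ext (f.app_act h m x) (s.app_act h _ _ _ m x)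

/-- The homotopy fibre of a morphism that is a quasi-isomorphism at `a` is acyclic at `a`. -/
theorem isAcyclicAt_fib {M N : DGModule A} (u : M ⟶ N) (a : A.Obj)
    (surj : ∀ {p q r : ℤ} (hq : q + 1 = p) (hr : p + 1 = r) (y : N.X a p),
      N.d hr y = 0 → ∃ (x : M.X a p) (z : N.X a q), M.d hr x = 0 ∧ y = u.app a p x + N.d hq z)
    (inj : ∀ {p q r : ℤ} (hq : q + 1 = p) (hr : p + 1 = r) (x : M.X a p) (z : N.X a q),
      M.d hr x = 0 → u.app a p x = N.d hq z → ∃ w : M.X a q, x = M.d hq w) :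
    (fib u).IsAcyclicAt a := by
  intro p q r hq hr x hx
  subst hq hr
  obtain ⟨x, y⟩ := x
  have h₁ : M.d rfl x = 0 := congrArg Prod.fst hx
  have h₂ : N.cast a (by omega) (u.app a _ x) - N.d (by omega) y = (0 : N.X a (q + 1 + 1 - 1)) :=
    congrArg Prod.snd hx
  have h₃ : u.app a (q + 1) x = N.d (by omega) y := by
    have := congrArg (N.cast a (by omega : q + 1 + 1 - 1 = q + 1)) (sub_eq_zero.1 h₂)
    rw [cast_cast, cast_d] at this
    exact this
  -- A cocycle (x, y) of the fibre satisfies dx = 0 and u x = dy, so injectivity on cohomology gives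
  -- x = dw. Then u w - y is a cocycle, hence u x' + dz by surjectivity, and (w - x', z) bounds (x,
  -- y).
  obtain ⟨w, hw⟩ := inj (by omega : (q + 1 - 1) + 1 = q + 1) rfl x y h₁ h₃
  obtain ⟨x', z, hx', hz⟩ := surj (by omega : (q - 1) + 1 = q) rfl
    (u.app a q (M.cast a (by omega) w) - N.cast a (by omega) y) (by
      rw [map_sub, ← u.app_d, d_cast, d_cast, ← hw, h₃, sub_self])
  refine ⟨(M.cast a (by omega) w - x', z), ?_⟩
  rw [fib_d]
  refine Prod.ext ?_ ?_
  · show x = M.d _ (M.cast a _ w - x')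
    rw [map_sub, hx', sub_zero, d_cast, hw]
  · show y = N.cast a _ (u.app a _ (M.cast a _ w - x')) - N.d _ z
    have : u.app a q (M.cast a (by omega) w - x') - N.d (by omega) z = N.cast a (by omega) y := by
      rw [map_sub, sub_sub, ← hz, sub_sub_cancel]
    have := congrArg (N.cast a (by omega : q = q + 1 - 1)) this
    rw [map_sub, cast_cast, cast_d] at this
    exact this.symm

theorem IsQuasiIso.isAcyclic_fib {M N : DGModule A} {u : M ⟶ N} (hu : IsQuasiIso u) :
    (fib u).IsAcyclic := fun a => isAcyclicAt_fib u a (hu.surj a) (hu.inj a)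

section FibInclusions

variable {M N : DGModule A} (u : M ⟶ N)

/-- The inclusion of the graded module `M` in the homotopy fibre. -/
def fibInl (a : A.Obj) (p : ℤ) : M.X a p →ₗ[k] (fib u).X a p :=
  LinearMap.inl k (M.X a p) (N.X a (p - 1))

/-- The inclusion of the shift of the graded module `N` in the homotopy fibre. -/
def fibInr (a : A.Obj) {p q : ℤ} (h : p + 1 = q) : N.X a p →ₗ[k] (fib u).X a q :=
  LinearMap.inr k (M.X a q) (N.X a (q - 1)) ∘ₗ N.cast a (by omega)

theorem d_fibInl (a : A.Obj) {p q : ℤ} (h : p + 1 = q) (m : M.X a p) :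
    (fib u).d h (fibInl u a p m) = fibInl u a q (M.d h m) + fibInr u a h (u.app a p m) := by
  refine Prod.ext ?_ ?_
  · exact (add_zero (M.d h m)).symm
  · show N.cast a _ (u.app a p m) - N.d _ 0 = 0 + N.cast a _ (u.app a p m)
    rw [map_zero, sub_zero, zero_add]

theorem d_fibInr (a : A.Obj) {p q r : ℤ} (h : p + 1 = q) (h' : q + 1 = r) (n : N.X a p) :
    (fib u).d h' (fibInr u a h n) = -fibInr u a h' (N.d h n) := by
  refine Prod.ext ?_ ?_
  · show M.d _ 0 = -0
    rw [map_zero, neg_zero]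
  · show N.cast a _ (u.app a q 0) - N.d _ (N.cast a _ n) = - N.cast a _ (N.d h n)
    rw [map_zero, map_zero, zero_sub, d_cast, cast_d]

theorem fibInl_act {a b : A.Obj} {p q n : ℤ} (h : p + q = n) (m : M.X b p) (x : A.Hom a b q) :
    fibInl u a n (M.act h m x) = (fib u).act h (fibInl u b p m) x :=
  Prod.ext rfl (show (0 : N.X a (n - 1)) = N.act (by omega) (0 : N.X b (p - 1)) x by simp)

theorem fibInr_act {a b : A.Obj} {p q n p' n' : ℤ} (h : p + q = n) (hp : p + 1 = p')
    (hn : n + 1 = n') (h' : p' + q = n') (m : N.X b p) (x : A.Hom a b q) :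
    fibInr u a hn (N.act h m x) = (fib u).act h' (fibInr u b hp m) x := by
  refine Prod.ext (show (0 : M.X a n') = M.act h' (0 : M.X b p') x by simp) ?_
  show N.cast a _ (N.act h m x) = N.act _ (N.cast b _ m) x
  rw [cast_act, act_cast]

end FibInclusions

/-- A quasi-isomorphism out of a K-injective module has a left inverse up to homotopy. -/
theorem IsKInj.exists_leftInverse {M N : DGModule A} (hM : M.IsKInj) {u : M ⟶ N}
    (hu : IsQuasiIso u) : ∃ r : N ⟶ M, IsNullHomotopic (u ≫ r - 𝟙 M) := by
  -- The fibre of `u` is acyclic, so its projection to `M` is null-homotopic. On the summand `N` of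
  -- the fibre the null-homotopy is a closed map, the retraction; on the summand `M` it is the
  -- homotopy between `u ≫ r` and the identity.
  obtain ⟨s, hs⟩ := hM _ hu.isAcyclic_fib (fibFst u)
  refine ⟨Hom.mk (fun a p => s.app a rfl ∘ₗ fibInr u a rfl) ?_ ?_, ?_⟩
  · intro a p q h n
    subst h
    have : (0 : M.X a (p + 1)) = _ := hs a rfl rfl (fibInr u a (rfl : p + 1 = p + 1) n)
    rw [d_fibInr u a rfl rfl, map_neg, eq_comm, ← sub_eq_add_neg, sub_eq_zero] at this
    exact this.symm
  · intro a b p q n h m x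
    exact (congrArg _ (fibInr_act u h rfl rfl (by omega) m x)).trans
      (s.app_act (by omega : p + 1 + q = n + 1) rfl rfl h _ x)
  · refine IsNullHomotopic.symm ⟨⟨fun a p q h => s.app a h ∘ₗ fibInl u a p, ?_⟩, ?_⟩
    · intro a b p q n p' n' h hp hn h' m x
      exact (congrArg _ (fibInl_act u h m x)).trans (s.app_act h hp hn h' _ x)
    · intro a p q r hq hr m
      subst hr
      have : m = _ := hs a hq rfl (fibInl u a p m)
      rw [d_fibInl u a rfl, map_add, ← add_assoc] at this
      rw [sub_app, comp_app, id_app]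
      exact sub_eq_of_eq_add this

end DGModule

end

/-! ### The right adjoint of restriction and its compatibility with homotopies. -/

noncomputable section

namespace DGModule

variable {k : Type u} [Field k] {D E : DGCat.{u} k} {T : Type u}

/-! ### Coinduction along dg functors -/

/-- The elements of degree `p` at `a` of the coinduced module: the families of graded linear maps
`E(F_t x, a) → L_t(x)` of degree `p - c` that are linear over `D`. -/
def coindX (c : ℤ) (F : T → DGFunctor D E) (L : T → DGModule D) (a : E.Obj) (p : ℤ) :
    Submodule k (∀ (t : T) (x : D.Obj) (i : {i : ℤ × ℤ // p + i.1 = i.2 + c}),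
      E.Hom ((F t).obj x) a i.1.1 →ₗ[k] (L t).X x i.1.2) where
  carrier := {φ | ∀ (t : T) (x y : D.Obj) (q r qr n n' : ℤ) (h : p + q = n + c) (hqr : q + r = qr)
    (h' : p + qr = n' + c) (hn : n + r = n') (f : E.Hom ((F t).obj x) a q) (g : D.Hom y x r),
    φ t y ⟨(qr, n'), h'⟩ (E.comp hqr f ((F t).map g)) = (L t).act hn (φ t x ⟨(q, n), h⟩ f) g}
  add_mem' {φ ψ} hφ hψ t x y q r qr n n' h hqr h' hn f g := by
    simp only [Pi.add_apply, LinearMap.add_apply, map_add, hφ t x y q r qr n n' h hqr h' hn f g,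
      hψ t x y q r qr n n' h hqr h' hn f g]
  zero_mem' t x y q r qr n n' h hqr h' hn f g := by
    simp only [Pi.zero_apply, LinearMap.zero_apply, map_zero]
  smul_mem' s φ hφ t x y q r qr n n' h hqr h' hn f g := by
    simp only [Pi.smul_apply, LinearMap.smul_apply, map_smul, hφ t x y q r qr n n' h hqr h' hn f g]

theorem koszulSign_of_succ {p q : ℤ} (h : p + 1 = q) : koszulSign k q = -koszulSign k p := by
  rw [← h, koszulSign_succ]

theorem koszulSign_one : koszulSign k 1 = -1 := by
  rw [koszulSign_of_succ (zero_add 1), koszulSign_zero]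

section

variable (c : ℤ) (F : T → DGFunctor D E) (L : T → DGModule D)

/-- The differential of the coinduced module. -/
def coindD (a : E.Obj) {p p' : ℤ} (h : p + 1 = p') :
    coindX c F L a p →ₗ[k] coindX c F L a p' where
  toFun φ := ⟨fun t x i => koszulSign k c • ((L t).d (sub_add_cancel _ 1)) ∘ₗ
      φ.1 t x ⟨(i.1.1, i.1.2 - 1), by have := i.2; show p + i.1.1 = i.1.2 - 1 + c; omega⟩ -
      koszulSign k p • φ.1 t x ⟨(i.1.1 + 1, i.1.2), by have := i.2; show p + (i.1.1 + 1) = i.1.2 + c; omega⟩ ∘ₗ E.d rfl, by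
    intro t x y q r qr n n' h1 hqr h2 hn f g
    have e := fun q r qr n n' h hqr h' hn f g => φ.2 t x y q r qr n n' h hqr h' hn f g
    simp only [LinearMap.sub_apply, LinearMap.smul_apply, LinearMap.comp_apply]
    rw [e q r qr (n - 1) (n' - 1) (by omega) hqr (by omega) (by omega),
      (L t).leibniz (p' := n) (q' := r + 1) _ _ (by omega) rfl hn (by omega),
      E.leibniz hqr rfl rfl rfl (by omega) (by omega), map_add, map_smul, ← (F t).map_d,
      e (q + 1) r (qr + 1) n n' (by omega) (by omega) (by omega) (by omega),
      e q (r + 1) (qr + 1) (n - 1) n' (by omega) (by omega) (by omega) (by omega)]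
    simp only [map_sub, map_smul, LinearMap.sub_apply, LinearMap.smul_apply, smul_add, smul_smul,
      koszulSign_mul]
    rw [koszulSign_congr (k := k) (m := c + (n - 1)) (n := p + q) ⟨0, by omega⟩]
    abel⟩
  map_add' φ ψ := by
    refine Subtype.ext ?_
    funext t x i
    refine LinearMap.ext fun f => ?_
    simp only [Submodule.coe_add, Pi.add_apply, LinearMap.sub_apply, LinearMap.smul_apply,
      LinearMap.comp_apply, LinearMap.add_apply, map_add, smul_add]
    abel
  map_smul' s φ := by
    refine Subtype.ext ?_
    funext t x i
    refine LinearMap.ext fun f => ?_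
    simp only [Submodule.coe_smul, Pi.smul_apply, LinearMap.sub_apply, LinearMap.smul_apply,
      LinearMap.comp_apply, map_smul, smul_sub, RingHom.id_apply, smul_comm s]

theorem coindD_apply (a : E.Obj) {p p' : ℤ} (h : p + 1 = p') (φ : coindX c F L a p) (t : T)
    (x : D.Obj) {q q' n n' : ℤ} (hq : q + 1 = q') (hn : n + 1 = n') (h1 : p' + q = n' + c)
    (h2 : p + q = n + c) (h3 : p + q' = n' + c) (f : E.Hom ((F t).obj x) a q) :
    (coindD c F L a h φ).1 t x ⟨(q, n'), h1⟩ f =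
      koszulSign k c • (L t).d hn (φ.1 t x ⟨(q, n), h2⟩ f) - koszulSign k p • φ.1 t x ⟨(q', n'), h3⟩ (E.d hq f) := by
  obtain rfl : n = n' - 1 := by omega
  subst hq
  rfl

/-- The action on the coinduced module. -/
def coindAct {a b : E.Obj} {p q n : ℤ} (h : p + q = n) :
    coindX c F L b p →ₗ[k] E.Hom a b q →ₗ[k] coindX c F L a n :=
  LinearMap.mk₂ k (fun φ g => ⟨fun t x i =>
    φ.1 t x ⟨(q + i.1.1, i.1.2), by have := i.2; dsimp only; omega⟩ ∘ₗ E.comp rfl g, by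
    intro t x y r s rs m m' h1 hrs h2 hm f e
    simp only [LinearMap.comp_apply]
    rw [← φ.2 t x y (q + r) s (q + rs) m m' (by omega) (by omega) (by omega) hm,
      E.assoc rfl hrs (by omega) rfl]⟩)
    (by intros; rfl) (by intros; rfl)
    (by intros; refine Subtype.ext ?_; funext t x i; refine LinearMap.ext fun f => ?_; simp)
    (by intros; refine Subtype.ext ?_; funext t x i; refine LinearMap.ext fun f => ?_; simp)

theorem coindAct_apply {a b : E.Obj} {p q n : ℤ} (h : p + q = n) (φ : coindX c F L b p)
    (g : E.Hom a b q) (t : T) (x : D.Obj) {r qr m : ℤ} (hqr : q + r = qr) (h1 : n + r = m + c)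
    (h2 : p + qr = m + c) (f : E.Hom ((F t).obj x) a r) :
    (coindAct c F L h φ g).1 t x ⟨(r, m), h1⟩ f = φ.1 t x ⟨(qr, m), h2⟩ (E.comp hqr g f) := by
  subst hqr; rfl

theorem coindX_ext {c : ℤ} {F : T → DGFunctor D E} {L : T → DGModule D} {a : E.Obj} {p : ℤ}
    {φ ψ : coindX c F L a p}
    (h : ∀ t x q n (hn : p + q = n + c) (f : E.Hom ((F t).obj x) a q),
      φ.1 t x ⟨(q, n), hn⟩ f = ψ.1 t x ⟨(q, n), hn⟩ f) : φ = ψ :=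
  Subtype.ext (by funext t x ⟨⟨q, n⟩, hn⟩; exact LinearMap.ext (h t x q n hn))

/-- The module coinduced from the modules `L t` along the dg functors `F t`, with grading shifted
by `c`. -/
def coind : DGModule E where
  X a p := coindX c F L a p
  d {a _ _} h := coindD c F L a h
  act h := coindAct c F L h
  d_d {a p q r} h h' φ := by
    refine coindX_ext fun t x s n hn f => ?_
    rw [coindD_apply c F L a h' _ t x rfl (sub_add_cancel n 1) hn (by omega) (by omega),
      coindD_apply c F L a h _ t x rfl (sub_add_cancel (n - 1) 1) _ (by omega) (by omega),
      coindD_apply c F L a h _ t x rfl (sub_add_cancel n 1) _ (by omega) (by omega)]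
    subst h
    simp only [map_sub, map_smul, (L t).d_d, E.d_d, map_zero, smul_zero, zero_sub, sub_zero,
      koszulSign_succ, smul_neg, neg_smul]
    rw [smul_comm, sub_neg_eq_add, neg_add_cancel]
    rfl
  act_id {a p} h φ := by
    refine coindX_ext fun t x s n hn f => ?_
    rw [coindAct_apply c F L h φ _ t x (zero_add s) hn hn, E.id_comp]
  act_act {a b c' p q r pq qr n} hpq hqr h h' φ f g := by
    refine coindX_ext fun t x s m hm e => ?_
    rw [coindAct_apply c F L h _ _ t x rfl hm (by omega),
      coindAct_apply c F L hpq _ _ t x rfl _ (by omega),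
      coindAct_apply c F L h' _ _ t x (by omega : qr + s = q + (r + s)) hm (by omega),
      E.assoc hqr rfl _ rfl]
  leibniz {a b p q n p' q' n'} h hn hp hq h₁ h₂ φ g := by
    refine coindX_ext fun t x s m hm e => ?_
    rw [coindD_apply c F L a hn _ t x rfl (sub_add_cancel m 1) hm (by omega) (by omega),
      coindAct_apply c F L h _ _ t x rfl _ (by omega),
      coindAct_apply c F L h _ _ t x (by omega : q + (s + 1) = q + s + 1) _ (by omega)]
    rw [Submodule.coe_add, Submodule.coe_smul]
    simp only [Pi.add_apply, Pi.smul_apply, LinearMap.add_apply, LinearMap.smul_apply]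
    rw [coindAct_apply c F L h₁ _ _ t x rfl hm (by omega),
      coindAct_apply c F L h₂ _ _ t x (by omega : q' + s = q + s + 1) hm (by omega),
      coindD_apply c F L b hp _ t x rfl (sub_add_cancel m 1) _ (by omega) (by omega),
      E.leibniz rfl rfl hq rfl (by omega) (by omega), map_add, map_smul, smul_add, smul_smul,
      koszulSign_mul, h]
    abel

/-- Evaluation of an element of the coinduced module. -/
def coindEv {a : E.Obj} {p : ℤ} (t : T) (x : D.Obj) {q n : ℤ} (h : p + q = n + c) :
    (coind c F L).X a p →ₗ[k] E.Hom ((F t).obj x) a q →ₗ[k] (L t).X x n where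
  toFun φ := φ.1 t x ⟨(q, n), h⟩
  map_add' _ _ := rfl
  map_smul' _ _ := rfl

end

variable {c : ℤ} {F : T → DGFunctor D E} {L : T → DGModule D}

theorem coind_ext {a : E.Obj} {p : ℤ} {φ ψ : (coind c F L).X a p}
    (h : ∀ t x q n (hn : p + q = n + c) (f : E.Hom ((F t).obj x) a q),
      coindEv c F L t x hn φ f = coindEv c F L t x hn ψ f) : φ = ψ :=
  coindX_ext h

theorem coindEv_comp {a : E.Obj} {p : ℤ} (φ : (coind c F L).X a p) (t : T) {x y : D.Obj}
    {q r qr n n' : ℤ} (h : p + q = n + c) (hqr : q + r = qr) (h' : p + qr = n' + c)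
    (hn : n + r = n') (f : E.Hom ((F t).obj x) a q) (g : D.Hom y x r) :
    coindEv c F L t y h' φ (E.comp hqr f ((F t).map g)) =
      (L t).act hn (coindEv c F L t x h φ f) g :=
  φ.2 t x y q r qr n n' h hqr h' hn f g

theorem coindEv_d {a : E.Obj} {p p' : ℤ} (h : p + 1 = p') (φ : (coind c F L).X a p) (t : T)
    (x : D.Obj) {q q' n n' : ℤ} (hq : q + 1 = q') (hn : n + 1 = n') (h1 : p' + q = n' + c)
    (h2 : p + q = n + c) (h3 : p + q' = n' + c) (f : E.Hom ((F t).obj x) a q) :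
    coindEv c F L t x h1 ((coind c F L).d h φ) f =
      koszulSign k c • (L t).d hn (coindEv c F L t x h2 φ f) -
        koszulSign k p • coindEv c F L t x h3 φ (E.d hq f) :=
  coindD_apply c F L a h φ t x hq hn h1 h2 h3 f

theorem coindEv_act {a b : E.Obj} {p q n : ℤ} (h : p + q = n) (φ : (coind c F L).X b p)
    (g : E.Hom a b q) (t : T) (x : D.Obj) {r qr m : ℤ} (hqr : q + r = qr) (h1 : n + r = m + c)
    (h2 : p + qr = m + c) (f : E.Hom ((F t).obj x) a r) :
    coindEv c F L t x h1 ((coind c F L).act h φ g) f =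
      coindEv c F L t x h2 φ (E.comp hqr g f) :=
  coindAct_apply c F L h φ g t x hqr h1 h2 f

/-- Construction of linear maps to a coinduced module. -/
def coindLift {V : Type u} [AddCommGroup V] [Module k V] {a : E.Obj} {p : ℤ}
    (β : ∀ (t : T) (x : D.Obj) (q n : ℤ), p + q = n + c →
      V →ₗ[k] E.Hom ((F t).obj x) a q →ₗ[k] (L t).X x n)
    (hβ : ∀ (t : T) (x y : D.Obj) (q r qr n n' : ℤ) (h : p + q = n + c) (hqr : q + r = qr)
      (h' : p + qr = n' + c) (hn : n + r = n') (v : V) (f : E.Hom ((F t).obj x) a q)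
      (g : D.Hom y x r),
      β t y qr n' h' v (E.comp hqr f ((F t).map g)) = (L t).act hn (β t x q n h v f) g) :
    V →ₗ[k] (coind c F L).X a p where
  toFun v := (⟨fun t x i => β t x i.1.1 i.1.2 i.2 v, fun t x y q r qr n n' h hqr h' hn f g =>
    hβ t x y q r qr n n' h hqr h' hn v f g⟩ : coindX c F L a p)
  map_add' v w := coindX_ext fun t x q n h f => by
    simp only [map_add]; rfl
  map_smul' s v := coindX_ext fun t x q n h f => by
    simp only [map_smul]; rfl

theorem coindEv_lift {V : Type u} [AddCommGroup V] [Module k V] {a : E.Obj} {p : ℤ}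
    (β : ∀ (t : T) (x : D.Obj) (q n : ℤ), p + q = n + c →
      V →ₗ[k] E.Hom ((F t).obj x) a q →ₗ[k] (L t).X x n) (hβ)
    (v : V) (t : T) (x : D.Obj) {q n : ℤ} (h : p + q = n + c) (f : E.Hom ((F t).obj x) a q) :
    coindEv c F L t x h (coindLift β hβ v) f = β t x q n h v f := rfl

/-! ### The adjunction between restriction and coinduction -/

section Adjunction

variable (F : DGFunctor D E)

/-- Coinduction along one dg functor. -/
abbrev coindOne (L : DGModule D) : DGModule E :=
  coind (T := PUnit.{u + 1}) 0 (fun _ => F) (fun _ => L)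

/-- The morphism `M ⟶ F_* L` that corresponds to a morphism `F^* M ⟶ L`. -/
def toCoind {M : DGModule E} {L : DGModule D} (b : M.restrict F ⟶ L) : M ⟶ coindOne F L :=
  Hom.mk (fun a p => coindLift
    (fun _ x q n h => (M.act (by omega : p + q = n)).compr₂ (resApp b x n))
    (fun _ x y q r qr n n' h hqr h' hn v f g => by
      simp only [LinearMap.compr₂_apply]
      rw [← M.act_act (pq := n) (by omega) hqr hn, resApp_act]))
    (fun {a p p'} h m => coind_ext fun t x q n hn f => by
      rw [coindEv_d h _ t x rfl (sub_add_cancel n 1) hn (by omega) (by omega)]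
      simp only [coindEv_lift, LinearMap.compr₂_apply, koszulSign_zero, one_smul]
      rw [eq_sub_iff_add_eq, ← map_smul, ← map_add,
        ← M.leibniz (n := n - 1) (by omega) (by omega) h rfl, resApp_d])
    (fun {a b p q n} h m f => coind_ext fun t x r s hs g => by
      rw [coindEv_act h _ _ t x rfl hs (by omega)]
      simp only [coindEv_lift, LinearMap.compr₂_apply]
      rw [M.act_act h rfl _ (by omega)])

theorem ev_toCoind {M : DGModule E} {L : DGModule D} (b : M.restrict F ⟶ L) (a : E.Obj) {p : ℤ}
    (m : M.X a p) (t : PUnit) (x : D.Obj) {q n : ℤ} (h : p + q = n + 0) (h' : p + q = n)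
    (f : E.Hom (F.obj x) a q) :
    coindEv (T := PUnit.{u + 1}) 0 (fun _ => F) (fun _ => L) t x h ((toCoind F b).app a p m) f =
      resApp b x n (M.act h' m f) := rfl

/-- The counit of the adjunction. -/
def coindCounit (L : DGModule D) : (coindOne F L).restrict F ⟶ L :=
  ofRes (fun x p => (coindEv (T := PUnit.{u + 1}) 0 (fun _ => F) (fun _ => L) PUnit.unit x
      (by omega : p + 0 = p + 0)).flip (E.id (F.obj x)))
    (fun x p q h φ => by
      simp only [LinearMap.flip_apply]
      rw [coindEv_d h φ PUnit.unit x (zero_add 1) h _ rfl (by omega),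
        koszulSign_zero, one_smul, E.d_id, map_zero, smul_zero, sub_zero])
    (fun x y p q n h φ f => by
      simp only [LinearMap.flip_apply]
      rw [coindEv_act h φ (F.map f) PUnit.unit x (add_zero q) _ (by omega),
        E.comp_id, ← E.id_comp (zero_add q) (F.map f)]
      exact coindEv_comp φ _ _ (zero_add q) _ h _ f)

/-- The map `f ↦ b (m · f)` takes the value `b m` at the identity. -/
theorem toCoind_counit {M : DGModule E} {L : DGModule D} (b : M.restrict F ⟶ L) :
    restrictMap F (toCoind F b) ≫ coindCounit F L = b := by
  refine Hom.ext ?_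
  funext a p
  refine LinearMap.ext fun m => ?_
  exact congrArg (resApp b a p) (M.act_id (add_zero p) m)

/-- Linearity of `g` gives `g (m · f) (1) = (g m · f) (1) = g m (f)`; with `toCoind_counit` this
makes `toCoind` a bijection. -/
theorem counit_toCoind {M : DGModule E} {L : DGModule D} (g : M ⟶ coindOne F L) :
    toCoind F (restrictMap F g ≫ coindCounit F L) = g := by
  refine Hom.ext ?_
  funext a p
  refine LinearMap.ext fun m => coind_ext fun t x q n hn f => ?_
  show coindEv _ _ _ _ _ _ (g.app _ _ (M.act _ m f)) (E.id _) = _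
  rw [g.app_act (by omega : p + q = n), coindEv_act _ _ _ _ _ (add_zero q) _ hn, E.comp_id]

/-- Functoriality of coinduction. -/
def coindMap {L L' : DGModule D} (b : L ⟶ L') : coindOne F L ⟶ coindOne F L' :=
  toCoind F (coindCounit F L ≫ b)

/-- Both sides have the same adjoint, by the two triangle identities above. -/
theorem toCoind_comp {M : DGModule E} {L L' : DGModule D} (b : M.restrict F ⟶ L) (e : L ⟶ L') :
    toCoind F (b ≫ e) = toCoind F b ≫ coindMap F e := by
  rw [← counit_toCoind F (toCoind F b ≫ coindMap F e)]
  congr 1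
  show _ = restrictMap F (toCoind F b) ≫ restrictMap F (coindMap F e) ≫ coindCounit F L'
  rw [coindMap, toCoind_counit, ← Category.assoc, toCoind_counit]

theorem ev_coindMap {L L' : DGModule D} (b : L ⟶ L') (a : E.Obj) {p : ℤ}
    (φ : (coindOne F L).X a p) (t : PUnit) (x : D.Obj) {q n : ℤ} (h : p + q = n + 0)
    (f : E.Hom (F.obj x) a q) :
    coindEv (T := PUnit.{u + 1}) 0 (fun _ => F) (fun _ => L') t x h ((coindMap F b).app a p φ) f =
      b.app x n (coindEv (T := PUnit.{u + 1}) 0 (fun _ => F) (fun _ => L) t x h φ f) := by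
  rw [coindMap, ev_toCoind F _ a φ t x h (by omega) f]
  show b.app x n (coindEv _ _ _ _ _ _ ((coindOne F L).act (by omega : p + q = n) φ f) (E.id _)) = _
  rw [coindEv_act _ _ _ _ _ (add_zero q) _ h, E.comp_id]

theorem toCoind_sub {M : DGModule E} {L : DGModule D} (b e : M.restrict F ⟶ L) :
    toCoind F (b - e) = toCoind F b - toCoind F e := by
  refine Hom.ext ?_
  funext a p
  refine LinearMap.ext fun m => coind_ext fun t x q n hn f => ?_
  rw [sub_app, map_sub, LinearMap.sub_apply, ev_toCoind F _ a m t x hn (by omega),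
    ev_toCoind F _ a m t x hn (by omega), ev_toCoind F _ a m t x hn (by omega)]
  exact sub_app b e x n _

/-- The linear maps underlying the homotopy that corresponds to a homotopy on the restriction. -/
def ResHomotopy.coindApp {M : DGModule E} {L : DGModule D} {b : M.restrict F ⟶ L}
    (s : ResHomotopy b) (a : E.Obj) {p p' : ℤ} (h : p' + 1 = p) :
    M.X a p →ₗ[k] (coindOne F L).X a p' :=
  coindLift (fun _ x q n hn => (M.act rfl).compr₂ (s.app x (by omega : n + 1 = p + q))) (by
    intro t x y q r qr n n' h1 hqr h2 hn v f g
    simp only [LinearMap.compr₂_apply]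
    rw [← M.act_act rfl hqr (by omega : p + q + r = p + qr)]
    exact s.app_act _ _ _ hn (M.act _ v f) g)

theorem ResHomotopy.ev_coindApp {M : DGModule E} {L : DGModule D} {b : M.restrict F ⟶ L}
    (s : ResHomotopy b) (a : E.Obj) {p p' : ℤ} (h : p' + 1 = p) (m : M.X a p) (t : PUnit)
    (x : D.Obj) {q n w : ℤ} (hn : p' + q = n + 0) (hw : p + q = w) (hw' : n + 1 = w)
    (f : E.Hom (F.obj x) a q) :
    coindEv (T := PUnit.{u + 1}) 0 (fun _ => F) (fun _ => L) t x hn (s.coindApp F a h m) f =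
      s.app x hw' (M.act hw m f) := by
  subst hw; rfl

/-- A null-homotopy s of b yields the null-homotopy m ↦ (f ↦ s (m · f)), by the Leibniz rule for m ·
f. So the adjunction descends to homotopy classes. -/
theorem IsNullHomotopic.toCoind {M : DGModule E} {L : DGModule D} {b : M.restrict F ⟶ L}
    (hb : IsNullHomotopic b) : IsNullHomotopic (toCoind F b) := by
  obtain ⟨s⟩ := (isNullHomotopic_iff_resHomotopy b).1 hb
  refine ⟨⟨fun a p p' h => s.coindApp F a h, ?_⟩, ?_⟩
  · intro a b p q n p' n' h hp hn h' m f
    refine coind_ext fun t x r r' hr g => ?_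
    rw [coindEv_act h' _ _ t x rfl hr (by omega), s.ev_coindApp F _ _ _ t x hr rfl (by omega),
      s.ev_coindApp F _ _ _ t x _ (by omega : p + (q + r) = n + r) (by omega),
      M.act_act h rfl]
  · intro a p q r hq hr m
    refine coind_ext fun t x q' n hn f => ?_
    rw [ev_toCoind F b a m t x hn (by omega), map_add, LinearMap.add_apply,
      coindEv_d hq _ t x rfl (sub_add_cancel n 1) hn (by omega) (by omega),
      s.ev_coindApp F _ _ _ t x _ (by omega : p + q' = n) (by omega),
      s.ev_coindApp F _ _ _ t x _ (by omega : p + (q' + 1) = n + 1) rfl,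
      s.ev_coindApp F _ _ _ t x hn (by omega : r + q' = n + 1) rfl,
      s.eq x (by omega : n - 1 + 1 = n) rfl,
      M.leibniz (by omega) rfl hr rfl (by omega : r + q' = n + 1) (by omega : p + (q' + 1) = n + 1),
      koszulSign_zero, one_smul, map_add, map_smul,
      koszulSign_of_succ hq, neg_smul]
    abel

/-- The left adjoint, restriction, preserves acyclic modules, and the adjunction respects
null-homotopies. -/
theorem IsKInj.coindOne {L : DGModule D} (hL : L.IsKInj) : (coindOne F L).IsKInj := by
  intro M hM g
  rw [← counit_toCoind F g]
  exact (hL _ (hM.restrict F) _).toCoind F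

end Adjunction

end DGModule

end

/-! ### The cobar complex and the existence of K-injective resolutions. -/

noncomputable section

namespace DGModule

variable {k : Type u} [Field k] {D E : DGCat.{u} k} {T : Type u}

/-! ### Total complexes of sequences of dg modules -/

/-- A closed morphism of degree one (in the sense that it anticommutes with the differentials). -/
structure DegOne (X Y : DGModule E) : Type u where
  app : ∀ (a : E.Obj) {p q : ℤ}, p + 1 = q → X.X a p →ₗ[k] Y.X a q
  app_d : ∀ {a : E.Obj} {p q r : ℤ} (h : p + 1 = q) (h' : q + 1 = r) (m : X.X a p),
    app a h' (X.d h m) = -Y.d h' (app a h m)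
  app_act : ∀ {a b : E.Obj} {p q n p' n' : ℤ} (h : p + q = n) (hp : p + 1 = p')
    (hn : n + 1 = n') (h' : p' + q = n') (m : X.X b p) (f : E.Hom a b q),
    app a hn (X.act h m f) = Y.act h' (app b hp m) f

/-- A morphism of graded modules, not necessarily compatible with the differentials. -/
structure GrHom (X Y : DGModule E) : Type u where
  app : ∀ (a : E.Obj) (p : ℤ), X.X a p →ₗ[k] Y.X a p
  app_act : ∀ {a b : E.Obj} {p q n : ℤ} (h : p + q = n) (m : X.X b p) (f : E.Hom a b q),
    app a n (X.act h m f) = Y.act h (app b p m) f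

/-- The difference of two closed morphisms of degree one. -/
def DegOne.sub {X Y : DGModule E} (f g : DegOne X Y) : DegOne X Y where
  app a _ _ h := f.app a h - g.app a h
  app_d h h' m := by
    simp only [LinearMap.sub_apply, f.app_d h h', g.app_d h h', map_sub, neg_sub_neg, neg_sub]
  app_act h hp hn h' m x := by
    simp only [LinearMap.sub_apply, f.app_act h hp hn h', g.app_act h hp hn h', map_sub]

/-- Construction of morphisms of degree one. -/
def DegOne.ofFamily {X Y : DGModule E} (φ : ∀ (a : E.Obj) (p : ℤ), X.X a p →ₗ[k] Y.X a (p + 1))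
    (hd : ∀ (a : E.Obj) (p : ℤ) (m : X.X a p), φ a (p + 1) (X.d rfl m) = -Y.d rfl (φ a p m))
    (hact : ∀ {a b : E.Obj} {p q n : ℤ} (h : p + q = n) (m : X.X b p) (f : E.Hom a b q),
      φ a n (X.act h m f) = Y.act (by omega) (φ b p m) f) : DegOne X Y where
  app a p q h := Y.cast a h ∘ₗ φ a p
  app_d h h' m := by
    subst h h'
    exact hd _ _ m
  app_act h hp hn h' m f := by
    subst hp hn
    exact hact h m f

section Tot

variable (W : ℕ → DGModule E) (δ : ∀ n, DegOne (W n) (W (n + 1)))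

/-- The differential of the total module. -/
def totD (a : E.Obj) {p q : ℤ} (h : p + 1 = q) :
    (∀ n, (W (n + 1)).X a (p + 1)) →ₗ[k] (∀ n, (W (n + 1)).X a (q + 1)) :=
  -- The differential is `-d - δ`, the sign of `d` coming from the shift by one. The component at `W
  -- 1` receives no `δ`, since `W 0` is not part of the total module.
  LinearMap.pi fun n => match n with
    | 0 => -((W 1).d (by omega : p + 1 + 1 = q + 1) ∘ₗ
        (LinearMap.proj 0 : (∀ n, (W (n + 1)).X a (p + 1)) →ₗ[k] _))
    | n + 1 => -((W (n + 2)).d (by omega : p + 1 + 1 = q + 1) ∘ₗ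
          (LinearMap.proj (n + 1) : (∀ n, (W (n + 1)).X a (p + 1)) →ₗ[k] _)) -
        (δ (n + 1)).app a (by omega : p + 1 + 1 = q + 1) ∘ₗ
          (LinearMap.proj n : (∀ n, (W (n + 1)).X a (p + 1)) →ₗ[k] _)

theorem totD_zero (a : E.Obj) {p q : ℤ} (h : p + 1 = q) (z : ∀ n, (W (n + 1)).X a (p + 1)) :
    totD W δ a h z 0 = -(W 1).d (by omega) (z 0) := rfl

theorem totD_succ (a : E.Obj) {p q : ℤ} (h : p + 1 = q) (z : ∀ n, (W (n + 1)).X a (p + 1))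
    (n : ℕ) : totD W δ a h z (n + 1) =
      -(W (n + 2)).d (by omega) (z (n + 1)) - (δ (n + 1)).app a (by omega) (z n) := rfl

variable (hδ : ∀ (n : ℕ) (a : E.Obj) (p q r : ℤ) (h : p + 1 = q) (h' : q + 1 = r)
  (m : (W n).X a p), (δ (n + 1)).app a h' ((δ n).app a h m) = 0)

/-- The total module of the sequence `W 1 → W 2 → ⋯`, shifted by one. -/
def tot : DGModule E where
  X a p := ∀ n, (W (n + 1)).X a (p + 1)
  d {a _ _} h := totD W δ a h
  act {a b p q n} h := LinearMap.mk₂ k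
    (fun z f i => (W (i + 1)).act (by omega : p + 1 + q = n + 1) (z i) f)
    (by intros; funext i; simp) (by intros; funext i; simp) (by intros; funext i; simp)
    (by intros; funext i; simp)
  d_d {a p q r} h h' z := by
    funext n
    cases n with
    | zero => rw [totD_zero, totD_zero, map_neg, (W 1).d_d, neg_zero, neg_zero]; rfl
    | succ n =>
      rw [totD_succ, totD_succ, map_sub, map_neg, (W (n + 2)).d_d]
      cases n with
      | zero =>
        rw [totD_zero, map_neg, (δ 1).app_d (by omega) (by omega)]
        simp
      | succ n =>
        rw [totD_succ, map_sub, map_neg, hδ, (δ (n + 2)).app_d (by omega) (by omega)]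
        simp
  act_id h z := by
    funext n
    exact (W (n + 1)).act_id _ _
  act_act hpq hqr h h' m f g := by
    funext n
    exact (W (n + 1)).act_act _ _ _ _ _ _ _
  leibniz {a b p q n p' q' n'} h hn hp hq h₁ h₂ m f := by
    have hs : koszulSign k (p + 1) = - koszulSign k p := koszulSign_succ p
    have e : ∀ i, (W (i + 1)).d (by omega : n + 1 + 1 = n' + 1)
        ((W (i + 1)).act (by omega : p + 1 + q = n + 1) (m i) f) =
        (W (i + 1)).act (by omega : p' + 1 + q = n' + 1) ((W (i + 1)).d (by omega) (m i)) f -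
        koszulSign k p • (W (i + 1)).act (by omega : p + 1 + q' = n' + 1) (m i) (E.d hq f) := by
      intro i
      rw [(W (i + 1)).leibniz (p' := p' + 1) (n' := n' + 1) _ _ (by omega) hq (by omega)
        (by omega), hs, neg_smul, sub_eq_add_neg]
    funext i
    cases i with
    | zero =>
      refine (congrArg (- ·) (e 0)).trans ?_
      refine Eq.trans ?_ (congrArg (· + koszulSign k p •
        (W 1).act (by omega : p + 1 + q' = n' + 1) (m 0) (E.d hq f))
          (LinearMap.map_neg₂ ((W 1).act (by omega : p' + 1 + q = n' + 1))
            ((W 1).d (by omega : p + 1 + 1 = p' + 1) (m 0)) f).symm)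
      abel
    | succ i =>
      refine (congrArg (- · - (δ (i + 1)).app a (by omega : n + 1 + 1 = n' + 1)
        ((W (i + 1)).act (by omega : p + 1 + q = n + 1) (m i) f)) (e (i + 1))).trans ?_
      refine Eq.trans ?_ (congrArg (· + koszulSign k p •
        (W (i + 2)).act (by omega : p + 1 + q' = n' + 1) (m (i + 1)) (E.d hq f))
          (LinearMap.map_sub₂ ((W (i + 2)).act (by omega : p' + 1 + q = n' + 1))
            (-(W (i + 2)).d (by omega : p + 1 + 1 = p' + 1) (m (i + 1)))
            ((δ (i + 1)).app b (by omega : p + 1 + 1 = p' + 1) (m i)) f).symm)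
      rw [(δ (i + 1)).app_act (p' := p' + 1) _ (by omega) _ (by omega), map_neg,
        LinearMap.neg_apply]
      abel

/-- The components of the elements of the total module. -/
def totProj (a : E.Obj) (p : ℤ) (n : ℕ) : (tot W δ hδ).X a p →ₗ[k] (W (n + 1)).X a (p + 1) :=
  LinearMap.proj n

/-- Construction of linear maps to the total module. -/
def totLift {V : Type u} [AddCommGroup V] [Module k V] (a : E.Obj) (p : ℤ)
    (f : ∀ n, V →ₗ[k] (W (n + 1)).X a (p + 1)) : V →ₗ[k] (tot W δ hδ).X a p :=
  LinearMap.pi f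

variable {W δ hδ}

theorem totProj_lift {V : Type u} [AddCommGroup V] [Module k V] (a : E.Obj) (p : ℤ)
    (f : ∀ n, V →ₗ[k] (W (n + 1)).X a (p + 1)) (v : V) (n : ℕ) :
    totProj W δ hδ a p n (totLift W δ hδ a p f v) = f n v := rfl

theorem tot_ext {a : E.Obj} {p : ℤ} {y z : (tot W δ hδ).X a p}
    (h : ∀ n, totProj W δ hδ a p n y = totProj W δ hδ a p n z) : y = z := funext h

/-- The element of the total module with given components. -/
def totMk {a : E.Obj} {p : ℤ} (z : ∀ n, (W (n + 1)).X a (p + 1)) : (tot W δ hδ).X a p := z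

theorem totProj_mk {a : E.Obj} {p : ℤ} (z : ∀ n, (W (n + 1)).X a (p + 1)) (n : ℕ) :
    totProj W δ hδ a p n (totMk z) = z n := rfl

theorem totProj_d_zero (a : E.Obj) {p q : ℤ} (h : p + 1 = q) (z : (tot W δ hδ).X a p) :
    totProj W δ hδ a q 0 ((tot W δ hδ).d h z) =
      -(W 1).d (by omega) (totProj W δ hδ a p 0 z) := rfl

theorem totProj_d_succ (a : E.Obj) {p q : ℤ} (h : p + 1 = q) (z : (tot W δ hδ).X a p) (n : ℕ) :
    totProj W δ hδ a q (n + 1) ((tot W δ hδ).d h z) =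
      -(W (n + 2)).d (by omega) (totProj W δ hδ a p (n + 1) z) -
        (δ (n + 1)).app a (by omega) (totProj W δ hδ a p n z) := rfl

theorem totProj_act {a b : E.Obj} {p q n : ℤ} (h : p + q = n) (z : (tot W δ hδ).X b p)
    (f : E.Hom a b q) (i : ℕ) :
    totProj W δ hδ a n i ((tot W δ hδ).act h z f) =
      (W (i + 1)).act (by omega : p + 1 + q = n + 1) (totProj W δ hδ b p i z) f := rfl

variable (W δ hδ)

/-- The augmentation `W 0 ⟶ tot W`. -/
def totι : W 0 ⟶ tot W δ hδ :=
  Hom.mk (fun a p => totLift W δ hδ a p fun n => match n with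
      | 0 => (δ 0).app a rfl
      | _ + 1 => 0)
    (fun {a p q} h m => tot_ext fun n => by
      subst h
      match n with
      | 0 =>
        rw [totProj_d_zero]
        exact (δ 0).app_d rfl rfl m
      | 1 =>
        rw [totProj_d_succ]
        simp only [totProj_lift]
        rw [LinearMap.zero_apply, LinearMap.zero_apply, map_zero, neg_zero, hδ 0, sub_zero]
      | n + 2 =>
        rw [totProj_d_succ]
        simp only [totProj_lift]
        rw [LinearMap.zero_apply, LinearMap.zero_apply, LinearMap.zero_apply, map_zero, map_zero,
          neg_zero, sub_zero])
    (fun {a b p q n} h m f => tot_ext fun i => by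
      rw [totProj_act]
      match i with
      | 0 => exact (δ 0).app_act h rfl rfl (by omega) m f
      | i + 1 =>
        simp only [totProj_lift]
        rw [LinearMap.zero_apply, LinearMap.zero_apply, map_zero, LinearMap.zero_apply])

theorem totProj_ι_zero (a : E.Obj) (p : ℤ) (m : (W 0).X a p) :
    totProj W δ hδ a p 0 ((totι W δ hδ).app a p m) = (δ 0).app a rfl m := rfl

theorem totProj_ι_succ (a : E.Obj) (p : ℤ) (m : (W 0).X a p) (n : ℕ) :
    totProj W δ hδ a p (n + 1) ((totι W δ hδ).app a p m) = 0 := rfl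

/-- A contraction of the complex `W 0 → W 1 → ⋯` at the object `b`. -/
structure SeqContraction (b : E.Obj) : Type u where
  ρ : ∀ (n : ℕ) {p q : ℤ}, q + 1 = p → (W (n + 1)).X b p →ₗ[k] (W n).X b q
  ρ_d : ∀ (n : ℕ) {p q r : ℤ} (h : q + 1 = p) (h' : p + 1 = r) (y : (W (n + 1)).X b p),
    ρ n h' ((W (n + 1)).d h' y) = -(W n).d h (ρ n h y)
  ρ_δ_zero : ∀ {p q : ℤ} (h : p + 1 = q) (m : (W 0).X b p), ρ 0 h ((δ 0).app b h m) = m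
  ρ_δ_succ : ∀ (n : ℕ) {p q r : ℤ} (h : p + 1 = q) (h' : q + 1 = r) (y : (W (n + 1)).X b q),
    ρ (n + 1) h' ((δ (n + 1)).app b h' y) = y - (δ n).app b h (ρ n h y)

variable {W δ}

/-- If the image of `m` is the boundary of `z`, its component zero reads `δ m = -d z_0`; applying
the contraction gives `m = d (ρ z_0)`. -/
theorem SeqContraction.ι_inj {b : E.Obj} (S : SeqContraction W δ b) {p q : ℤ} (hq : q + 1 = p)
    (m : (W 0).X b p) (z : (tot W δ hδ).X b q)
    (h : (totι W δ hδ).app b p m = (tot W δ hδ).d hq z) : ∃ w : (W 0).X b q, m = (W 0).d hq w := by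
  subst hq
  refine ⟨S.ρ 0 rfl (totProj W δ hδ b q 0 z), ?_⟩
  have h0 := congrArg (totProj W δ hδ b (q + 1) 0) h
  rw [totProj_ι_zero, totProj_d_zero] at h0
  rw [← S.ρ_δ_zero rfl m, h0, map_neg, S.ρ_d 0 rfl rfl, neg_neg]

/-- For a cocycle `y`, applying `ρ` to the cocycle equations shows that `y` differs from the image
of `ρ y_0` by the boundary of the family `-ρ y_{n+1}`. No convergence is at stake, because the total
module is a product and each component of its differential involves at most two terms. -/
theorem SeqContraction.ι_surj {b : E.Obj} (S : SeqContraction W δ b) {p q r : ℤ} (hq : q + 1 = p)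
    (hr : p + 1 = r) (y : (tot W δ hδ).X b p) (hy : (tot W δ hδ).d hr y = 0) :
    ∃ (m : (W 0).X b p) (z : (tot W δ hδ).X b q), (W 0).d hr m = 0 ∧
      y = (totι W δ hδ).app b p m + (tot W δ hδ).d hq z := by
  subst hq hr
  have hy' := fun n => congrArg (totProj W δ hδ b (q + 1 + 1) n) hy
  have h0 : (W 1).d rfl (totProj W δ hδ b (q + 1) 0 y) = 0 := by
    have := hy' 0
    rwa [totProj_d_zero, map_zero, neg_eq_zero] at this
  have h2 : ∀ n, (W (n + 1)).d rfl (S.ρ (n + 1) rfl (totProj W δ hδ b (q + 1) (n + 1) y)) =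
      totProj W δ hδ b (q + 1) n y -
        (δ n).app b rfl (S.ρ n rfl (totProj W δ hδ b (q + 1) n y)) := fun n => by
    have := congrArg (S.ρ (n + 1) rfl) (hy' (n + 1))
    rw [totProj_d_succ, map_zero, map_zero, map_sub, map_neg, S.ρ_d (n + 1) rfl rfl, neg_neg,
      sub_eq_zero] at this
    rw [this, S.ρ_δ_succ n rfl rfl]
  refine ⟨S.ρ 0 rfl (totProj W δ hδ b (q + 1) 0 y),
    totMk fun n => -S.ρ (n + 1) rfl (totProj W δ hδ b (q + 1) (n + 1) y), ?_, ?_⟩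
  · have := S.ρ_d 0 rfl rfl (totProj W δ hδ b (q + 1) 0 y)
    rw [h0, map_zero, eq_comm, neg_eq_zero] at this
    exact this
  · refine tot_ext fun n => ?_
    cases n with
    | zero =>
      rw [map_add, totProj_ι_zero, totProj_d_zero, totProj_mk, map_neg, neg_neg, h2]
      abel
    | succ n =>
      rw [map_add, totProj_ι_succ, totProj_d_succ, totProj_mk, totProj_mk, map_neg, map_neg,
        neg_neg, h2]
      abel

/-- Dependent choice: the homotopy on each layer of the cobar complex is chosen in terms of the
preceding one. -/
theorem exists_seq_of_step {S : ℕ → Type u} (R : ∀ n, S n → S (n + 1) → Prop) (s₀ : S 0)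
    (h : ∀ n (s : S n), ∃ s', R n s s') : ∃ f : ∀ n, S n, f 0 = s₀ ∧ ∀ n, R n (f n) (f (n + 1)) := by
  choose g hg using h
  exact ⟨fun n => Nat.rec s₀ (fun n s => g n s) n, rfl, fun n => hg n _⟩

/-- If all morphisms of degree one from `M` to the modules `W (n + 1)` are boundaries, then `M` is
orthogonal to the total module. -/
theorem orthogonal_tot {M : DGModule E}
    (H : ∀ (n : ℕ) (g : DegOne M (W (n + 1))), ∃ s : GrHom M (W (n + 1)),
      ∀ (a : E.Obj) (p q : ℤ) (h : p + 1 = q) (m : M.X a p),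
        g.app a h m = -(W (n + 1)).d h (s.app a p m) + s.app a q (M.d h m)) :
    Orthogonal M (tot W δ hδ) := by
  intro f
  let φ : ∀ (n : ℕ) (a : E.Obj) (p : ℤ), M.X a p →ₗ[k] (W (n + 1)).X a (p + 1) := fun n a p =>
    totProj W δ hδ a p n ∘ₗ f.app a p
  have hφ : ∀ n a p m, φ n a p m = totProj W δ hδ a p n (f.app a p m) := fun _ _ _ _ => rfl
  have φd0 : ∀ (a : E.Obj) (p : ℤ) (m : M.X a p),
      φ 0 a (p + 1) (M.d rfl m) = -(W 1).d rfl (φ 0 a p m) := fun a p m => by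
    rw [hφ, f.app_d, totProj_d_zero, hφ]
  have φd : ∀ (n : ℕ) (a : E.Obj) (p : ℤ) (m : M.X a p),
      φ (n + 1) a (p + 1) (M.d rfl m) =
        -(W (n + 2)).d rfl (φ (n + 1) a p m) - (δ (n + 1)).app a rfl (φ n a p m) :=
    fun n a p m => by
      rw [hφ, f.app_d, totProj_d_succ, hφ, hφ]
  have φact : ∀ (n : ℕ) {a b : E.Obj} {p q r : ℤ} (h : p + q = r) (h' : p + 1 + q = r + 1)
      (m : M.X b p) (x : E.Hom a b q),
      φ n a r (M.act h m x) = (W (n + 1)).act h' (φ n b p m) x :=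
    fun n a b p q r h h' m x => by
      rw [hφ, f.app_act, totProj_act, hφ]
  -- A candidate for component `n` of the homotopy need only satisfy the homotopy equation of the
  -- `n`-th layer of `W` modulo the kernel of the next `δ`: the error left is `-δ` of the preceding
  -- component, and `δ δ = 0`.
  let S : ℕ → Type u := fun n => {s : GrHom M (W (n + 1)) // ∀ (a : E.Obj) (p : ℤ) (m : M.X a p),
    (δ (n + 1)).app a (rfl : p + 1 + 1 = p + 1 + 1)
      (φ n a p m + (W (n + 1)).d rfl (s.app a p m) - s.app a (p + 1) (M.d rfl m)) = 0}
  let R : ∀ n, S n → S (n + 1) → Prop := fun n s s' => ∀ (a : E.Obj) (p : ℤ) (m : M.X a p),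
    φ (n + 1) a p m = -(W (n + 2)).d rfl (s'.1.app a p m) -
      (δ (n + 1)).app a rfl (s.1.app a p m) + s'.1.app a (p + 1) (M.d rfl m)
  obtain ⟨s₀, hs₀⟩ := H 0 (DegOne.ofFamily (φ 0) φd0 fun h m x => φact 0 h (by omega) m x)
  have hs₀' : ∀ (a : E.Obj) (p : ℤ) (m : M.X a p), φ 0 a p m =
      -(W 1).d rfl (s₀.app a p m) + s₀.app a (p + 1) (M.d rfl m) := fun a p m => hs₀ a p _ rfl m
  obtain ⟨s, hs, hR⟩ := exists_seq_of_step (S := S) R ⟨s₀, fun a p m => by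
      rw [hs₀', ← map_zero ((δ (0 + 1)).app a rfl)]
      congr 1
      abel⟩ (by
    intro n s
    -- The condition in `S n` says exactly that `φ (n + 1) + δ s` is closed of degree one, so `H`
    -- makes it a boundary; a primitive is the next component.
    obtain ⟨s', hs'⟩ := H (n + 1) (DegOne.ofFamily
      (fun a p => φ (n + 1) a p + (δ (n + 1)).app a rfl ∘ₗ s.1.app a p) (fun a p m => by
        have e := s.2 a p m
        rw [map_sub, map_add, (δ (n + 1)).app_d rfl rfl] at e
        simp only [LinearMap.add_apply, LinearMap.comp_apply]
        rw [φd, map_add, ← sub_eq_zero]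
        rw [← neg_eq_zero] at e
        rw [← e]
        abel) (fun {a b p q n'} h m x => by
        simp only [LinearMap.add_apply, LinearMap.comp_apply, map_add]
        rw [φact (n + 1) h (by omega), s.1.app_act h,
          (δ (n + 1)).app_act h rfl rfl (by omega)]))
    have hs'' : ∀ (a : E.Obj) (p : ℤ) (m : M.X a p),
        φ (n + 1) a p m + (δ (n + 1)).app a rfl (s.1.app a p m) =
        -(W (n + 2)).d rfl (s'.app a p m) + s'.app a (p + 1) (M.d rfl m) :=
      fun a p m => hs' a p _ rfl m
    have hs3 : ∀ (a : E.Obj) (p : ℤ) (m : M.X a p), φ (n + 1) a p m =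
      -(W (n + 2)).d rfl (s'.app a p m) -
      (δ (n + 1)).app a rfl (s.1.app a p m) + s'.app a (p + 1) (M.d rfl m) := fun a p m => by
      rw [eq_sub_of_add_eq (hs'' a p m)]
      abel
    refine ⟨⟨s', fun a p m => ?_⟩, hs3⟩
    rw [hs3, ← neg_eq_zero, ← map_neg, ← hδ (n + 1) a p _ _ rfl rfl (s.1.app a p m)]
    congr 1
    abel)
  refine ⟨⟨fun a p q h => totLift W δ hδ a q fun n =>
    (W (n + 1)).cast a h.symm ∘ₗ (s n).1.app a p, ?_⟩, ?_⟩
  · intro a b p q n p' n' h hp hn h' m x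
    subst hp hn
    refine tot_ext fun i => ?_
    rw [totProj_act]
    exact (s i).1.app_act h m x
  · intro a p q r hq hr m
    subst hq hr
    refine tot_ext fun i => ?_
    rw [map_add]
    cases i with
    | zero =>
      rw [totProj_d_zero]
      have e : (s 0).1 = s₀ := congrArg Subtype.val hs
      have := hs₀' a (q + 1) m
      rw [← e] at this
      exact this
    | succ i =>
      rw [totProj_d_succ]
      exact hR i a _ m

end Tot

/-! ### The cobar resolution -/

section Cobar

variable (F : T → DGFunctor D E)

/-- Restriction along all the dg functors `F t` followed by coinduction, shifted by one. -/
def cobarStep (X : DGModule E) : DGModule E := coind 1 F fun t => X.restrict (F t)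

variable {X Y : DGModule E}

/-- Evaluation of the elements of `cobarStep F X`. -/
def cobarEv {a : E.Obj} {p : ℤ} (t : T) (x : D.Obj) {q n : ℤ} (h : p + q = n + 1) :
    (cobarStep F X).X a p →ₗ[k] E.Hom ((F t).obj x) a q →ₗ[k] X.X ((F t).obj x) n :=
  coindEv 1 F (fun t => X.restrict (F t)) t x h

variable {F}

theorem cobar_ext {a : E.Obj} {p : ℤ} {φ ψ : (cobarStep F X).X a p}
    (h : ∀ t x q n (hn : p + q = n + 1) (f : E.Hom ((F t).obj x) a q),
      cobarEv F t x hn φ f = cobarEv F t x hn ψ f) : φ = ψ :=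
  coind_ext h

theorem cobarEv_comp {a : E.Obj} {p : ℤ} (φ : (cobarStep F X).X a p) (t : T) {x y : D.Obj}
    {q r qr n n' : ℤ} (h : p + q = n + 1) (hqr : q + r = qr) (h' : p + qr = n' + 1)
    (hn : n + r = n') (f : E.Hom ((F t).obj x) a q) (g : D.Hom y x r) :
    cobarEv F t y h' φ (E.comp hqr f ((F t).map g)) =
      X.act hn (cobarEv F t x h φ f) ((F t).map g) :=
  coindEv_comp (L := fun t => X.restrict (F t)) φ t h hqr h' hn f g

theorem cobarEv_d {a : E.Obj} {p p' : ℤ} (h : p + 1 = p') (φ : (cobarStep F X).X a p) (t : T)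
    (x : D.Obj) {q q' n n' : ℤ} (hq : q + 1 = q') (hn : n + 1 = n') (h1 : p' + q = n' + 1)
    (h2 : p + q = n + 1) (h3 : p + q' = n' + 1) (f : E.Hom ((F t).obj x) a q) :
    cobarEv F t x h1 ((cobarStep F X).d h φ) f =
      -X.d hn (cobarEv F t x h2 φ f) - koszulSign k p • cobarEv F t x h3 φ (E.d hq f) := by
  refine (coindEv_d h φ t x hq hn h1 h2 h3 f).trans ?_
  rw [koszulSign_one, neg_smul, one_smul]
  rfl

theorem cobarEv_act {a b : E.Obj} {p q n : ℤ} (h : p + q = n) (φ : (cobarStep F X).X b p)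
    (g : E.Hom a b q) (t : T) (x : D.Obj) {r qr m : ℤ} (hqr : q + r = qr) (h1 : n + r = m + 1)
    (h2 : p + qr = m + 1) (f : E.Hom ((F t).obj x) a r) :
    cobarEv F t x h1 ((cobarStep F X).act h φ g) f =
      cobarEv F t x h2 φ (E.comp hqr g f) :=
  coindEv_act h φ g t x hqr h1 h2 f

/-- Construction of linear maps to `cobarStep F X`. -/
def cobarLift {V : Type u} [AddCommGroup V] [Module k V] {a : E.Obj} {p : ℤ}
    (β : ∀ (t : T) (x : D.Obj) (q n : ℤ), p + q = n + 1 →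
      V →ₗ[k] E.Hom ((F t).obj x) a q →ₗ[k] X.X ((F t).obj x) n)
    (hβ : ∀ (t : T) (x y : D.Obj) (q r qr n n' : ℤ) (h : p + q = n + 1) (hqr : q + r = qr)
      (h' : p + qr = n' + 1) (hn : n + r = n') (v : V) (f : E.Hom ((F t).obj x) a q)
      (g : D.Hom y x r),
      β t y qr n' h' v (E.comp hqr f ((F t).map g)) =
        X.act hn (β t x q n h v f) ((F t).map g)) :
    V →ₗ[k] (cobarStep F X).X a p :=
  coindLift (L := fun t => X.restrict (F t)) β hβ

theorem cobarEv_lift {V : Type u} [AddCommGroup V] [Module k V] {a : E.Obj} {p : ℤ}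
    (β : ∀ (t : T) (x : D.Obj) (q n : ℤ), p + q = n + 1 →
      V →ₗ[k] E.Hom ((F t).obj x) a q →ₗ[k] X.X ((F t).obj x) n) (hβ)
    (v : V) (t : T) (x : D.Obj) {q n : ℤ} (h : p + q = n + 1) (f : E.Hom ((F t).obj x) a q) :
    cobarEv F t x h (cobarLift (X := X) β hβ v) f = β t x q n h v f := rfl

/-- Evaluation at the identity. -/
def cobarRet (t : T) (x : D.Obj) {p q : ℤ} (h : q + 1 = p) :
    (cobarStep F X).X ((F t).obj x) p →ₗ[k] X.X ((F t).obj x) q :=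
  (cobarEv F t x (by omega : p + 0 = q + 1)).flip (E.id _)

theorem cobarRet_d (t : T) (x : D.Obj) {p q r : ℤ} (h : q + 1 = p) (h' : p + 1 = r)
    (φ : (cobarStep F X).X ((F t).obj x) p) :
    cobarRet t x h' ((cobarStep F X).d h' φ) = -X.d h (cobarRet t x h φ) := by
  simp only [cobarRet, LinearMap.flip_apply]
  rw [cobarEv_d h' φ t x (zero_add 1) h _ (by omega) (by omega), E.d_id, map_zero, smul_zero,
    sub_zero]

/-- An element of the cobar construction is recovered from evaluation at the identity: φ(f) = (φ ·
f)(1). -/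
theorem act_cobarRet (t : T) (x : D.Obj) {a : E.Obj} {p q r p' : ℤ} (φ : (cobarStep F X).X a p)
    (h : p + q = r) (h' : p' + 1 = r) (hn : p + q = p' + 1) (f : E.Hom ((F t).obj x) a q) :
    cobarRet t x h' ((cobarStep F X).act h φ f) = cobarEv F t x hn φ f := by
  simp only [cobarRet, LinearMap.flip_apply]
  rw [cobarEv_act h φ f t x (add_zero q) _ hn, E.comp_id]

variable (F X)

/-- The unit `X → cobarStep F X`. -/
def cobarUnit : DegOne X (cobarStep F X) where
  app a p p' h := cobarLift (fun t x q _ hn => X.act (by omega))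
    (fun t x y q r qr n n' h1 hqr h2 hn v f g => (X.act_act _ hqr hn _ v f _).symm)
  app_d {a p q r} h h' m := cobar_ext fun t x s n hn f => by
    rw [map_neg, LinearMap.neg_apply, cobarEv_d h' _ t x rfl (sub_add_cancel n 1) hn (by omega)
      (by omega)]
    simp only [cobarEv_lift]
    rw [X.leibniz (by omega : p + s = n - 1) _ h rfl (by omega) (by omega), koszulSign_of_succ h]
    simp
  app_act {a b p q n p' n'} h hp hn h' m f := cobar_ext fun t x r s hs g => by
    rw [cobarEv_act h' _ _ t x rfl hs (by omega)]
    simp only [cobarEv_lift]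
    rw [X.act_act h rfl]

theorem cobarEv_unit (a : E.Obj) {p p' : ℤ} (h : p + 1 = p') (m : X.X a p) (t : T) (x : D.Obj)
    {q n : ℤ} (hn : p' + q = n + 1) (hn' : p + q = n) (f : E.Hom ((F t).obj x) a q) :
    cobarEv F t x hn ((cobarUnit F X).app a h m) f = X.act hn' m f := rfl

theorem cobarRet_unit (t : T) (x : D.Obj) {p q : ℤ} (h : p + 1 = q) (m : X.X ((F t).obj x) p) :
    cobarRet t x h ((cobarUnit F X).app _ h m) = m :=
  (cobarEv_unit F X _ h m t x _ (add_zero p) _).trans (X.act_id _ _)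

variable {X}

/-- Functoriality of `cobarStep` for morphisms of degree one. -/
def cobarMap (δ : DegOne X Y) : DegOne (cobarStep F X) (cobarStep F Y) where
  app a p p' h := cobarLift (fun t x q n hn =>
      (cobarEv F t x (by omega : p + q = n - 1 + 1)).compr₂ (δ.app _ (sub_add_cancel n 1)))
    (fun t x y q r qr n n' h1 hqr h2 hn v f g => by
      simp only [LinearMap.compr₂_apply]
      rw [cobarEv_comp v t (n := n - 1) (by omega) hqr _ (by omega), δ.app_act])
  app_d {a p q r} h h' m := cobar_ext fun t x s n hn f => by
    rw [map_neg, LinearMap.neg_apply, cobarEv_d h' _ t x rfl (sub_add_cancel n 1) hn (by omega)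
      (by omega)]
    simp only [cobarEv_lift, LinearMap.compr₂_apply]
    rw [cobarEv_d h m t x rfl (sub_add_cancel (n - 1) 1) _ (by omega) (by omega), map_sub, map_neg,
      map_smul, δ.app_d _ (sub_add_cancel n 1), koszulSign_of_succ h]
    simp
    abel
  app_act {a b p q n p' n'} h hp hn h' m f := cobar_ext fun t x r s hs g => by
    rw [cobarEv_act h' _ _ t x rfl hs (by omega)]
    simp only [cobarEv_lift, LinearMap.compr₂_apply]
    rw [cobarEv_act h _ _ t x rfl _ (by omega)]

theorem cobarEv_map (δ : DegOne X Y) (a : E.Obj) {p p' : ℤ} (h : p + 1 = p')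
    (φ : (cobarStep F X).X a p) (t : T) (x : D.Obj) {q n n' : ℤ} (hn : p' + q = n' + 1)
    (hn' : p + q = n + 1) (h' : n + 1 = n') (f : E.Hom ((F t).obj x) a q) :
    cobarEv F t x hn ((cobarMap F δ).app a h φ) f = δ.app _ h' (cobarEv F t x hn' φ f) := by
  obtain rfl : n = n' - 1 := by omega
  rfl

/-- The differential that follows a given one in the cobar resolution. -/
def cobarNext (δ : DegOne X (cobarStep F X)) :
    DegOne (cobarStep F X) (cobarStep F (cobarStep F X)) :=
  (cobarUnit F (cobarStep F X)).sub (cobarMap F δ)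

theorem cobarEv_next (δ : DegOne X (cobarStep F X)) (a : E.Obj) {p p' : ℤ} (h : p + 1 = p')
    (φ : (cobarStep F X).X a p) (t : T) (x : D.Obj) {q m m' : ℤ}
    (hn : p' + q = m' + 1) (hn' : p + q = m + 1) (h' : m + 1 = m') (h'' : p + q = m')
    (f : E.Hom ((F t).obj x) a q) :
    cobarEv F t x hn ((cobarNext F δ).app a h φ) f =
      (cobarStep F X).act h'' φ f - δ.app _ h' (cobarEv F t x hn' φ f) := by
  rw [← cobarEv_map F _ a h φ t x hn hn' h', ← cobarEv_unit F _ a h φ t x hn h'',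
    ← LinearMap.sub_apply, ← map_sub]
  rfl

/-- At `f`, the two terms are `(unit m) · f` and `unit (m · f)`, which agree by linearity of the
unit. -/
theorem cobarNext_unit (a : E.Obj) {p q r : ℤ} (h : p + 1 = q) (h' : q + 1 = r) (m : X.X a p) :
    (cobarNext F (cobarUnit F X)).app a h' ((cobarUnit F X).app a h m) = 0 := by
  refine cobar_ext fun t x s l hl f => ?_
  rw [cobarEv_next F _ a h' _ t x hl (m := l - 1) (by omega) (by omega) (by omega),
    map_zero, LinearMap.zero_apply, cobarEv_unit F X a h m t x _ (by omega),
    ← (cobarUnit F X).app_act (n := l - 1) (by omega) h (by omega) (by omega), sub_self]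

/-- Put δ' = unit - F_*(δ). The value of δ'' (δ' φ) at f is δ' φ · f - δ' (φ · f - δ (φ(f))); the
part δ' δ vanishes by `H` and the rest by linearity of δ'. -/
theorem cobarNext_next (δ : DegOne X (cobarStep F X))
    (H : ∀ (a : E.Obj) (p q r : ℤ) (h : p + 1 = q) (h' : q + 1 = r) (m : X.X a p),
      (cobarNext F δ).app a h' (δ.app a h m) = 0)
    (a : E.Obj) {p q r : ℤ} (h : p + 1 = q) (h' : q + 1 = r) (m : (cobarStep F X).X a p) :
    (cobarNext F (cobarNext F δ)).app a h' ((cobarNext F δ).app a h m) = 0 := by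
  refine cobar_ext fun t x s l hl f => ?_
  rw [cobarEv_next F _ a h' _ t x hl (m := l - 1) (by omega) (by omega) (by omega),
    map_zero, LinearMap.zero_apply,
    cobarEv_next F δ a h m t x _ (m := l - 1 - 1) (by omega) (by omega) (by omega), map_sub, H,
    sub_zero, ← (cobarNext F δ).app_act (n := l - 1) (by omega) h (by omega) (by omega), sub_self]

/-- This is the identity `ρ δ' + δ ρ = 1` of a contracting homotopy: at the identity morphism the
unit returns `φ` and `F_*(δ)` returns `δ (φ(1))`. -/
theorem cobarRet_next (δ : DegOne X (cobarStep F X)) (t : T) (x : D.Obj) {p q r : ℤ}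
    (h : p + 1 = q) (h' : q + 1 = r) (φ : (cobarStep F X).X ((F t).obj x) q) :
    cobarRet t x h' ((cobarNext F δ).app _ h' φ) = φ - δ.app _ h (cobarRet t x h φ) := by
  refine (cobarEv_next F δ _ h' φ t x _ (m := p) (by omega) h (add_zero q) (E.id _)).trans ?_
  rw [(cobarStep F X).act_id]
  rfl

/-- The terms of the cobar resolution. -/
def cobarW (N : DGModule E) : ℕ → DGModule E
  | 0 => N
  | n + 1 => cobarStep F (cobarW N n)

/-- The differentials of the cobar resolution. -/
def cobarδ (N : DGModule E) : ∀ n, DegOne (cobarW F N n) (cobarW F N (n + 1))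
  | 0 => cobarUnit F N
  | n + 1 => cobarNext F (X := cobarW F N n) (cobarδ N n)

theorem cobarδ_δ (N : DGModule E) (n : ℕ) (a : E.Obj) (p q r : ℤ) (h : p + 1 = q) (h' : q + 1 = r)
    (m : (cobarW F N n).X a p) :
    (cobarδ F N (n + 1)).app a h' ((cobarδ F N n).app a h m) = 0 := by
  induction n generalizing a p q r with
  | zero => exact cobarNext_unit F a h h' m
  | succ n ih => exact cobarNext_next F (X := cobarW F N n) (cobarδ F N n) ih a h h' m

/-- The cobar resolution of `N` relative to the dg functors `F t`. -/
def cobar (N : DGModule E) : DGModule E := tot (cobarW F N) (cobarδ F N) (cobarδ_δ F N)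

/-- The augmentation `N ⟶ cobar F N`. -/
def cobarι (N : DGModule E) : N ⟶ cobar F N := totι (cobarW F N) (cobarδ F N) (cobarδ_δ F N)

/-- Evaluation at the identity contracts the cobar resolution at the objects `F t x`. -/
def cobarContraction (N : DGModule E) (t : T) (x : D.Obj) :
    SeqContraction (cobarW F N) (cobarδ F N) ((F t).obj x) where
  ρ n _ _ h := cobarRet (X := cobarW F N n) t x h
  ρ_d n _ _ _ h h' y := cobarRet_d (X := cobarW F N n) t x h h' y
  ρ_δ_zero h m := cobarRet_unit F N t x h m
  ρ_δ_succ n _ _ _ h h' y := cobarRet_next F (X := cobarW F N n) (cobarδ F N n) t x h h' y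

/-- Quasi-isomorphisms are detected objectwise, so a contraction at each object suffices, although
these contractions do not respect the action of `E`. -/
theorem isQuasiIso_cobarι (hF : ∀ b : E.Obj, ∃ t x, (F t).obj x = b) (N : DGModule E) :
    IsQuasiIso (cobarι F N) where
  surj b p q r hq hr y hy := by
    obtain ⟨t, x, rfl⟩ := hF b
    exact (cobarContraction F N t x).ι_surj (cobarδ_δ F N) hq hr y hy
  inj b p q r hq hr m z _ h := by
    obtain ⟨t, x, rfl⟩ := hF b
    exact (cobarContraction F N t x).ι_inj (cobarδ_δ F N) hq m z h

/-- A morphism of degree one to `cobarStep F X` is a boundary if the restrictions of the source are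
orthogonal to those of `X`. -/
theorem DegOne.exists_homotopy {M : DGModule E}
    (H : ∀ t, Orthogonal (M.restrict (F t)) (X.restrict (F t))) (g : DegOne M (cobarStep F X)) :
    ∃ s : GrHom M (cobarStep F X), ∀ (a : E.Obj) (p q : ℤ) (h : p + 1 = q) (m : M.X a p),
      g.app a h m = -(cobarStep F X).d h (s.app a p m) + s.app a q (M.d h m) := by
  -- The adjoint of `g` along `F t` is `m ↦ g m (1)`, a closed map between restrictions, to which
  -- `H` applies.
  have key : ∀ t, Nonempty (ResHomotopy₂ (F t) (M := M) (X := X)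
      (fun x n => cobarRet t x rfl ∘ₗ g.app ((F t).obj x) rfl)) := fun t =>
    (H t).nonempty_resHomotopy₂ _ (fun x p q h m => by
        simp only [LinearMap.comp_apply]
        subst h
        rw [g.app_d rfl, map_neg, cobarRet_d t x rfl, neg_neg])
      (fun x y p q n h m f => by
        simp only [LinearMap.comp_apply]
        rw [g.app_act h rfl rfl (by omega : p + 1 + q = n + 1),
          act_cobarRet t x _ _ _ (by omega : p + 1 + q = n + 1),
          ← E.id_comp (zero_add q) ((F t).map f), cobarEv_comp _ t (by omega) _ _ h,
          E.id_comp]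
        rfl)
  let s := fun t => (key t).some
  have hs : ∀ t x {p q r : ℤ} (hq : q + 1 = p) (hr : p + 1 = r) (m : M.X ((F t).obj x) p),
      cobarRet t x rfl (g.app ((F t).obj x) rfl m) =
        X.d hq ((s t).app x hq m) + (s t).app x hr (M.d hr m) := fun t x _ _ _ hq hr m =>
    (s t).eq x hq hr m
  -- Back through the adjunction: the homotopies `s t` assemble to `m ↦ (f ↦ s t (m · f))`.
  let σ : ∀ (a : E.Obj) (p : ℤ), M.X a p →ₗ[k] (cobarStep F X).X a p := fun a p =>
    cobarLift (fun t x q n h => (M.act rfl).compr₂ ((s t).app x h.symm)) (by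
      intro t x y q r qr n n' h hqr h' hn v f e
      simp only [LinearMap.compr₂_apply]
      rw [← M.act_act rfl hqr (by omega : p + q + r = p + qr)]
      exact (s t).app_act _ _ _ hn _ e)
  have hσ : ∀ (a : E.Obj) (p : ℤ) (m : M.X a p) (t : T) (x : D.Obj) {q n w : ℤ} (h : p + q = n + 1)
      (hw : p + q = w) (hw' : n + 1 = w) (f : E.Hom ((F t).obj x) a q),
      cobarEv F t x h (σ a p m) f = (s t).app x hw' (M.act hw m f) := by
    intro a p m t x q n w h hw hw' f
    subst hw; rfl
  refine ⟨⟨σ, ?_⟩, ?_⟩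
  · intro a b p q n h m f
    refine cobar_ext fun t x r l hl e => ?_
    rw [cobarEv_act h _ _ t x rfl hl (by omega), hσ _ _ _ t x hl rfl (by omega),
      hσ _ _ _ t x _ (by omega : p + (q + r) = n + r) (by omega), M.act_act h rfl]
  · intro a p q h m
    refine cobar_ext fun t x r l hl f => ?_
    rw [map_add, LinearMap.add_apply, map_neg, LinearMap.neg_apply,
      cobarEv_d h _ t x rfl (sub_add_cancel l 1) hl (by omega) (by omega),
      hσ _ _ _ t x _ (by omega : p + r = l) (by omega),
      hσ _ _ _ t x _ (by omega : p + (r + 1) = l + 1) rfl,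
      hσ _ _ _ t x hl (by omega : q + r = l + 1) rfl]
    have e := hs t x (sub_add_cancel l 1) rfl (M.act (by omega : p + r = l) m f)
    rw [g.app_act (by omega : p + r = l) h rfl (by omega), act_cobarRet t x _ _ _ hl,
      M.leibniz _ rfl h rfl (by omega : q + r = l + 1) (by omega : p + (r + 1) = l + 1), map_add,
      map_smul] at e
    rw [e]
    abel

/-- `M` is orthogonal to the cobar resolution of `N` if its restrictions are orthogonal to those of
the terms of the resolution. -/
theorem orthogonal_cobar {M N : DGModule E}
    (H : ∀ n t, Orthogonal (M.restrict (F t)) ((cobarW F N n).restrict (F t))) :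
    Orthogonal M (cobar F N) :=
  orthogonal_tot (cobarδ_δ F N) fun n g => DegOne.exists_homotopy F (X := cobarW F N n) (H n) g

end Cobar

/-! ### K-injective resolutions -/

/-- Over the unit dg category, every family of linear maps of a given degree is compatible with
the action. -/
theorem act_unit_eq {M N : DGModule (DGCat.unit k)} (φ : ∀ {p q : ℤ}, q + 1 = p →
      M.X PUnit.unit p →ₗ[k] N.X PUnit.unit q) {p q n p' n' : ℤ} (h : p + q = n) (hp : p' + 1 = p)
    (hn : n' + 1 = n) (h' : p' + q = n') (m : M.X PUnit.unit p) (f : DGCat.unitHom k q) :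
    φ hn (M.act (a := PUnit.unit) (b := PUnit.unit) h m f) =
      N.act (a := PUnit.unit) (b := PUnit.unit) h' (φ hp m) f := by
  by_cases hq : q = 0
  · subst hq
    obtain rfl : p = n := by omega
    obtain rfl : p' = n' := by omega
    have hf : f = f.1 • (DGCat.unit k).id PUnit.unit := Subtype.ext (mul_one f.1).symm
    rw [hf]
    exact (congrArg (φ hn) ((map_smul _ _ _).trans (congrArg (f.1 • ·) (M.act_id h m)))).trans
      ((map_smul _ _ _).trans (((map_smul _ _ _).trans
        (congrArg (f.1 • ·) (N.act_id h' (φ hp m)))).symm))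
  · rw [show f = 0 from Subtype.ext (f.2 hq), map_zero, map_zero, map_zero]

/-- Every acyclic module is orthogonal to every module over the unit dg category. -/
theorem IsAcyclic.orthogonal_unit {M : DGModule (DGCat.unit k)} (hM : M.IsAcyclic)
    (N : DGModule (DGCat.unit k)) : Orthogonal M N := by
  obtain ⟨σ⟩ := (hM PUnit.unit).nonempty_contraction
  intro f
  refine ⟨⟨fun a p q h => f.app a q ∘ₗ σ.s h, ?_⟩, ?_⟩
  · intro a b p q n p' n' h hp hn h' m x
    exact act_unit_eq (fun h => f.app PUnit.unit _ ∘ₗ σ.s h) h hp hn h' m x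
  · intro a p q r hq hr m
    rw [LinearMap.comp_apply, LinearMap.comp_apply, ← f.app_d, ← map_add]
    exact congrArg _ (σ.eq hq hr m).symm

/-- Every dg module has a K-injective resolution. -/
theorem exists_isKInj_resolution (N : DGModule E) :
    ∃ (I : DGModule E) (ι : N ⟶ I), I.IsKInj ∧ IsQuasiIso ι :=
  -- The family consists of all objects of `E`, regarded as dg functors from `k`. Restrictions of an
  -- acyclic module to `k` are contractible, hence orthogonal to everything, so there is nothing to
  -- verify about the terms of the complex.
  ⟨cobar (fun e : E.Obj => E.point e) N, cobarι _ N, fun _ hM =>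
    orthogonal_cobar _ fun _ _ => (hM.restrict _).orthogonal_unit _,
    isQuasiIso_cobarι _ (fun b => ⟨b, PUnit.unit, rfl⟩) N⟩

end DGModule

end

/-! ### Morphisms, coproducts and perfect objects in the derived category; restriction. -/

noncomputable section

namespace DGModule

variable {k : Type u} [Field k] {A B : DGCat.{u} k}

/-! ### The derived category -/

/-- The functor from the category of dg modules to the derived category. -/
def toD (A : DGCat.{u} k) : DGModule A ⥤ A.Derived :=
  toHomotopyCat A ⋙ (quasiIso A).Q

instance : (toD A).Additive :=
  inferInstanceAs (toHomotopyCat A ⋙ (quasiIso A).Q).Additive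

theorem toD_map_congr {M N : DGModule A} {f g : M ⟶ N} (h : IsNullHomotopic (f - g)) :
    (toD A).map f = (toD A).map g :=
  congrArg (quasiIso A).Q.map ((toHomotopyCat_map_eq_iff f g).2 h)

theorem toD_map_eq_zero {M N : DGModule A} {f : M ⟶ N} (h : IsNullHomotopic f) :
    (toD A).map f = 0 := by
  rw [toD_map_congr (g := 0) (by simpa using h), Functor.map_zero]

theorem IsQuasiIso.isIso_toD {M N : DGModule A} {f : M ⟶ N} (h : IsQuasiIso f) :
    IsIso ((toD A).map f) :=
  Localization.inverts (quasiIso A).Q (quasiIso A) _ ⟨f, rfl, h⟩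

theorem exists_toHomotopyCat_obj_eq (Z : A.HomotopyCat) :
    ∃ M : DGModule A, (toHomotopyCat A).obj M = Z :=
  ⟨Quotient.as (r := homotopic A) Z, rfl⟩

theorem exists_toHomotopyCat_map_eq {M N : DGModule A}
    (f : (toHomotopyCat A).obj M ⟶ (toHomotopyCat A).obj N) :
    ∃ g : M ⟶ N, (toHomotopyCat A).map g = f :=
  Quot.exists_rep f

theorem exists_of_quasiIso {M N : DGModule A}
    {f : (toHomotopyCat A).obj M ⟶ (toHomotopyCat A).obj N} (hf : quasiIso A f) :
    ∃ g : M ⟶ N, (toHomotopyCat A).map g = f ∧ IsQuasiIso g := by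
  obtain ⟨g, hg, hq⟩ := hf
  exact ⟨g, hg.symm, hq⟩

/-- Every morphism in the derived category is a left fraction. -/
theorem exists_comp_toD_map_eq {M N : DGModule A} (φ : (toD A).obj M ⟶ (toD A).obj N) :
    ∃ (N' : DGModule A) (f : M ⟶ N') (s : N ⟶ N'), IsQuasiIso s ∧
      φ ≫ (toD A).map s = (toD A).map f := by
  obtain ⟨⟨f, s, hs⟩, hα⟩ := Localization.exists_leftFraction (quasiIso A).Q (quasiIso A)
    (X := (toHomotopyCat A).obj M) (Y := (toHomotopyCat A).obj N) φ
  rename_i Z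
  obtain ⟨N', rfl⟩ := exists_toHomotopyCat_obj_eq Z
  obtain ⟨f, rfl⟩ := exists_toHomotopyCat_map_eq f
  obtain ⟨s, rfl, hqs⟩ := exists_of_quasiIso hs
  refine ⟨N', f, s, hqs, ?_⟩
  rw [hα]
  exact MorphismProperty.LeftFraction.map_comp_map_s _ _ _

/-- Write the morphism as a left fraction (f, s) with s : N ⟶ N' a quasi-isomorphism; since N is
K-injective, s has a left homotopy inverse r, and f ≫ r represents the fraction. -/
theorem exists_toD_map_eq {M N : DGModule A} (hN : N.IsKInj)
    (φ : (toD A).obj M ⟶ (toD A).obj N) : ∃ f : M ⟶ N, (toD A).map f = φ := by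
  obtain ⟨N', f, s, hqs, hφ⟩ := exists_comp_toD_map_eq φ
  obtain ⟨r, hr⟩ := hN.exists_leftInverse hqs
  have hr' := toD_map_congr hr
  rw [Functor.map_comp, CategoryTheory.Functor.map_id] at hr'
  exact ⟨f ≫ r, by rw [Functor.map_comp, ← hφ, Category.assoc, hr', Category.comp_id]⟩

/-- This is the description of equality in a localization with left calculus of fractions. -/
theorem exists_null_comp_of_toD_map_eq_zero {M N : DGModule A} {f : M ⟶ N}
    (h : (toD A).map f = 0) : ∃ (N' : DGModule A) (s : N ⟶ N'), IsQuasiIso s ∧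
      IsNullHomotopic (f ≫ s) := by
  have h' : (quasiIso A).Q.map ((toHomotopyCat A).map f) =
      (quasiIso A).Q.map ((toHomotopyCat A).map (0 : M ⟶ N)) := by
    refine Eq.trans h ?_
    rw [Functor.map_zero, Functor.map_zero]
    rfl
  obtain ⟨Z, s, hs, e⟩ :=
    (MorphismProperty.map_eq_iff_postcomp (quasiIso A).Q (quasiIso A) _ _).1 h'
  obtain ⟨N', rfl⟩ := exists_toHomotopyCat_obj_eq Z
  obtain ⟨s, rfl, hqs⟩ := exists_of_quasiIso hs
  rw [← Functor.map_comp, ← Functor.map_comp, toHomotopyCat_map_eq_iff, zero_comp, sub_zero] at e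
  exact ⟨N', s, hqs, e⟩

/-- The quasi-isomorphism that kills `f` has a left homotopy inverse, because its source `N` is
K-injective. With `exists_toD_map_eq`, morphisms to `N` in the derived category are homotopy
classes. -/
theorem isNullHomotopic_of_toD_map_eq_zero {M N : DGModule A} (hN : N.IsKInj) {f : M ⟶ N}
    (h : (toD A).map f = 0) : IsNullHomotopic f := by
  obtain ⟨N', s, hqs, h1⟩ := exists_null_comp_of_toD_map_eq_zero h
  obtain ⟨r, hr⟩ := hN.exists_leftInverse hqs
  have h2 := hr.symm.comp_left f
  rw [Preadditive.comp_sub, Category.comp_id, ← Category.assoc] at h2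
  exact h2.congr (h1.comp_right r)

theorem exists_toD_obj_eq (Y : A.Derived) : ∃ M : DGModule A, (toD A).obj M = Y :=
  ⟨Quotient.as (r := homotopic A) (Quotient.as (C := Paths _) Y).obj, rfl⟩

/-! ### Direct sums -/

section DirectSum

variable {J : Type u} (N : J → DGModule A)

/-- The direct sum of a family of dg modules. -/
def dsum : DGModule A where
  X a p := Π₀ j, (N j).X a p
  d h := DFinsupp.mapRange.linearMap fun j => (N j).d h
  act {a b p q n} h := LinearMap.mk₂ k
    (fun x f => DFinsupp.mapRange (fun j m => (N j).act h m f) (fun j => by simp) x)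
    (by intros; ext j; simp) (by intros; ext j; simp) (by intros; ext j; simp)
    (by intros; ext j; simp)
  d_d h h' x := by
    ext j
    exact (N j).d_d h h' _
  act_id h x := by
    ext j
    exact (N j).act_id h _
  act_act hpq hqr h h' m f g := by
    ext j
    exact (N j).act_act hpq hqr h h' _ f g
  leibniz h hn hp hq h₁ h₂ m f := by
    ext j
    exact (N j).leibniz h hn hp hq h₁ h₂ _ f

/-- The components of the elements of a direct sum. -/
def dsumProj (j : J) : dsum N ⟶ N j :=
  Hom.mk (fun a p => DFinsupp.lapply (M := fun j => (N j).X a p) j) (fun _ _ => rfl) (fun _ _ _ => rfl)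

variable {N} in
theorem dsum_ext {a : A.Obj} {p : ℤ} {x y : (dsum N).X a p}
    (h : ∀ j, (dsumProj N j).app a p x = (dsumProj N j).app a p y) : x = y :=
  DFinsupp.ext h

open scoped Classical in
/-- The inclusion of a linear summand. -/
def dsumSingle (j : J) (a : A.Obj) (p : ℤ) : (N j).X a p →ₗ[k] (dsum N).X a p :=
  DFinsupp.lsingle (M := fun j => (N j).X a p) j

variable {N} in
theorem dsumProj_single_self (j : J) (a : A.Obj) (p : ℤ) (x : (N j).X a p) :
    (dsumProj N j).app a p (dsumSingle N j a p x) = x := by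
  classical
  exact DFinsupp.single_eq_same (β := fun j => (N j).X a p)

variable {N} in
theorem dsumProj_single_of_ne {i j : J} (h : i ≠ j) (a : A.Obj) (p : ℤ) (x : (N j).X a p) :
    (dsumProj N i).app a p (dsumSingle N j a p x) = 0 := by
  classical
  exact DFinsupp.single_eq_of_ne (β := fun j => (N j).X a p) h

/-- The inclusion of a summand. -/
def dsumIncl (j : J) : N j ⟶ dsum N :=
  Hom.mk (dsumSingle N j)
    (fun {a p q} h x => dsum_ext fun i => by
      rw [(dsumProj N i).app_d]
      by_cases hi : i = j
      · subst hi
        rw [dsumProj_single_self, dsumProj_single_self]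
      · rw [dsumProj_single_of_ne hi, dsumProj_single_of_ne hi, map_zero])
    (fun {a b p q n} h x f => dsum_ext fun i => by
      rw [(dsumProj N i).app_act]
      by_cases hi : i = j
      · subst hi
        rw [dsumProj_single_self, dsumProj_single_self]
      · rw [dsumProj_single_of_ne hi, dsumProj_single_of_ne hi, map_zero, LinearMap.zero_apply])

theorem dsumIncl_proj_self (j : J) : dsumIncl N j ≫ dsumProj N j = 𝟙 _ := by
  refine Hom.ext ?_
  funext a p
  exact LinearMap.ext fun x => dsumProj_single_self j a p x

theorem dsumIncl_proj_of_ne {i j : J} (h : i ≠ j) : dsumIncl N j ≫ dsumProj N i = 0 := by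
  refine Hom.ext ?_
  funext a p
  exact LinearMap.ext fun x => dsumProj_single_of_ne h a p x

variable {N} in
open scoped Classical in
theorem dsum_induction {a : A.Obj} {p : ℤ} {P : (dsum N).X a p → Prop} (h0 : P 0)
    (hadd : ∀ x y, P x → P y → P (x + y)) (hs : ∀ j x, P ((dsumIncl N j).app a p x))
    (x : (dsum N).X a p) : P x := by
  exact DFinsupp.induction (β := fun j => (N j).X a p) (p := P) x h0
    fun i b f _ _ hf => hadd _ _ (hs i b) hf

variable {N} in
open scoped Classical in
/-- Construction of linear maps out of a direct sum. -/
def dsumToModule {V : Type u} [AddCommGroup V] [Module k V] (a : A.Obj) (p : ℤ)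
    (f : ∀ j, (N j).X a p →ₗ[k] V) : (dsum N).X a p →ₗ[k] V :=
  DFinsupp.lsum (M := fun j => (N j).X a p) ℕ f

variable {N} in
theorem dsumToModule_incl {V : Type u} [AddCommGroup V] [Module k V] (a : A.Obj) (p : ℤ)
    (f : ∀ j, (N j).X a p →ₗ[k] V) (j : J) (x : (N j).X a p) :
    dsumToModule a p f ((dsumIncl N j).app a p x) = f j x := by
  classical
  exact DFinsupp.lsum_single (M := fun j => (N j).X a p) ℕ f j x

variable {N} {P : DGModule A}

/-- Construction of morphisms out of a direct sum. -/
def dsumDesc (f : ∀ j, N j ⟶ P) : dsum N ⟶ P :=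
  Hom.mk (fun a p => dsumToModule a p fun j => (f j).app a p)
    (fun {a p q} h x => by
      induction x using dsum_induction with
      | h0 => simp only [map_zero]
      | hadd x y hx hy => simp only [map_add, hx, hy]
      | hs j x => rw [← (dsumIncl N j).app_d, dsumToModule_incl, dsumToModule_incl, (f j).app_d])
    (fun {a b p q n} h x g => by
      induction x using dsum_induction with
      | h0 => simp only [map_zero, LinearMap.zero_apply]
      | hadd x y hx hy => simp only [map_add, LinearMap.add_apply, hx, hy]
      | hs j x =>
        rw [← (dsumIncl N j).app_act, dsumToModule_incl, dsumToModule_incl, (f j).app_act])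

theorem dsumIncl_desc (f : ∀ j, N j ⟶ P) (j : J) : dsumIncl N j ≫ dsumDesc f = f j := by
  refine Hom.ext ?_
  funext a p
  exact LinearMap.ext fun x => dsumToModule_incl a p (fun j => (f j).app a p) j x

/-- Null-homotopies chosen independently on the summands define one on the direct sum. -/
theorem isNullHomotopic_of_dsumIncl {f : dsum N ⟶ P}
    (h : ∀ j, IsNullHomotopic (dsumIncl N j ≫ f)) : IsNullHomotopic f := by
  choose s hs using h
  refine ⟨⟨fun a p q h => dsumToModule a p fun j => (s j).app a h, ?_⟩, ?_⟩
  · intro a b p q n p' n' h hp hn h' x g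
    induction x using dsum_induction with
    | h0 => simp only [map_zero, LinearMap.zero_apply]
    | hadd x y hx hy => simp only [map_add, LinearMap.add_apply, hx, hy]
    | hs j x =>
      rw [← (dsumIncl N j).app_act, dsumToModule_incl, dsumToModule_incl, (s j).app_act h hp hn h']
  · intro a p q r hq hr x
    induction x using dsum_induction with
    | h0 => simp only [map_zero, add_zero]
    | hadd x y hx hy => simp only [map_add, hx, hy]; abel
    | hs j x =>
      rw [← (dsumIncl N j).app_d, dsumToModule_incl, dsumToModule_incl, ← hs j a hq hr]
      rfl

end DirectSum

/-! ### Coproducts in the derived category -/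

section Coproduct

variable {J : Type u} {N : J → DGModule A}

/-- After a K-injective replacement of the target, the given morphisms are represented by morphisms
of modules, which extend to the direct sum. -/
theorem exists_dsum_desc {Y : A.Derived} (φ : ∀ j, (toD A).obj (N j) ⟶ Y) :
    ∃ f : (toD A).obj (dsum N) ⟶ Y, ∀ j, (toD A).map (dsumIncl N j) ≫ f = φ j := by
  obtain ⟨P, rfl⟩ := exists_toD_obj_eq Y
  obtain ⟨I, ι, hI, hι⟩ := exists_isKInj_resolution P
  have := hι.isIso_toD
  choose f hf using fun j => exists_toD_map_eq hI (φ j ≫ (toD A).map ι)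
  refine ⟨(toD A).map (dsumDesc f) ≫ inv ((toD A).map ι), fun j => ?_⟩
  rw [← Category.assoc, ← Functor.map_comp, dsumIncl_desc, hf]
  exact (Category.assoc _ _ _).trans
    ((congrArg (φ j ≫ ·) (IsIso.hom_inv_id _)).trans (Category.comp_id _))

/-- With a K-injective target, vanishing on each summand means a null-homotopy on each summand, and
these assemble. -/
theorem eq_zero_of_dsumIncl_comp {Y : A.Derived} {f : (toD A).obj (dsum N) ⟶ Y}
    (h : ∀ j, (toD A).map (dsumIncl N j) ≫ f = 0) : f = 0 := by
  obtain ⟨P, rfl⟩ := exists_toD_obj_eq Y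
  obtain ⟨I, ι, hI, hι⟩ := exists_isKInj_resolution P
  have := hι.isIso_toD
  obtain ⟨a, ha⟩ := exists_toD_map_eq hI (f ≫ (toD A).map ι)
  have h0 : (toD A).map a = 0 := toD_map_eq_zero <| isNullHomotopic_of_dsumIncl fun j =>
    isNullHomotopic_of_toD_map_eq_zero hI (by
      rw [Functor.map_comp, ha]
      exact (Category.assoc _ _ _).symm.trans
        ((congrArg (· ≫ (toD A).map ι) (h j)).trans zero_comp))
  rw [ha] at h0
  exact (cancel_mono ((toD A).map ι)).1 (h0.trans zero_comp.symm)

/-- The direct sum of dg modules is a coproduct in the derived category. -/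
theorem nonempty_isColimit_dsum (N : J → DGModule A) :
    Nonempty (IsColimit (Cofan.mk ((toD A).obj (dsum N)) fun j =>
      (toD A).map (dsumIncl N j) : Cofan fun j => (N j).toDerived)) := by
  choose d hd using fun s : Cofan fun j => (N j).toDerived =>
    exists_dsum_desc (N := N) fun j => s.inj j
  refine ⟨Cofan.IsColimit.mk _ d hd fun s m hm => ?_⟩
  rw [← sub_eq_zero]
  refine eq_zero_of_dsumIncl_comp fun j => ?_
  exact (Preadditive.comp_sub _ _ _).trans (sub_eq_zero.2 ((hm j).trans (hd s j).symm))

/-- The morphisms to a direct sum that factor through a finite direct sum. -/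
def finHom (M : DGModule A) (N : J → DGModule A) :
    AddSubgroup ((toD A).obj M ⟶ (toD A).obj (dsum N)) :=
  AddSubgroup.closure {g | ∃ (j : J) (x : (toD A).obj M ⟶ (toD A).obj (N j)),
    g = x ≫ (toD A).map (dsumIncl N j)}

variable {M : DGModule A}

theorem comp_dsumIncl_mem_finHom (j : J) (x : (toD A).obj M ⟶ (toD A).obj (N j)) :
    x ≫ (toD A).map (dsumIncl N j) ∈ finHom M N :=
  AddSubgroup.subset_closure ⟨j, x, rfl⟩

/-- Membership in the subgroup becomes an equation: `f` equals its truncation by finitely many of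
the idempotents `dsumProj N j ≫ dsumIncl N j`. The converse is `mem_finHom_of_eq_sum`; the equation
is stable under precomposition and can be tested after a faithful operation. -/
theorem exists_finset_of_mem_finHom {f : (toD A).obj M ⟶ (toD A).obj (dsum N)}
    (hf : f ∈ finHom M N) : ∃ S : Finset J,
      f = ∑ j ∈ S, f ≫ (toD A).map (dsumProj N j ≫ dsumIncl N j) := by
  classical
  -- Asking for the identity on every larger finite set lets the sets for two summands be merged in
  -- the induction.
  suffices h : ∃ S : Finset J, ∀ S', S ⊆ S' →
      f = ∑ j ∈ S', f ≫ (toD A).map (dsumProj N j ≫ dsumIncl N j) by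
    obtain ⟨S, hS⟩ := h
    exact ⟨S, hS S subset_rfl⟩
  induction hf using AddSubgroup.closure_induction with
  | mem f hf =>
    obtain ⟨j, x, rfl⟩ := hf
    refine ⟨{j}, fun S hS => ?_⟩
    rw [Finset.sum_eq_single_of_mem j (hS (Finset.mem_singleton_self j)), Category.assoc,
      ← Functor.map_comp, ← Category.assoc (dsumIncl N j), dsumIncl_proj_self, Category.id_comp]
    intro i _ hi
    rw [Category.assoc, ← Functor.map_comp, ← Category.assoc (dsumIncl N j),
      dsumIncl_proj_of_ne N hi, zero_comp, Functor.map_zero, comp_zero]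
  | zero => exact ⟨∅, fun S _ => by simp⟩
  | add f g _ _ hf hg =>
    obtain ⟨S, hS⟩ := hf
    obtain ⟨S', hS'⟩ := hg
    refine ⟨S ∪ S', fun U hU => ?_⟩
    simp only [Preadditive.add_comp, Finset.sum_add_distrib]
    rw [← hS U (Finset.union_subset_left hU), ← hS' U (Finset.union_subset_right hU)]
  | neg f _ hf =>
    obtain ⟨S, hS⟩ := hf
    refine ⟨S, fun U hU => ?_⟩
    simp only [Preadditive.neg_comp, Finset.sum_neg_distrib]
    rw [← hS U hU]

theorem mem_finHom_of_eq_sum {f : (toD A).obj M ⟶ (toD A).obj (dsum N)} (S : Finset J)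
    (h : f = ∑ j ∈ S, f ≫ (toD A).map (dsumProj N j ≫ dsumIncl N j)) : f ∈ finHom M N := by
  rw [h]
  refine AddSubgroup.sum_mem _ fun j _ => ?_
  rw [Functor.map_comp, ← Category.assoc]
  exact comp_dsumIncl_mem_finHom j _

theorem comp_mem_finHom {M' : DGModule A} (e : (toD A).obj M' ⟶ (toD A).obj M)
    {f : (toD A).obj M ⟶ (toD A).obj (dsum N)} (hf : f ∈ finHom M N) : e ≫ f ∈ finHom M' N := by
  obtain ⟨S, hS⟩ := exists_finset_of_mem_finHom hf
  refine mem_finHom_of_eq_sum S ?_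
  simp only [Category.assoc]
  rw [← Preadditive.comp_sum, ← hS]

/-- A morphism between direct sums that respects the summands carries the generators of the subgroup
to generators. -/
theorem comp_mem_finHom_of_incl {N' : J → DGModule A}
    (e : (toD A).obj (dsum N) ⟶ (toD A).obj (dsum N'))
    (he : ∀ j, ∃ x : (toD A).obj (N j) ⟶ (toD A).obj (N' j),
      (toD A).map (dsumIncl N j) ≫ e = x ≫ (toD A).map (dsumIncl N' j))
    {f : (toD A).obj M ⟶ (toD A).obj (dsum N)} (hf : f ∈ finHom M N) : f ≫ e ∈ finHom M N' := by
  induction hf using AddSubgroup.closure_induction with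
  | mem f hf =>
    obtain ⟨j, y, rfl⟩ := hf
    obtain ⟨x, hx⟩ := he j
    rw [Category.assoc, hx, ← Category.assoc]
    exact comp_dsumIncl_mem_finHom j _
  | zero => rw [zero_comp]; exact zero_mem _
  | add f g _ _ hf hg => rw [Preadditive.add_comp]; exact add_mem hf hg
  | neg f _ hf => rw [Preadditive.neg_comp]; exact neg_mem hf

-- Injectivity of the comparison map holds for any object of a preadditive category: the morphism
-- from the coproduct to `N i` that is the identity on `N i` and zero on the other summands recovers
-- the component at `i`. Compactness is therefore only a matter of surjectivity.
open scoped Classical in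
theorem injective_toAddMonoid_inj {D : Type (u + 1)} [Category.{u + 1} D] [Preadditive D] (M : D)
    {N : J → D} {c : Cofan N} (hc : IsColimit c) :
    Function.Injective (DirectSum.toAddMonoid fun j => Preadditive.rightComp M (c.inj j)) := by
  rw [injective_iff_map_eq_zero]
  intro x hx
  refine DFinsupp.ext fun i => ?_
  let s : Cofan N := Cofan.mk (N i) fun j => if h : j = i then eqToHom (h ▸ rfl) else 0
  have key : ∀ y : ⨁ j, (M ⟶ N j),
      (DirectSum.toAddMonoid fun j => Preadditive.rightComp M (c.inj j)) y ≫ hc.desc s = y i := by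
    intro y
    induction y using DirectSum.induction_on with
    | zero => rw [map_zero, zero_comp]; rfl
    | of j y =>
      rw [DirectSum.toAddMonoid_of]
      have e : c.inj j ≫ hc.desc s = s.inj j := hc.fac s ⟨j⟩
      refine (Category.assoc _ _ _).trans ((congrArg (y ≫ ·) e).trans ?_)
      by_cases h : j = i
      · subst h
        refine Eq.trans ?_ (DirectSum.of_eq_same (β := fun j => M ⟶ N j) j y).symm
        simp [s]
      · refine Eq.trans ?_ (DirectSum.of_eq_of_ne (β := fun j => M ⟶ N j) j i y (Ne.symm h)).symm
        simp [s, h]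
    | add y z hy hz => rw [map_add, Preadditive.add_comp, hy, hz]; rfl
  rw [← key x, hx, zero_comp]
  rfl

/-- Every family in the derived category comes from modules, `dsum` is a coproduct of it, and
injectivity is automatic; what remains is that each morphism to `dsum N` lies in the image of the
comparison map. This is the form of perfection used from here on. -/
theorem isPerfect_iff : M.IsPerfect ↔
    ∀ (J : Type u) (N : J → DGModule A) (f : (toD A).obj M ⟶ (toD A).obj (dsum N)),
      f ∈ finHom M N := by
  classical
  constructor
  · intro h J N f
    obtain ⟨x, rfl⟩ := (h J _ _ (nonempty_isColimit_dsum N)).2 f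
    induction x using DirectSum.induction_on with
    | zero => rw [map_zero]; exact zero_mem _
    | of j y =>
      rw [DirectSum.toAddMonoid_of]
      exact comp_dsumIncl_mem_finHom j y
    | add y z hy hz => rw [map_add]; exact add_mem hy hz
  · rintro h J N c ⟨hc⟩
    refine ⟨injective_toAddMonoid_inj _ hc, fun f => ?_⟩
    choose N' hN' using fun j => exists_toD_obj_eq (N j)
    obtain rfl : (fun j => (toD A).obj (N' j)) = N := funext hN'
    obtain ⟨e, he⟩ := exists_dsum_desc (N := N') fun j => c.inj j
    let s : Cofan (fun j => (toD A).obj (N' j)) :=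
      Cofan.mk ((toD A).obj (dsum N')) fun j => (toD A).map (dsumIncl N' j)
    -- An arbitrary coproduct is compared with `dsum N'`; only this one-sided inverse is needed to
    -- bring a finite sum back to it.
    have hs : hc.desc s ≫ e = 𝟙 c.pt := hc.hom_ext fun ⟨j⟩ => by
      rw [← Category.assoc, hc.fac, Category.comp_id]
      exact he j
    suffices H : ∀ g ∈ finHom M N', g ≫ e ∈
        (DirectSum.toAddMonoid fun j => Preadditive.rightComp ((toD A).obj M) (c.inj j)).range by
      obtain ⟨x, hx⟩ := H (f ≫ hc.desc s) (h J N' _)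
      exact ⟨x, hx.trans ((Category.assoc _ _ _).trans
        ((congrArg (f ≫ ·) hs).trans (Category.comp_id f)))⟩
    intro g hg
    induction hg using AddSubgroup.closure_induction with
    | mem f hf =>
      obtain ⟨j, y, rfl⟩ := hf
      refine ⟨DirectSum.of _ j y, ?_⟩
      rw [DirectSum.toAddMonoid_of, Category.assoc, he]
      rfl
    | zero => rw [zero_comp]; exact zero_mem _
    | add f g _ _ hf hg => rw [Preadditive.add_comp]; exact add_mem hf hg
    | neg f _ hf => rw [Preadditive.neg_comp]; exact neg_mem hf

end Coproduct

/-! ### Restriction on the derived categories -/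

section Restriction

variable (F : DGFunctor A B)

/-- Restriction on the homotopy categories. -/
def resHo : B.HomotopyCat ⥤ A.HomotopyCat :=
  CategoryTheory.Quotient.lift (homotopic B) (restrictFunctor F ⋙ toHomotopyCat A)
    fun _ _ _ _ h => (toHomotopyCat_map_eq_iff _ _).2 (h.restrict F)

instance : (resHo F).Additive where
  map_add {M N f g} := by
    obtain ⟨M, rfl⟩ := exists_toHomotopyCat_obj_eq M
    obtain ⟨N, rfl⟩ := exists_toHomotopyCat_obj_eq N
    obtain ⟨f, rfl⟩ := exists_toHomotopyCat_map_eq f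
    obtain ⟨g, rfl⟩ := exists_toHomotopyCat_map_eq g
    rfl

/-- The localization functor from the homotopy category to the derived category. -/
def derQ (A : DGCat.{u} k) : A.HomotopyCat ⥤ A.Derived := (quasiIso A).Q

instance : (derQ A).Additive := inferInstanceAs (quasiIso A).Q.Additive

instance : (derQ A).IsLocalization (quasiIso A) :=
  inferInstanceAs ((quasiIso A).Q.IsLocalization (quasiIso A))

/-- Restriction on the derived categories. -/
def resD : B.Derived ⥤ A.Derived :=
  Localization.Construction.lift (W := quasiIso B) (resHo F ⋙ derQ A) (by
    rintro M N _ ⟨f, rfl, hf⟩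
    exact (hf.restrict F).isIso_toD)

theorem derQ_comp_resD : derQ B ⋙ resD F = resHo F ⋙ derQ A :=
  Localization.Construction.fac _ _

instance : (resD F).Additive := by
  refine (Localization.functor_additive_iff (derQ B) (quasiIso B) (resD F)).2 ?_
  rw [derQ_comp_resD]
  infer_instance

variable {M N P : DGModule B}

/-- The restriction of a morphism in the derived category. -/
def resMap (φ : (toD B).obj M ⟶ (toD B).obj N) :
    (toD A).obj (M.restrict F) ⟶ (toD A).obj (N.restrict F) :=
  (resD F).map φ

theorem resMap_map (f : M ⟶ N) : resMap F ((toD B).map f) = (toD A).map (restrictMap F f) := by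
  have := Functor.congr_hom (derQ_comp_resD F) ((toHomotopyCat B).map f)
  exact this.trans ((Category.id_comp _).trans (Category.comp_id _))

theorem resMap_comp (φ : (toD B).obj M ⟶ (toD B).obj N) (ψ : (toD B).obj N ⟶ (toD B).obj P) :
    resMap F (φ ≫ ψ) = resMap F φ ≫ resMap F ψ :=
  (resD F).map_comp φ ψ

theorem resMap_sub (φ ψ : (toD B).obj M ⟶ (toD B).obj N) :
    resMap F (φ - ψ) = resMap F φ - resMap F ψ :=
  (resD F).map_sub

theorem resMap_sum {J : Type u} (S : Finset J) (φ : J → ((toD B).obj M ⟶ (toD B).obj N)) :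
    resMap F (∑ j ∈ S, φ j) = ∑ j ∈ S, resMap F (φ j) :=
  (resD F).map_sum φ S

/-- The comparison of the restriction of a direct sum with the direct sum of the restrictions. -/
def restrictDsum {J : Type u} (N : J → DGModule B) :
    (dsum N).restrict F ⟶ dsum fun j => (N j).restrict F :=
  ofRes (M := dsum N) (fun _ _ => LinearMap.id) (fun _ _ _ _ _ => rfl)
    (fun _ _ _ _ _ _ _ _ => rfl)

theorem isQuasiIso_restrictDsum {J : Type u} (N : J → DGModule B) :
    IsQuasiIso (restrictDsum F N) where
  surj a p q r hq hr y hy := ⟨y, 0, hy, by rw [map_zero, add_zero]; rfl⟩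
  inj a p q r hq hr x z hx h := ⟨z, h⟩

/-- Morphisms from a perfect module to the restriction of a direct sum. -/
theorem IsPerfect.exists_finset {M₀ : DGModule A} (h : M₀.IsPerfect) {J : Type u}
    (N : J → DGModule B) (f : (toD A).obj M₀ ⟶ (toD A).obj ((dsum N).restrict F)) :
    ∃ S : Finset J, f = ∑ j ∈ S, f ≫ resMap F ((toD B).map (dsumProj N j ≫ dsumIncl N j)) := by
  have := (isQuasiIso_restrictDsum F N).isIso_toD
  obtain ⟨S, hS⟩ := exists_finset_of_mem_finHom
    (isPerfect_iff.1 h J _ (f ≫ (toD A).map (restrictDsum F N)))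
  refine ⟨S, ?_⟩
  rw [← cancel_mono ((toD A).map (restrictDsum F N)), hS, Preadditive.sum_comp]
  refine Finset.sum_congr rfl fun j _ => ?_
  rw [resMap_map, Category.assoc, Category.assoc, ← Functor.map_comp, ← Functor.map_comp]
  rfl

/-- A criterion for perfection: `M` is perfect if the morphisms out of `M` are determined by their
composition with a morphism from a perfect module to the restriction of `M`. -/
theorem isPerfect_of_faithful {M₀ : DGModule A} (h : M₀.IsPerfect) (η : M₀ ⟶ M.restrict F)
    (H : ∀ (N : DGModule B) (f : (toD B).obj M ⟶ (toD B).obj N),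
      (toD A).map η ≫ resMap F f = 0 → f = 0) : M.IsPerfect := by
  refine isPerfect_iff.2 fun J N f => ?_
  obtain ⟨S, hS⟩ := h.exists_finset F N ((toD A).map η ≫ resMap F f)
  -- `f` and its truncation to `S` have the same composite with `η` after restriction, so `H`
  -- applied to their difference makes them equal.
  refine mem_finHom_of_eq_sum S ?_
  rw [← sub_eq_zero]
  refine H _ _ ?_
  rw [resMap_sub, resMap_sum, Preadditive.comp_sub, Preadditive.comp_sum, sub_eq_zero, hS]
  refine Finset.sum_congr rfl fun j _ => ?_
  rw [resMap_comp, Category.assoc]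

end Restriction

end DGModule

end

/-! ### Exact sequences of homotopy fibres, and shifts. -/

noncomputable section

namespace DGModule

variable {k : Type u} [Field k] {A : DGCat.{u} k}

/-! ### Functoriality of homotopy fibres -/

section FibMap

variable {M N : DGModule A} (u : M ⟶ N)

/-- The elements of the homotopy fibre. -/
def fibMk (a : A.Obj) {p q : ℤ} (h : q + 1 = p) (m : M.X a p) (n : N.X a q) : (fib u).X a p :=
  ((m, N.cast a (by omega) n) : M.X a p × N.X a (p - 1))

variable {u}

theorem exists_eq_fibMk {a : A.Obj} {p q : ℤ} (h : q + 1 = p) (x : (fib u).X a p) :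
    ∃ m n, x = fibMk u a h m n :=
  ⟨x.1, N.cast a (by omega) x.2, Prod.ext rfl (by
    show x.2 = N.cast a _ (N.cast a _ x.2)
    rw [cast_cast, cast_rfl])⟩

theorem fibMk_inj {a : A.Obj} {p q : ℤ} {h : q + 1 = p} {m m' : M.X a p} {n n' : N.X a q}
    (e : fibMk u a h m n = fibMk u a h m' n') : m = m' ∧ n = n' := by
  refine ⟨congrArg Prod.fst e, ?_⟩
  have := congrArg (N.cast a (by omega : p - 1 = q)) (congrArg Prod.snd e)
  simpa [fibMk] using this

theorem fibMk_zero {a : A.Obj} {p q : ℤ} (h : q + 1 = p) : fibMk u a h 0 0 = 0 :=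
  Prod.ext rfl (map_zero (N.cast a _))

theorem fibMk_add {a : A.Obj} {p q : ℤ} (h : q + 1 = p) (m m' : M.X a p) (n n' : N.X a q) :
    fibMk u a h (m + m') (n + n') = fibMk u a h m n + fibMk u a h m' n' :=
  Prod.ext rfl (map_add (N.cast a _) n n')

theorem d_fibMk {a : A.Obj} {p q r : ℤ} (h : q + 1 = p) (h' : p + 1 = r) (m : M.X a p)
    (n : N.X a q) :
    (fib u).d h' (fibMk u a h m n) = fibMk u a h' (M.d h' m) (u.app a p m - N.d h n) := by
  refine Prod.ext rfl ?_
  show N.cast a _ (u.app a p m) - N.d _ (N.cast a _ n) = N.cast a _ (u.app a p m - N.d h n)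
  rw [map_sub, d_cast, cast_d]

theorem act_fibMk {a b : A.Obj} {p q r p' r' : ℤ} (h : p' + 1 = p) (hr : p + q = r)
    (h' : r' + 1 = r) (hr' : p' + q = r') (m : M.X b p) (n : N.X b p') (x : A.Hom a b q) :
    (fib u).act hr (fibMk u b h m n) x = fibMk u a h' (M.act hr m x) (N.act hr' n x) := by
  refine Prod.ext rfl ?_
  show N.act _ (N.cast b _ n) x = N.cast a _ (N.act hr' n x)
  rw [act_cast, cast_act]

variable {M' N' : DGModule A} {v : M' ⟶ N'}

variable (f : M ⟶ M') (g : N ⟶ N') (s : DegNegOne M N')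
  (hs : ∀ (a : A.Obj) {p q r : ℤ} (hq : q + 1 = p) (hr : p + 1 = r) (m : M.X a p),
    (f ≫ v - u ≫ g).app a p m = N'.d hq (s.app a hq m) + s.app a hr (M.d hr m))

/-- The linear maps underlying `fibMap`. -/
def fibMapApp (a : A.Obj) (p : ℤ) : (fib u).X a p →ₗ[k] (fib v).X a p :=
  LinearMap.prod (f.app a p ∘ₗ LinearMap.fst k (M.X a p) (N.X a (p - 1)))
    (g.app a (p - 1) ∘ₗ LinearMap.snd k (M.X a p) (N.X a (p - 1)) +
      s.app a (by omega) ∘ₗ LinearMap.fst k (M.X a p) (N.X a (p - 1)))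

theorem fibMapApp_fibMk (a : A.Obj) {p q : ℤ} (h : q + 1 = p) (m : M.X a p) (n : N.X a q) :
    fibMapApp (v := v) f g s a p (fibMk u a h m n) =
      fibMk v a h (f.app a p m) (g.app a q n + s.app a h m) := by
  obtain rfl : q = p - 1 := by omega
  rfl

/-- The morphism between homotopy fibres induced by a square that commutes up to homotopy. -/
def fibMap : fib u ⟶ fib v :=
  Hom.mk (fibMapApp f g s)
    (fun {a p q} h x => by
      obtain ⟨m, n, rfl⟩ := exists_eq_fibMk (sub_add_cancel p 1) x
      have e := hs a (sub_add_cancel p 1) h m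
      rw [sub_app, comp_app, comp_app] at e
      rw [d_fibMk _ h, fibMapApp_fibMk, fibMapApp_fibMk, d_fibMk _ h, f.app_d, map_sub, map_add,
        sub_eq_iff_eq_add.1 e, g.app_d]
      congr 1
      abel)
    (fun {a b p q n} h x y => by
      obtain ⟨m, m', rfl⟩ := exists_eq_fibMk (sub_add_cancel p 1) x
      rw [act_fibMk _ h (sub_add_cancel n 1) (by omega), fibMapApp_fibMk, fibMapApp_fibMk,
        act_fibMk _ h (sub_add_cancel n 1) (by omega), f.app_act h, g.app_act,
        s.app_act h (sub_add_cancel p 1) (sub_add_cancel n 1) (by omega), map_add,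
        LinearMap.add_apply])

theorem fibMap_fibMk (a : A.Obj) {p q : ℤ} (h : q + 1 = p) (m : M.X a p) (n : N.X a q) :
    (fibMap f g s hs).app a p (fibMk u a h m n) =
      fibMk v a h (f.app a p m) (g.app a q n + s.app a h m) :=
  fibMapApp_fibMk f g s a h m n

theorem fibMap_fst : fibMap f g s hs ≫ fibFst v = fibFst u ≫ f := rfl

/-- The five lemma for the long exact cohomology sequences of the two fibres, carried out as a
diagram chase that keeps track of the homotopy `s`. -/
theorem isQuasiIso_fibMap (hf : IsQuasiIso f) (hg : IsQuasiIso g) :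
    IsQuasiIso (fibMap f g s hs) where
  surj a p q r hq hr y hy := by
    obtain ⟨m', n', rfl⟩ := exists_eq_fibMk hq y
    rw [d_fibMk, ← fibMk_zero hr] at hy
    obtain ⟨h1, h2⟩ := fibMk_inj hy
    obtain ⟨m, z, hm, rfl⟩ := hf.surj a hq hr m' h1
    have e := hs a hq hr m
    rw [sub_app, comp_app, comp_app, hm, map_zero, add_zero, sub_eq_iff_eq_add] at e
    rw [map_add, e, v.app_d, sub_eq_zero] at h2
    -- A preimage needs some `n` with `d n = u m`. Injectivity of `g` on cohomology provides `n₀`;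
    -- surjectivity then provides a cocycle `n₁` accounting for what `g n₀` misses.
    obtain ⟨n₀, hn₀⟩ := hg.inj a hq hr (u.app a p m) (n' - s.app a hq m - v.app a q z)
      (by rw [← u.app_d, hm, map_zero]) (by rw [map_sub, map_sub, ← h2]; abel)
    obtain ⟨n₁, z₁, hn₁, hz₁⟩ := hg.surj a (sub_add_cancel q 1) hq
      (n' - g.app a q n₀ - s.app a hq m - v.app a q z) (by
        rw [map_sub, map_sub, map_sub, ← h2, ← g.app_d, ← hn₀]; abel)
    refine ⟨fibMk u a hq m (n₀ + n₁), fibMk v a (sub_add_cancel q 1) z (-z₁), ?_, ?_⟩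
    · rw [d_fibMk _ hr, hm, map_add, hn₁, ← hn₀, add_zero, sub_self, fibMk_zero]
    · rw [d_fibMk _ hq, fibMap_fibMk, ← fibMk_add]
      congr 1
      rw [map_add, map_neg, sub_neg_eq_add, add_assoc, sub_eq_iff_eq_add.1 (sub_eq_iff_eq_add.1 (sub_eq_iff_eq_add.1 hz₁))]
      abel
  inj a p q r hq hr x z hx h := by
    obtain ⟨m, n, rfl⟩ := exists_eq_fibMk hq x
    obtain ⟨z, y, rfl⟩ := exists_eq_fibMk (sub_add_cancel q 1) z
    rw [d_fibMk, ← fibMk_zero hr] at hx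
    obtain ⟨h1, h2⟩ := fibMk_inj hx
    rw [sub_eq_zero] at h2
    rw [d_fibMk _ hq, fibMap_fibMk] at h
    obtain ⟨h3, h4⟩ := fibMk_inj h
    obtain ⟨m₀, rfl⟩ := hf.inj a hq hr m z h1 h3
    -- The primitive `m₀` of `m` is adjusted by a cocycle `m₁`, so that its image under `f` agrees
    -- with `z` up to a boundary; only then can the second component be solved for.
    obtain ⟨m₁, z₁, hm₁, hz₁⟩ := hf.surj a (sub_add_cancel q 1) hq (z - f.app a q m₀) (by
      rw [map_sub, ← f.app_d, h3, sub_self])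
    have hz : z = f.app a q (m₀ + m₁) + M'.d (sub_add_cancel q 1) z₁ := by
      rw [map_add, add_assoc, ← hz₁, add_sub_cancel]
    have e := hs a (sub_add_cancel q 1) hq (m₀ + m₁)
    rw [sub_app, comp_app, comp_app, map_add (M.d hq), hm₁, add_zero] at e
    obtain ⟨y₀, hy₀⟩ := hg.inj a (sub_add_cancel q 1) hq (n - u.app a q (m₀ + m₁))
      (s.app a (sub_add_cancel q 1) (m₀ + m₁) + v.app a _ z₁ - y) (by
        rw [map_sub, ← u.app_d, map_add (M.d hq), hm₁, add_zero, h2, sub_self]) (by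
        rw [map_sub, eq_sub_of_add_eq h4, map_sub, map_add (N'.d _), ← v.app_d,
          eq_sub_of_add_eq e.symm, hz]
        simp only [map_add]
        abel)
    refine ⟨fibMk u a (sub_add_cancel q 1) (m₀ + m₁) (-y₀), ?_⟩
    rw [d_fibMk _ hq, map_add (M.d hq), hm₁, add_zero, map_neg, ← hy₀]
    congr 1
    abel

end FibMap

/-- Exactness of the functors represented in the derived category on homotopy fibres. -/
theorem exists_comp_fibFst_eq {M N P : DGModule A} (u : N ⟶ P)
    (g : (toD A).obj M ⟶ (toD A).obj N) (hg : g ≫ (toD A).map u = 0) :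
    ∃ h : (toD A).obj M ⟶ (toD A).obj (fib u), h ≫ (toD A).map (fibFst u) = g := by
  -- Both ends of `u` are replaced by K-injective modules, so that vanishing in the derived category
  -- becomes a null-homotopy, which is what a lift to the fibre requires.
  obtain ⟨I, ι, hI, hι⟩ := exists_isKInj_resolution N
  obtain ⟨I', κ, hI', hκ⟩ := exists_isKInj_resolution P
  have := hι.isIso_toD
  have := hκ.isIso_toD
  obtain ⟨v, hv⟩ := exists_toD_map_eq hI'
    (inv ((toD A).map ι) ≫ (toD A).map u ≫ (toD A).map κ)
  obtain ⟨s, hs⟩ : IsNullHomotopic (ι ≫ v - u ≫ κ) := by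
    refine isNullHomotopic_of_toD_map_eq_zero hI' ?_
    rw [Functor.map_sub, Functor.map_comp, Functor.map_comp, hv, IsIso.hom_inv_id_assoc, sub_self]
  have := (isQuasiIso_fibMap ι κ s hs hι hκ).isIso_toD
  obtain ⟨a, ha⟩ := exists_toD_map_eq hI (g ≫ (toD A).map ι)
  -- The lift is to the fibre of the replacement `v`; the quasi-isomorphism `fibMap` carries it back
  -- to the fibre of `u`.
  obtain ⟨b, rfl⟩ := exists_lift_fib v a (isNullHomotopic_of_toD_map_eq_zero hI' (by
    rw [Functor.map_comp, ha, hv, Category.assoc, IsIso.hom_inv_id_assoc, ← Category.assoc, hg,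
      zero_comp]))
  refine ⟨(toD A).map b ≫ inv ((toD A).map (fibMap ι κ s hs)), ?_⟩
  rw [← cancel_mono ((toD A).map ι), ← ha, Category.assoc, Category.assoc, ← Functor.map_comp,
    ← fibMap_fst ι κ s hs, Functor.map_comp, IsIso.inv_hom_id_assoc, Functor.map_comp]

/-! ### Shifts -/

section Shift

theorem koszulSign_mul_self (c : ℤ) : koszulSign k c * koszulSign k c = 1 := by
  rw [koszulSign_mul, koszulSign_congr (n := 0) ⟨c, by ring⟩, koszulSign_zero]

/-- The shift of a dg module by `c`. -/
def sh (c : ℤ) (M : DGModule A) : DGModule A where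
  X a n := M.X a (n + c)
  -- With the action left unsigned, the sign is forced by the Leibniz rule, whose sign depends on
  -- the shifted degree.
  d {a p q} h := koszulSign k c • M.d (by omega)
  act h := M.act (by omega)
  d_d h h' m := by
    simp only [LinearMap.smul_apply, map_smul, M.d_d, smul_zero]
  act_id h m := M.act_id _ m
  act_act hpq hqr h h' m f g := M.act_act _ hqr _ _ m f g
  leibniz {a b p q n p' q' n'} h hn hp hq h₁ h₂ m f := by
    simp only [LinearMap.smul_apply]
    rw [M.leibniz (p' := p' + c) _ _ (by omega) hq (by omega) (by omega), smul_add, smul_smul,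
      koszulSign_mul, koszulSign_congr (k := k) (m := c + (p + c)) (n := p) ⟨c, by ring⟩,
      map_smul, LinearMap.smul_apply]

/-- The components of a shift. -/
def shIn (c : ℤ) (M : DGModule A) (a : A.Obj) {p n : ℤ} (h : n + c = p) :
    M.X a p →ₗ[k] (sh c M).X a n := M.cast a h.symm

/-- The components of a shift. -/
def shOut (c : ℤ) (M : DGModule A) (a : A.Obj) {p n : ℤ} (h : n + c = p) :
    (sh c M).X a n →ₗ[k] M.X a p := M.cast a h

variable {M N : DGModule A} {c : ℤ}

@[simp] theorem shIn_out (a : A.Obj) {p n : ℤ} (h : n + c = p) (m : (sh c M).X a n) :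
    shIn c M a h (shOut c M a h m) = m := by
  subst h; rfl

@[simp] theorem shOut_in (a : A.Obj) {p n : ℤ} (h : n + c = p) (m : M.X a p) :
    shOut c M a h (shIn c M a h m) = m := by
  subst h; rfl

theorem shOut_d (a : A.Obj) {p q n m : ℤ} (h : n + 1 = m) (h₁ : n + c = p) (h₂ : m + c = q)
    (h₃ : p + 1 = q) (x : (sh c M).X a n) :
    shOut c M a h₂ ((sh c M).d h x) = koszulSign k c • M.d h₃ (shOut c M a h₁ x) := by
  subst h₁ h₂; rfl

theorem shOut_act {a b : A.Obj} {p q n r t : ℤ} (h : n + q = r) (h₁ : n + c = p) (h₂ : r + c = t)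
    (h₃ : p + q = t) (x : (sh c M).X b n) (f : A.Hom a b q) :
    shOut c M a h₂ ((sh c M).act h x f) = M.act h₃ (shOut c M b h₁ x) f := by
  subst h₁ h₂; rfl

theorem shIn_d (a : A.Obj) {p q n m : ℤ} (h : n + 1 = m) (h₁ : n + c = p) (h₂ : m + c = q)
    (h₃ : p + 1 = q) (x : M.X a p) :
    (sh c M).d h (shIn c M a h₁ x) = koszulSign k c • shIn c M a h₂ (M.d h₃ x) := by
  subst h₁ h₂; rfl

theorem shIn_act {a b : A.Obj} {p q n r t : ℤ} (h : n + q = r) (h₁ : n + c = p) (h₂ : r + c = t)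
    (h₃ : p + q = t) (x : M.X b p) (f : A.Hom a b q) :
    (sh c M).act h (shIn c M b h₁ x) f = shIn c M a h₂ (M.act h₃ x f) := by
  subst h₁ h₂; rfl

/-- The shift of a morphism. -/
def shMap (c : ℤ) (f : M ⟶ N) : sh c M ⟶ sh c N :=
  Hom.mk (fun a n => f.app a (n + c))
    (fun {a p q} h m => by
      refine (map_smul (f.app a (q + c)) (koszulSign k c) _).trans ?_
      exact congrArg (koszulSign k c • ·) (f.app_d _ m))
    (fun _ m x => f.app_act _ m x)

theorem shMap_comp {P : DGModule A} (f : M ⟶ N) (g : N ⟶ P) :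
    shMap c (f ≫ g) = shMap c f ≫ shMap c g := rfl

theorem shOut_map (f : M ⟶ N) (a : A.Obj) {p n : ℤ} (h : n + c = p) (x : (sh c M).X a n) :
    shOut c N a h ((shMap c f).app a n x) = f.app a p (shOut c M a h x) := by
  subst h; rfl

theorem IsAcyclic.sh (h : M.IsAcyclic) : (sh c M).IsAcyclic := by
  intro a p q r hq hr x hx
  have h1 : M.d (by omega : p + c + 1 = r + c) (shOut c M a rfl x) = 0 := by
    have := congrArg (shOut c M a rfl) hx
    rw [shOut_d a hr rfl rfl (by omega), map_zero] at this
    rw [← one_smul k (M.d _ _), ← koszulSign_mul_self c, mul_smul, this, smul_zero]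
  obtain ⟨w, hw⟩ := h a (by omega : q + c + 1 = p + c) (by omega) _ h1
  refine ⟨shIn c M a rfl (koszulSign k c • w), ?_⟩
  rw [shIn_d a hq rfl rfl (by omega), map_smul, map_smul, smul_smul, koszulSign_mul_self, one_smul,
    ← hw, shIn_out]

/-- Shifting by `-c` turns a morphism to the shift of `N` into a morphism to `N` with acyclic
source. -/
theorem IsKInj.sh (hN : N.IsKInj) : (sh c N).IsKInj := by
  intro M hM f
  let g : DGModule.sh (-c) M ⟶ N := Hom.mk
    (fun a n => shOut c N a (by omega) ∘ₗ f.app a (n - c) ∘ₗ shOut (-c) M a (by omega))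
    (fun {a p q} h m => by
      simp only [LinearMap.comp_apply]
      rw [shOut_d (p := p - c) (q := q - c) a h (by omega) (by omega) (by omega), map_smul,
        f.app_d, map_smul, shOut_d (p := p) (q := q) a _ (by omega) (by omega) h, smul_smul,
        koszulSign_mul, neg_add_cancel, koszulSign_zero, one_smul])
    (fun {a b p q n} h m x => by
      simp only [LinearMap.comp_apply]
      rw [shOut_act (p := p - c) (t := n - c) h (by omega) (by omega) (by omega), f.app_act,
        shOut_act (p := p) (t := n) _ (by omega) (by omega) h])
  have hg : ∀ (a : A.Obj) (n n' : ℤ) (h : n - c = n') (m : (DGModule.sh (-c) M).X a n),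
      g.app a n m = shOut c N a (by omega) (f.app a n' (shOut (-c) M a (by omega) m)) := by
    intro a n n' h m
    subst h; rfl
  obtain ⟨t, ht⟩ := hN _ hM.sh g
  -- The sign compensates for the factors `(-1)^c` in the differentials of the two shifts.
  refine ⟨⟨fun a p q h => koszulSign k c • (shIn c N a (by omega) ∘ₗ
    t.app a (by omega : q + c + 1 = p + c) ∘ₗ shIn (-c) M a (by omega)), ?_⟩, ?_⟩
  · intro a b p q n p' n' h hp hn h' m x
    simp only [LinearMap.smul_apply, LinearMap.comp_apply]
    rw [← shIn_act (c := -c) (n := p + c) (r := n + c) (by omega) (by omega) (by omega) h,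
      t.app_act (p' := p' + c) _ (by omega) _ (by omega), map_smul, LinearMap.smul_apply,
      shIn_act h' rfl rfl]
  · intro a p q r hq hr m
    have e := ht a (by omega : q + c + 1 = p + c) (by omega : p + c + 1 = r + c)
      (shIn (-c) M a (by omega) m)
    rw [hg a _ p (by omega), shOut_in] at e
    have e' := congrArg (shIn c N a rfl) e
    rw [shIn_out] at e'
    rw [e']
    simp only [LinearMap.smul_apply, LinearMap.comp_apply, map_add, map_smul]
    rw [shIn_d (c := c) a hq rfl rfl (by omega), smul_smul, koszulSign_mul_self, one_smul,
      shIn_d (c := -c) (q := r) a _ _ (by omega) hr, map_smul, map_smul,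
      koszulSign_congr (k := k) (m := -c) (n := c) ⟨-c, by ring⟩]

theorem IsQuasiIso.sh {f : M ⟶ N} (hf : IsQuasiIso f) : IsQuasiIso (shMap c f) where
  surj a p q r hq hr y hy := by
    have h1 : N.d (by omega : p + c + 1 = r + c) (shOut c N a rfl y) = 0 := by
      have := congrArg (shOut c N a rfl) hy
      rw [shOut_d a hr rfl rfl (by omega), map_zero] at this
      rw [← one_smul k (N.d _ _), ← koszulSign_mul_self c, mul_smul, this, smul_zero]
    obtain ⟨x, z, hx, e⟩ := hf.surj a (by omega : q + c + 1 = p + c) _ _ h1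
    refine ⟨shIn c M a rfl x, shIn c N a rfl (koszulSign k c • z), ?_, ?_⟩
    · rw [shIn_d a hr rfl rfl (by omega), hx, map_zero, smul_zero]
    · rw [shIn_d a hq rfl rfl (by omega), map_smul, map_smul, smul_smul, koszulSign_mul_self,
        one_smul]
      refine ((shIn_out a rfl y).symm.trans (congrArg (shIn c N a rfl) e)).trans ?_
      rw [map_add]
      rfl
  inj a p q r hq hr x z hx h := by
    have h1 : M.d (by omega : p + c + 1 = r + c) (shOut c M a rfl x) = 0 := by
      have := congrArg (shOut c M a rfl) hx
      rw [shOut_d a hr rfl rfl (by omega), map_zero] at this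
      rw [← one_smul k (M.d _ _), ← koszulSign_mul_self c, mul_smul, this, smul_zero]
    have h2 := congrArg (shOut c N a rfl) h
    rw [shOut_map, shOut_d a hq rfl rfl (by omega), ← map_smul] at h2
    obtain ⟨w, hw⟩ := hf.inj a (by omega : q + c + 1 = p + c) _ _ _ h1 h2
    refine ⟨shIn c M a rfl (koszulSign k c • w), ?_⟩
    rw [shIn_d a hq rfl rfl (by omega), map_smul, map_smul, smul_smul, koszulSign_mul_self,
      one_smul, ← hw, shIn_out]

theorem sh_dsum_d {J : Type u} (N : J → DGModule A) (c : ℤ) (a : A.Obj) {p q : ℤ} (h : p + 1 = q)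
    (x : (sh c (dsum N)).X a p) : (sh c (dsum N)).d h x = (dsum fun j => sh c (N j)).d h x :=
  DFinsupp.ext fun _ => rfl

/-- The comparison of the shift of a direct sum with the direct sum of the shifts. -/
def shDsum {J : Type u} (N : J → DGModule A) (c : ℤ) : sh c (dsum N) ⟶ dsum fun j => sh c (N j) :=
  Hom.mk (fun _ _ => LinearMap.id) (fun h x => sh_dsum_d N c _ h x) (fun _ _ _ => rfl)

theorem shDsum_proj {J : Type u} (N : J → DGModule A) (j : J) :
    shDsum N c ≫ dsumProj (fun j => sh c (N j)) j = shMap c (dsumProj N j) :=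
  rfl

theorem dsumIncl_shDsum {J : Type u} (N : J → DGModule A) (j : J) :
    shMap c (dsumIncl N j) ≫ shDsum N c = dsumIncl (fun j => sh c (N j)) j :=
  rfl

theorem isQuasiIso_shDsum {J : Type u} (N : J → DGModule A) : IsQuasiIso (shDsum N c) where
  surj a p q r hq hr y hy := ⟨y, 0, (sh_dsum_d N c a hr y).trans hy, by
    rw [map_zero, add_zero]; rfl⟩
  inj a p q r hq hr x z hx h := ⟨z, Eq.trans h (sh_dsum_d N c a hq z).symm⟩

end Shift

end DGModule

end

/-! ### Perfect restrictions of representables: coinduction commutes with direct sums. -/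

noncomputable section

namespace DGModule

variable {k : Type u} [Field k] {D E : DGCat.{u} k}

/-! ### Cocycles of coinduced modules -/

section Cocycles

variable (F : DGFunctor D E)

/-- Evaluation of the elements of a module coinduced along one dg functor. -/
abbrev coindOneEv (L : DGModule D) {a : E.Obj} {p : ℤ} (x : D.Obj) {q n : ℤ} (h : p + q = n + 0) :
    (coindOne F L).X a p →ₗ[k] E.Hom (F.obj x) a q →ₗ[k] L.X x n :=
  coindEv (T := PUnit.{u + 1}) 0 (fun _ => F) (fun _ => L) PUnit.unit x h

/-- The restriction of a representable module. -/
abbrev repRes (e : E.Obj) : DGModule D := (E.representable e).restrict F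

variable {F} {L L' : DGModule D} {e : E.Obj}

/-- Construction of elements of a coinduced module. -/
def coindOneMk {p : ℤ} (β : ∀ (x : D.Obj) (q n : ℤ), p + q = n + 0 →
      E.Hom (F.obj x) e q →ₗ[k] L.X x n)
    (hβ : ∀ (x y : D.Obj) (q r qr n n' : ℤ) (h : p + q = n + 0) (hqr : q + r = qr)
      (h' : p + qr = n' + 0) (hn : n + r = n') (f : E.Hom (F.obj x) e q) (g : D.Hom y x r),
      β y qr n' h' (E.comp hqr f (F.map g)) = L.act hn (β x q n h f) g) :
    (coindOne F L).X e p :=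
  -- An element is the image of `1` under a linear map from `k`.
  coindLift (T := PUnit.{u + 1}) (V := k) (F := fun _ => F) (L := fun _ => L) (c := 0) (a := e)
    (fun _ x q n h => LinearMap.toSpanSingleton k _ (β x q n h))
    (fun t x y q r qr n n' h hqr h' hn v f g => by
      simp only [LinearMap.toSpanSingleton_apply, LinearMap.smul_apply, map_smul]
      rw [hβ x y q r qr n n' h hqr h' hn]) 1

theorem coindOneEv_mk {p : ℤ} (β : ∀ (x : D.Obj) (q n : ℤ), p + q = n + 0 →
      E.Hom (F.obj x) e q →ₗ[k] L.X x n) (hβ) (x : D.Obj) {q n : ℤ} (h : p + q = n + 0)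
    (f : E.Hom (F.obj x) e q) : coindOneEv F L x h (coindOneMk β hβ) f = β x q n h f :=
  congrArg (fun g => g f) (one_smul k (β x q n h))

/-- The components of a morphism from the restriction of a representable module to a shift. -/
def shApp {p : ℤ} (g : repRes F e ⟶ sh p L) (x : D.Obj) {q n : ℤ} (h : p + q = n + 0) :
    E.Hom (F.obj x) e q →ₗ[k] L.X x n :=
  shOut p L x (by omega) ∘ₗ g.app x q

theorem shApp_d {p : ℤ} (g : repRes F e ⟶ sh p L) (x : D.Obj) {q q' n n' : ℤ}
    (hq : q + 1 = q') (hn : n + 1 = n') (h : p + q = n + 0) (h' : p + q' = n' + 0)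
    (f : E.Hom (F.obj x) e q) :
    shApp g x h' (E.d hq f) = koszulSign k p • L.d hn (shApp g x h f) :=
  (congrArg (shOut p L x _) (g.app_d hq f)).trans (shOut_d x hq _ _ hn _)

theorem shApp_act {p : ℤ} (g : repRes F e ⟶ sh p L) {x y : D.Obj} {q r qr n n' : ℤ}
    (h : p + q = n + 0) (hqr : q + r = qr) (h' : p + qr = n' + 0) (hn : n + r = n')
    (f : E.Hom (F.obj x) e q) (w : D.Hom y x r) :
    shApp g y h' (E.comp hqr f (F.map w)) = L.act hn (shApp g x h f) w :=
  (congrArg (shOut p L y _) (g.app_act hqr f w)).trans (shOut_act hqr _ _ hn _ _)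

theorem shApp_comp {p : ℤ} (g : repRes F e ⟶ sh p L) (b : L ⟶ L') (x : D.Obj) {q n : ℤ}
    (h : p + q = n + 0) (f : E.Hom (F.obj x) e q) :
    shApp (g ≫ shMap p b) x h f = b.app x n (shApp g x h f) :=
  shOut_map b x _ _

/-- The element `φ` of the coinduced module corresponds to the morphism `g`. -/
def Represents {p : ℤ} (φ : (coindOne F L).X e p) (g : repRes F e ⟶ sh p L) : Prop :=
  ∀ (x : D.Obj) (q n : ℤ) (h : p + q = n + 0) (f : E.Hom (F.obj x) e q),
    coindOneEv F L x h φ f = shApp g x h f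

theorem Represents.add {p : ℤ} {φ ψ : (coindOne F L).X e p} {f g : repRes F e ⟶ sh p L}
    (hf : Represents φ f) (hg : Represents ψ g) : Represents (φ + ψ) (f + g) := by
  intro x q n h w
  rw [map_add, LinearMap.add_apply, hf, hg]
  exact (map_add (shOut p L x _) _ _).symm

theorem Represents.sub {p : ℤ} {φ ψ : (coindOne F L).X e p} {f g : repRes F e ⟶ sh p L}
    (hf : Represents φ f) (hg : Represents ψ g) : Represents (φ - ψ) (f - g) := by
  intro x q n h w
  rw [map_sub, LinearMap.sub_apply, hf, hg]
  exact ((congrArg (shOut p L x _) (sub_app f g x q w)).trans (map_sub _ _ _)).symm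

theorem Represents.zero {p : ℤ} : Represents (0 : (coindOne F L).X e p) 0 := by
  intro x q n h w
  rw [map_zero, LinearMap.zero_apply]
  exact (map_zero (shOut p L x (by omega : q + p = n))).symm

theorem Represents.sum {p : ℤ} {J : Type u} (S : Finset J) {φ : J → (coindOne F L).X e p}
    {g : J → (repRes F e ⟶ sh p L)} (h : ∀ j ∈ S, Represents (φ j) (g j)) :
    Represents (∑ j ∈ S, φ j) (∑ j ∈ S, g j) := by
  classical
  induction S using Finset.induction_on with
  | empty => exact Represents.zero
  | insert j S hj ih =>
    rw [Finset.sum_insert hj, Finset.sum_insert hj]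
    exact (h j (Finset.mem_insert_self j S)).add
      (ih fun i hi => h i (Finset.mem_insert_of_mem hi))

theorem Represents.comp {p : ℤ} {φ : (coindOne F L).X e p} {g : repRes F e ⟶ sh p L}
    (h : Represents φ g) (b : L ⟶ L') :
    Represents ((coindMap F b).app e p φ) (g ≫ shMap p b) := by
  intro x q n hn f
  rw [shApp_comp, ← h]
  exact ev_coindMap F b e φ PUnit.unit x hn f

/-- The differential of the coinduced module is `f ↦ d (φ f) - (-1)^p φ (d f)`, so a cocycle is
precisely a family commuting with the differentials once that of `L` is twisted by `(-1)^p`, as in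
the shift. With the next three lemmas, the cohomology in degree p of F_* L at e becomes the group of
homotopy classes of morphisms from F^* h^e to the shift of L by p. -/
theorem exists_represents {p r : ℤ} (h : p + 1 = r) {φ : (coindOne F L).X e p}
    (hφ : (coindOne F L).d h φ = 0) : ∃ g : repRes F e ⟶ sh p L, Represents φ g := by
  have hd : ∀ (x : D.Obj) (q q' n n' : ℤ) (hq : q + 1 = q') (hn : n + 1 = n') (h2 : p + q = n + 0)
      (h3 : p + q' = n' + 0) (f : E.Hom (F.obj x) e q),
      coindOneEv F L x h3 φ (E.d hq f) = koszulSign k p • L.d hn (coindOneEv F L x h2 φ f) := by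
    intro x q q' n n' hq hn h2 h3 f
    have := coindEv_d h φ PUnit.unit x hq hn (by omega) h2 h3 f
    rw [hφ, map_zero, LinearMap.zero_apply, koszulSign_zero, one_smul, eq_comm, sub_eq_zero] at this
    rw [this, smul_smul, koszulSign_mul_self, one_smul]
  refine ⟨Hom.mk (fun x q => shIn p L x (by omega : q + p = q + p) ∘ₗ
    coindOneEv F L x (by omega) φ) ?_ ?_, ?_⟩
  · intro x q q' hq f
    refine (congrArg (shIn p L x (rfl : q' + p = q' + p)) (hd x q q' (q + p) (q' + p) hq (by omega) (by omega)
      (by omega) f)).trans ?_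
    rw [map_smul]
    exact (shIn_d x hq rfl rfl (by omega) _).symm
  · intro y x q r qr hqr f w
    exact (congrArg (shIn p L y (rfl : qr + p = qr + p)) (coindEv_comp (n := q + p) φ PUnit.unit
      (by omega) hqr (by omega) (by omega) f w)).trans (shIn_act hqr rfl rfl _ _ _).symm
  · intro x q n hn f
    obtain rfl : n = q + p := by omega
    rfl

theorem exists_cocycle {p r : ℤ} (h : p + 1 = r) (g : repRes F e ⟶ sh p L) :
    ∃ φ : (coindOne F L).X e p, (coindOne F L).d h φ = 0 ∧ Represents φ g := by
  refine ⟨coindOneMk (fun x q n h => shApp g x h)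
    (fun x y q r qr n n' h hqr h' hn f w => shApp_act g h hqr h' hn f w), ?_, ?_⟩
  · refine coind_ext fun t x q n hn f => ?_
    rw [coindEv_d h _ t x rfl (sub_add_cancel n 1) hn (by omega) (by omega)]
    refine (congrArg₂ (fun y z => koszulSign k 0 • L.d _ y - koszulSign k p • z)
      (coindOneEv_mk _ _ x (by omega : p + q = n - 1 + 0) f) (coindOneEv_mk _ _ x _ _)).trans ?_
    rw [shApp_d g x rfl (sub_add_cancel n 1) (by omega), smul_smul, koszulSign_mul_self, koszulSign_zero,
      sub_self, map_zero, LinearMap.zero_apply]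
  · intro x q n hn f
    exact coindOneEv_mk _ _ x _ f

/-- A null-homotopy, multiplied by `(-1)^p` to remove the sign in the differential of the shift, is
an element of degree `p - 1` of the coinduced module. -/
theorem Represents.exists_eq_d {p q : ℤ} (h : q + 1 = p) {φ : (coindOne F L).X e p}
    {g : repRes F e ⟶ sh p L} (hφ : Represents φ g) (hg : IsNullHomotopic g) :
    ∃ ψ : (coindOne F L).X e q, φ = (coindOne F L).d h ψ := by
  obtain ⟨s, hs⟩ := hg
  let β : ∀ (x : D.Obj) (m n : ℤ), q + m = n + 0 → E.Hom (F.obj x) e m →ₗ[k] L.X x n :=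
    fun x m n h' => koszulSign k p • (shOut p L x (by omega : (m - 1) + p = n) ∘ₗ
      s.app x (sub_add_cancel m 1))
  have hβ : ∀ (x : D.Obj) (m n m' : ℤ) (h' : q + m = n + 0) (hm : m' + 1 = m)
      (f : E.Hom (F.obj x) e m), β x m n h' f =
        koszulSign k p • shOut p L x (by omega : m' + p = n) (s.app x hm f) := by
    intro x m n m' h' hm f
    obtain rfl : m' = m - 1 := by omega
    rfl
  refine ⟨coindOneMk β ?_, ?_⟩
  · intro x y m r mr n n' h1 hqr h2 hn f w
    rw [hβ y mr n' (m - 1 + r) h2 (by omega), hβ x m n (m - 1) h1 (by omega), map_smul,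
      LinearMap.smul_apply]
    refine congrArg (koszulSign k p • ·) ?_
    refine (congrArg (shOut p L y _) (s.app_act hqr (sub_add_cancel m 1) _ rfl f w)).trans ?_
    exact shOut_act _ _ _ hn _ _
  · refine coind_ext fun t x m n hn f => ?_
    rw [coindEv_d h _ t x rfl (sub_add_cancel n 1) hn (by omega) (by omega)]
    refine Eq.trans ?_ (congrArg₂ (fun y z => koszulSign k 0 • L.d (sub_add_cancel n 1) y -
      koszulSign k q • z) (coindOneEv_mk _ _ x (by omega : q + m = n - 1 + 0) f)
        (coindOneEv_mk _ _ x (by omega : q + (m + 1) = n + 0) _)).symm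
    rw [hβ x m (n - 1) (m - 1) (by omega) (by omega), hβ x (m + 1) n m (by omega) rfl]
    refine (hφ x m n hn f).trans ?_
    have e1 := congrArg (shOut p L x (by omega : m + p = n)) (hs x (sub_add_cancel m 1) rfl f)
    rw [map_add, shOut_d x (sub_add_cancel m 1) (by omega) _ (sub_add_cancel n 1)] at e1
    refine Eq.trans e1 ?_
    rw [koszulSign_zero, one_smul, map_smul, koszulSign_of_succ h, neg_smul, neg_smul, smul_neg,
      smul_smul, koszulSign_mul_self, one_smul, sub_neg_eq_add]
    rfl

/-- The same dictionary in the other direction: a primitive, with the sign `(-1)^p`, is a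
null-homotopy. -/
theorem Represents.isNullHomotopic {p q : ℤ} (h : q + 1 = p) {ψ : (coindOne F L).X e q}
    {g : repRes F e ⟶ sh p L} (hg : Represents ((coindOne F L).d h ψ) g) : IsNullHomotopic g := by
  refine ⟨⟨fun x n n' hn => koszulSign k p • (shIn p L x (rfl : n' + p = n' + p) ∘ₗ
    coindOneEv F L x (by omega : q + n = n' + p + 0) ψ), ?_⟩, ?_⟩
  · intro y x m r mr m' mr' hr hm hmr hr' f w
    have e := (congrArg (shIn p L y (rfl : mr' + p = mr' + p)) (coindEv_comp (n := m' + p) ψ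
      PUnit.unit (by omega) hr (by omega : q + mr = mr' + p + 0) (by omega) f w)).trans
        (shIn_act hr' rfl rfl _ _ _).symm
    exact (congrArg (fun z : (sh p L).X y mr' => koszulSign k p • z) e).trans
      (LinearMap.map_smul₂ ((sh p L).act hr') _ _ _).symm
  · intro x m m' m'' hm hm'' f
    have e := hg x m (m + p) (by omega) f
    have e' := coindEv_d h ψ PUnit.unit x (n := m' + p) hm'' (by omega) (by omega)
      (by omega) (by omega : q + m'' = m + p + 0) f
    rw [koszulSign_zero, one_smul] at e'
    have e2 := congrArg (shIn p L x (rfl : m + p = m + p)) (e.symm.trans e')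
    refine (shIn_out x rfl _).symm.trans (e2.trans ?_)
    have e3 : (sh p L).d hm (koszulSign k p • shIn p L x (rfl : m' + p = m' + p)
        (coindOneEv F L x (by omega) ψ f)) = shIn p L x (rfl : m + p = m + p)
          (L.d (by omega) (coindOneEv F L x (by omega : q + m = m' + p + 0) ψ f)) := by
      rw [map_smul, shIn_d x hm rfl rfl (by omega), smul_smul, koszulSign_mul_self, one_smul]
    refine Eq.trans ?_ (congrArg (· + koszulSign k p • shIn p L x (rfl : m + p = m + p)
      (coindOneEv F L x (by omega) ψ (E.d hm'' f))) e3).symm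
    rw [map_sub, map_smul, koszulSign_of_succ h, neg_smul, sub_eq_add_neg]

end Cocycles

/-! ### Direct sums of morphisms -/

section DsumMap

variable {A : DGCat.{u} k} {J : Type u} {N N' : J → DGModule A} (v : ∀ j, N j ⟶ N' j)

/-- The direct sum of a family of morphisms. -/
def dsumMap : dsum N ⟶ dsum N' :=
  Hom.mk (fun a p => DFinsupp.mapRange.linearMap fun j => (v j).app a p)
    (fun h _ => DFinsupp.ext fun j => (v j).app_d h _)
    (fun h _ x => DFinsupp.ext fun j => (v j).app_act h _ x)

theorem dsumMap_proj (j : J) : dsumMap v ≫ dsumProj N' j = dsumProj N j ≫ v j := rfl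

theorem dsumIncl_map (j : J) : dsumIncl N j ≫ dsumMap v = v j ≫ dsumIncl N' j := by
  refine Hom.ext ?_
  funext a p
  refine LinearMap.ext fun x => dsum_ext fun i => ?_
  show (v i).app a p ((dsumProj N i).app a p (dsumSingle N j a p x)) =
    (dsumProj N' i).app a p (dsumSingle N' j a p ((v j).app a p x))
  by_cases hi : i = j
  · subst hi
    rw [dsumProj_single_self, dsumProj_single_self]
  · rw [dsumProj_single_of_ne hi, dsumProj_single_of_ne hi, map_zero]

/-- The linear maps underlying `fibDsum`. -/
def fibDsumApp (a : A.Obj) (p : ℤ) :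
    (fib (dsumMap v)).X a p →ₗ[k] (dsum fun j => fib (v j)).X a p where
  toFun x := DFinsupp.zipWith (β := fun j => (fib (v j)).X a p) (β₁ := fun j => (N j).X a p)
    (β₂ := fun j => (N' j).X a (p - 1)) (fun _ m n => (m, n)) (fun _ => rfl) x.1 x.2
  map_add' _ _ := DFinsupp.ext fun _ => rfl
  map_smul' _ _ := DFinsupp.ext fun _ => rfl

theorem fibDsumApp_fibMk (a : A.Obj) {p q : ℤ} (h : q + 1 = p) (m : (dsum N).X a p)
    (n : (dsum N').X a q) (j : J) :
    (dsumProj (fun j => fib (v j)) j).app a p (fibDsumApp v a p (fibMk (dsumMap v) a h m n)) =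
      fibMk (v j) a h ((dsumProj N j).app a p m) ((dsumProj N' j).app a q n) := by
  obtain rfl : q = p - 1 := by omega
  rfl

/-- The morphism from the homotopy fibre of a direct sum to the direct sum of the homotopy
fibres. -/
def fibDsum : fib (dsumMap v) ⟶ dsum fun j => fib (v j) :=
  Hom.mk (fibDsumApp v)
    (fun {a p q} h x => by
      obtain ⟨m, n, rfl⟩ := exists_eq_fibMk (sub_add_cancel p 1) x
      refine dsum_ext fun j => ?_
      rw [d_fibMk _ h, fibDsumApp_fibMk, (dsumProj (fun j => fib (v j)) j).app_d,
        fibDsumApp_fibMk, d_fibMk _ h,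
        map_sub, (dsumProj N j).app_d, (dsumProj N' j).app_d]
      rfl)
    (fun {a b p q n} h x y => by
      obtain ⟨m, m', rfl⟩ := exists_eq_fibMk (sub_add_cancel p 1) x
      refine dsum_ext fun j => ?_
      rw [act_fibMk _ h (sub_add_cancel n 1) (by omega), fibDsumApp_fibMk,
        (dsumProj (fun j => fib (v j)) j).app_act, fibDsumApp_fibMk,
        act_fibMk _ h (sub_add_cancel n 1) (by omega), (dsumProj N j).app_act,
        (dsumProj N' j).app_act])

theorem fibDsum_map : fibDsum v ≫ dsumMap (fun j => fibFst (v j)) = fibFst (dsumMap v) := by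
  refine Hom.ext ?_
  funext a p
  exact LinearMap.ext fun x => DFinsupp.ext fun j => rfl

end DsumMap

/-! ### Coinduction and direct sums -/

section CoindSum

variable (F : DGFunctor D E) {J : Type u} {I : J → DGModule D} {I' : DGModule D}
  (w : dsum I ⟶ I')

/-- The comparison of the direct sum of coinduced modules with the module coinduced from a
resolution of the direct sum. -/
def coindSum : dsum (fun j => coindOne F (I j)) ⟶ coindOne F I' :=
  dsumDesc fun j => coindMap F (dsumIncl I j ≫ w)

variable {F}

theorem incl_coindSum (e : E.Obj) (p : ℤ) (j : J) (φ : (coindOne F (I j)).X e p) :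
    (coindSum F w).app e p ((dsumIncl (fun j => coindOne F (I j)) j).app e p φ) =
      (coindMap F (dsumIncl I j ≫ w)).app e p φ :=
  congrArg (fun f => Hom.app f e p φ)
    (dsumIncl_desc (fun j => coindMap F (dsumIncl I j ≫ w)) j)

theorem dsum_eq_sum {A : DGCat.{u} k} {N : J → DGModule A} {a : A.Obj} {p : ℤ}
    (x : (dsum N).X a p) : ∃ S : Finset J,
      x = ∑ j ∈ S, (dsumIncl N j).app a p ((dsumProj N j).app a p x) := by
  classical
  refine ⟨DFinsupp.support (β := fun j => (N j).X a p) x, dsum_ext fun i => ?_⟩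
  rw [map_sum]
  by_cases hi : (dsumProj N i).app a p x = 0
  · rw [hi]
    refine (Finset.sum_eq_zero fun j _ => ?_).symm
    by_cases hij : i = j
    · subst hij
      rw [hi, map_zero, map_zero]
    · exact dsumProj_single_of_ne hij a p _
  · refine Eq.trans ?_ (Finset.sum_eq_single_of_mem i
      ((DFinsupp.mem_support_iff (β := fun j => (N j).X a p)).2 hi)
      fun j _ hj => dsumProj_single_of_ne hj.symm a p _).symm
    exact (dsumProj_single_self i a p _).symm

/-- If the restrictions of the representable modules are perfect, then coinduction of K-injective
modules commutes with direct sums up to quasi-isomorphism. -/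
theorem isQuasiIso_coindSum (hF : ∀ e : E.Obj, (repRes F e).IsPerfect)
    (hI : ∀ j, (I j).IsKInj) (hI' : I'.IsKInj) (hw : IsQuasiIso w) :
    IsQuasiIso (coindSum F w) where
  surj e p q r hq hr φ hφ := by
    -- The cohomology class becomes a morphism from F^* h^e to the shift of I', that is, to the
    -- shift of the direct sum of the I_j in the derived category; perfection leaves finitely many
    -- components `y j`.
    obtain ⟨g, hg⟩ := exists_represents hr hφ
    have h1 := (hw.sh (c := p)).isIso_toD
    have h2 := (isQuasiIso_shDsum (c := p) I).isIso_toD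
    obtain ⟨S, hS⟩ := exists_finset_of_mem_finHom (isPerfect_iff.1 (hF e) J (fun j => sh p (I j))
      ((toD D).map g ≫ inv ((toD D).map (shMap p w)) ≫ (toD D).map (shDsum I p)))
    choose y hy using fun j => exists_toD_map_eq (hI j).sh
      ((toD D).map g ≫ inv ((toD D).map (shMap p w)) ≫ (toD D).map (shMap p (dsumProj I j)))
    -- The finite decomposition in the derived category is a homotopy of morphisms of modules,
    -- because the shift of `I'` is K-injective.
    have hnull : IsNullHomotopic (g - ∑ j ∈ S, y j ≫ shMap p (dsumIncl I j ≫ w)) := by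
      refine isNullHomotopic_of_toD_map_eq_zero hI'.sh ?_
      rw [Functor.map_sub, Functor.map_sum, sub_eq_zero]
      have e1 := congrArg (· ≫ inv ((toD D).map (shDsum I p)) ≫ (toD D).map (shMap p w)) hS
      simp only [Category.assoc, IsIso.hom_inv_id_assoc, IsIso.inv_hom_id, Category.comp_id,
        Preadditive.sum_comp] at e1
      rw [e1]
      refine Finset.sum_congr rfl fun j _ => ?_
      have e2 : (toD D).map (dsumIncl (fun j => sh p (I j)) j) ≫ inv ((toD D).map (shDsum I p)) =
          (toD D).map (shMap p (dsumIncl I j)) := by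
        rw [← dsumIncl_shDsum, Functor.map_comp, Category.assoc, IsIso.hom_inv_id, Category.comp_id]
      have e3 : (toD D).map (shDsum I p) ≫ (toD D).map (dsumProj (fun j => sh p (I j)) j) =
          (toD D).map (shMap p (dsumProj I j)) := by
        rw [← Functor.map_comp, shDsum_proj]
      rw [(toD D).map_comp (y j), hy, shMap_comp, (toD D).map_comp (shMap p _), ← e2, ← e3,
        (toD D).map_comp (dsumProj _ j)]
      simp only [Category.assoc]
    choose ψ hψ hψ' using fun j => exists_cocycle (F := F) hr (y j)
    -- Translated back into cocycles, `φ` is cohomologous to the image of the finite sum of the `ψ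
    -- j`.
    obtain ⟨z, hz⟩ := (hg.sub (Represents.sum S fun j _ =>
      (hψ' j).comp (dsumIncl I j ≫ w))).exists_eq_d hq hnull
    refine ⟨∑ j ∈ S, (dsumIncl (fun j => coindOne F (I j)) j).app e p (ψ j), z, ?_, ?_⟩
    · rw [map_sum]
      refine Finset.sum_eq_zero fun j _ => ?_
      rw [← (dsumIncl _ j).app_d, hψ, map_zero]
    · rw [← hz, map_sum]
      simp only [incl_coindSum]
      abel
  inj e p q r hq hr x z hx h := by
    have h1 := (hw.sh (c := p)).isIso_toD
    obtain ⟨S, hS⟩ := dsum_eq_sum x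
    have hc : ∀ j, (coindOne F (I j)).d hr
        ((dsumProj (fun j => coindOne F (I j)) j).app e p x) = 0 := fun j => by
      rw [← (dsumProj (fun j => coindOne F (I j)) j).app_d, hx, map_zero]
    choose y hy using fun j => exists_represents hr (hc j)
    have h2 : IsNullHomotopic (∑ j ∈ S, y j ≫ shMap p (dsumIncl I j ≫ w)) := by
      refine Represents.isNullHomotopic (ψ := z) hq ?_
      rw [← h, hS, map_sum]
      simp only [incl_coindSum]
      exact Represents.sum S fun j _ => (hy j).comp _
    -- The morphism induced by `w` is invertible in the derived category, so it may be cancelled;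
    -- this leaves an identity in the shifted direct sum that can be projected to each summand.
    have h3 : ∑ j ∈ S, (toD D).map (y j ≫ shMap p (dsumIncl I j)) = 0 := by
      rw [← cancel_mono ((toD D).map (shMap p w)), zero_comp, Preadditive.sum_comp,
        ← toD_map_eq_zero h2, Functor.map_sum]
      refine Finset.sum_congr rfl fun j _ => ?_
      rw [← Functor.map_comp, Category.assoc, shMap_comp]
    -- The condition `j ∈ S` is placed inside the statement so that a primitive can be chosen for
    -- every index; zero serves outside `S`.
    have h4 : ∀ j, ∃ ψ : (coindOne F (I j)).X e q, j ∈ S →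
        (dsumProj (fun j => coindOne F (I j)) j).app e p x = (coindOne F (I j)).d hq ψ := by
      intro j
      by_cases hj : j ∈ S
      · obtain ⟨ψ, hψ⟩ := (hy j).exists_eq_d hq (isNullHomotopic_of_toD_map_eq_zero (hI j).sh (by
          have e := congrArg (· ≫ (toD D).map (shMap p (dsumProj I j))) h3
          simp only [zero_comp, Preadditive.sum_comp] at e
          rw [Finset.sum_eq_single_of_mem j hj, ← Functor.map_comp, Category.assoc, ← shMap_comp,
            dsumIncl_proj_self] at e
          · exact e
          · intro i _ hi
            rw [← Functor.map_comp, Category.assoc, ← shMap_comp, dsumIncl_proj_of_ne I hi.symm]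
            exact ((toD D).map_comp _ _).trans ((congrArg ((toD D).map (y i) ≫ ·)
              ((congrArg (toD D).map (Hom.ext rfl : shMap p (0 : I i ⟶ I j) = 0)).trans
                (Functor.map_zero _ _ _))).trans comp_zero)))
        exact ⟨ψ, fun _ => hψ⟩
      · exact ⟨0, fun h => absurd h hj⟩
    choose ψ hψ using h4
    refine ⟨∑ j ∈ S, (dsumIncl (fun j => coindOne F (I j)) j).app e q (ψ j), ?_⟩
    rw [map_sum]
    refine hS.trans (Finset.sum_congr rfl fun j hj => ?_)
    rw [hψ j hj, (dsumIncl (fun j => coindOne F (I j)) j).app_d]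

theorem toCoind_sum {M : DGModule E} {L : DGModule D} (S : Finset J)
    (b : J → (M.restrict F ⟶ L)) : toCoind F (∑ j ∈ S, b j) = ∑ j ∈ S, toCoind F (b j) :=
  map_sum (AddMonoidHom.ofMapSub (toCoind F (M := M) (L := L)) (toCoind_sub F)) b S

/-- Up to quasi-isomorphism the target is F_* I', with I' a K-injective resolution of the sum of the
I_j. The adjoint morphism goes from F^* M to that sum; perfection of F^* M makes it finite, and the
adjoints of the pieces are morphisms from M to the F_* I_j. -/
theorem IsPerfect.mem_finHom_coindOne (hF : ∀ e : E.Obj, (repRes F e).IsPerfect) {M : DGModule E}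
    (hM : (M.restrict F).IsPerfect) (hI : ∀ j, (I j).IsKInj)
    (f : (toD E).obj M ⟶ (toD E).obj (dsum fun j => coindOne F (I j))) : f ∈ finHom M _ := by
  obtain ⟨I', w, hI', hw⟩ := exists_isKInj_resolution (dsum I)
  have := (isQuasiIso_coindSum w hF hI hI' hw).isIso_toD
  have := hw.isIso_toD
  obtain ⟨g, hg⟩ := exists_toD_map_eq (hI'.coindOne F) (f ≫ (toD E).map (coindSum F w))
  obtain ⟨b, rfl⟩ : ∃ b : M.restrict F ⟶ I', toCoind F b = g := ⟨_, counit_toCoind F g⟩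
  obtain ⟨S, hS⟩ := exists_finset_of_mem_finHom
    (isPerfect_iff.1 hM J I ((toD D).map b ≫ inv ((toD D).map w)))
  choose y hy using fun j => exists_toD_map_eq (hI j)
    ((toD D).map b ≫ inv ((toD D).map w) ≫ (toD D).map (dsumProj I j))
  have hb : IsNullHomotopic (b - ∑ j ∈ S, y j ≫ dsumIncl I j ≫ w) := by
    refine isNullHomotopic_of_toD_map_eq_zero hI' ?_
    rw [Functor.map_sub, Functor.map_sum, sub_eq_zero]
    have e1 := congrArg (· ≫ (toD D).map w) hS
    simp only [Category.assoc, IsIso.inv_hom_id, Category.comp_id, Preadditive.sum_comp] at e1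
    rw [e1]
    refine Finset.sum_congr rfl fun j _ => ?_
    simp only [Functor.map_comp, hy, Category.assoc]
  have hg' : f ≫ (toD E).map (coindSum F w) =
      ∑ j ∈ S, ((toD E).map (toCoind F (y j)) ≫ (toD E).map (dsumIncl (fun j => coindOne F (I j)) j)) ≫
        (toD E).map (coindSum F w) := by
    have h1 := hb.toCoind F
    rw [toCoind_sub, toCoind_sum] at h1
    rw [← hg, toD_map_congr h1, Functor.map_sum]
    refine Finset.sum_congr rfl fun j _ => ?_
    rw [toCoind_comp, Category.assoc, ← Functor.map_comp, ← Functor.map_comp]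
    congr 2
    exact (dsumIncl_desc (fun j => coindMap F (dsumIncl I j ≫ w)) j).symm
  rw [← Preadditive.sum_comp, cancel_mono] at hg'
  rw [hg']
  exact AddSubgroup.sum_mem _ fun j _ => comp_dsumIncl_mem_finHom j _

/-- Restriction preserves perfect modules if it preserves those that are representable. -/
theorem IsPerfect.restrict (hF : ∀ e : E.Obj, (repRes F e).IsPerfect) {M : DGModule E}
    (hM : M.IsPerfect) : (M.restrict F).IsPerfect := by
  refine isPerfect_iff.2 fun J N f => ?_
  choose I ι hI hι using fun j => exists_isKInj_resolution (N j)
  have hι' : ∀ j, IsIso ((toD D).map (ι j)) := fun j => (hι j).isIso_toD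
  obtain ⟨I', w, hI', hw⟩ := exists_isKInj_resolution (dsum I)
  have hiso := (isQuasiIso_coindSum w hF hI hI' hw).isIso_toD
  have hiso' := hw.isIso_toD
  -- The summands are replaced by K-injective ones. Only `e ≫ e' = 1` is needed to return to `N`.
  obtain ⟨e, he⟩ := exists_dsum_desc (N := N) fun j =>
    (toD D).map (ι j) ≫ (toD D).map (dsumIncl I j)
  obtain ⟨e', he'⟩ := exists_dsum_desc (N := I) fun j =>
    inv ((toD D).map (ι j)) ≫ (toD D).map (dsumIncl N j)
  have hee : e ≫ e' = 𝟙 _ := by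
    rw [← sub_eq_zero]
    refine eq_zero_of_dsumIncl_comp fun j => ?_
    rw [Preadditive.comp_sub, Category.comp_id, ← Category.assoc, he, Category.assoc, he',
      IsIso.hom_inv_id_assoc, sub_self]
  suffices h : f ≫ e ∈ finHom _ I by
    rw [← Category.comp_id f, ← hee, ← Category.assoc]
    exact comp_mem_finHom_of_incl e' (fun j => ⟨_, he' j⟩) h
  -- Here F_* preserves direct sums: the adjoint of `b` goes from the perfect module `M` to F_* I',
  -- which is the sum of the F_* I_j in the derived category.
  obtain ⟨b, hb⟩ := exists_toD_map_eq hI' ((f ≫ e) ≫ (toD D).map w)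
  obtain ⟨S, hS⟩ := exists_finset_of_mem_finHom (isPerfect_iff.1 hM J (fun j => coindOne F (I j))
    ((toD E).map (toCoind F b) ≫ inv ((toD E).map (coindSum F w))))
  choose y hy using fun j => exists_toD_map_eq ((hI j).coindOne F)
    ((toD E).map (toCoind F b) ≫ inv ((toD E).map (coindSum F w)) ≫ (toD E).map (dsumProj _ j))
  have hg : IsNullHomotopic (toCoind F b - ∑ j ∈ S, y j ≫ coindMap F (dsumIncl I j ≫ w)) := by
    refine isNullHomotopic_of_toD_map_eq_zero (hI'.coindOne F) ?_
    rw [Functor.map_sub, Functor.map_sum, sub_eq_zero]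
    have e1 := congrArg (· ≫ (toD E).map (coindSum F w)) hS
    simp only [Category.assoc, IsIso.inv_hom_id, Category.comp_id, Preadditive.sum_comp] at e1
    rw [e1]
    refine Finset.sum_congr rfl fun j _ => ?_
    rw [(toD E).map_comp (y j), hy, ← dsumIncl_desc (fun j => coindMap F (dsumIncl I j ≫ w)) j,
      (toD E).map_comp (dsumIncl _ j), (toD E).map_comp (dsumProj _ j)]
    simp only [Category.assoc]
    rfl
  -- The finite decomposition of the adjoint is carried back by the counit, which respects
  -- homotopies.
  have hb' : IsNullHomotopic (b - ∑ j ∈ S, (restrictMap F (y j) ≫ coindCounit F (I j)) ≫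
      dsumIncl I j ≫ w) := by
    have e1 : ∑ j ∈ S, y j ≫ coindMap F (dsumIncl I j ≫ w) =
        toCoind F (∑ j ∈ S, (restrictMap F (y j) ≫ coindCounit F (I j)) ≫ dsumIncl I j ≫ w) := by
      rw [toCoind_sum]
      refine Finset.sum_congr rfl fun j _ => ?_
      rw [toCoind_comp, counit_toCoind]
    rw [e1, ← toCoind_sub] at hg
    rw [← toCoind_counit F (b - _)]
    exact IsNullHomotopic.comp_right _ (hg.restrict F)
  have hfe : f ≫ e = ∑ j ∈ S, (toD D).map (restrictMap F (y j) ≫ coindCounit F (I j)) ≫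
      (toD D).map (dsumIncl I j) := by
    rw [← cancel_mono ((toD D).map w), ← hb, toD_map_congr hb', Preadditive.sum_comp,
      Functor.map_sum]
    refine Finset.sum_congr rfl fun j _ => ?_
    rw [(toD D).map_comp _ (dsumIncl I j ≫ w), (toD D).map_comp (dsumIncl I j), Category.assoc]
  rw [hfe]
  exact AddSubgroup.sum_mem _ fun j _ => comp_dsumIncl_mem_finHom j _

/-- If the restrictions of `M` and of the representable modules are perfect, then the morphisms
from `M` to a direct sum factor through a finite direct sum if this holds for the homotopy fibres
of morphisms to coinduced modules. -/
theorem IsPerfect.mem_finHom_of_fib (hF : ∀ e : E.Obj, (repRes F e).IsPerfect) {M : DGModule E}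
    (hM : (M.restrict F).IsPerfect) (hI : ∀ j, (I j).IsKInj) {N : J → DGModule E}
    (b : ∀ j, (N j).restrict F ⟶ I j)
    (H : ∀ f : (toD E).obj M ⟶ (toD E).obj (dsum fun j => fib (toCoind F (b j))), f ∈ finHom M _)
    (f : (toD E).obj M ⟶ (toD E).obj (dsum N)) : f ∈ finHom M N := by
  -- The composite with the sum of the maps from N_j to F_* I_j is supported on a finite set `S`.
  obtain ⟨S, hS⟩ := exists_finset_of_mem_finHom
    (IsPerfect.mem_finHom_coindOne hF hM hI (f ≫ (toD E).map (dsumMap fun j => toCoind F (b j))))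
  -- Hence `f` minus its truncation to `S` dies in the sum of the F_* I_j and lifts to the fibre,
  -- where `H` applies; the truncation itself is a finite sum by construction.
  obtain ⟨h, hh⟩ := exists_comp_fibFst_eq (dsumMap fun j => toCoind F (b j))
    (f - ∑ j ∈ S, f ≫ (toD E).map (dsumProj N j ≫ dsumIncl N j)) (by
      rw [Preadditive.sub_comp, Preadditive.sum_comp, sub_eq_zero, hS]
      refine Finset.sum_congr rfl fun j _ => ?_
      rw [Category.assoc, Category.assoc, ← Functor.map_comp, ← Functor.map_comp, ← Category.assoc,
        dsumMap_proj, Category.assoc, Category.assoc, dsumIncl_map])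
  have h1 : h ≫ (toD E).map (fibDsum fun j => toCoind F (b j)) ≫
      (toD E).map (dsumMap fun j => fibFst (toCoind F (b j))) ∈ finHom M N := by
    rw [← Category.assoc]
    refine comp_mem_finHom_of_incl _ (fun j => ⟨(toD E).map (fibFst (toCoind F (b j))), ?_⟩) (H _)
    rw [← Functor.map_comp, ← Functor.map_comp, dsumIncl_map]
  rw [← Functor.map_comp, fibDsum_map, hh] at h1
  rw [← sub_add_cancel f (∑ j ∈ S, f ≫ (toD E).map (dsumProj N j ≫ dsumIncl N j))]
  refine add_mem h1 (AddSubgroup.sum_mem _ fun j _ => ?_)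
  rw [Functor.map_comp, ← Category.assoc]
  exact comp_dsumIncl_mem_finHom j _

end CoindSum

end DGModule

end

/-! ### Exterior products of modules over two dg categories. -/

noncomputable section

namespace DGModule


variable {k : Type u} [Field k] {A B : DGCat.{u} k}

/-! ### Exterior products of dg modules -/

theorem gtensor_hom_ext {V W : ℤ → Type u} [∀ n, AddCommGroup (V n)] [∀ n, Module k (V n)]
    [∀ n, AddCommGroup (W n)] [∀ n, Module k (W n)] {n : ℤ} {U : Type u} [AddCommGroup U]
    [Module k U] {f g : GTensor k V W n →ₗ[k] U}
    (h : ∀ (p q : ℤ) (h : p + q = n) (v : V p) (w : W q),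
      f (GTensor.mk h v w) = g (GTensor.mk h v w)) : f = g := by
  refine LinearMap.ext fun x => ?_
  induction x using GTensor.induction with
  | hmk p q h' v w => exact h p q h' v w
  | hadd x y hx hy => rw [map_add, map_add, hx, hy]

section Box

variable (X : DGModule A) (Y : DGModule B)

/-- The differential of the exterior product. -/
def boxD (x : A.Obj × B.Obj) {n n' : ℤ} (hn : n + 1 = n') :
    GTensor k (X.X x.1) (Y.X x.2) n →ₗ[k] GTensor k (X.X x.1) (Y.X x.2) n' :=
  GTensor.lift fun p q h =>
    (GTensor.mk (by omega : (p + 1) + q = n')).comp (X.d rfl) +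
      koszulSign k p • (GTensor.mk (by omega : p + (q + 1) = n')).compl₂ (Y.d rfl)

theorem boxD_mk (x : A.Obj × B.Obj) {n n' p q p' q' : ℤ}
    (hn : n + 1 = n') (h : p + q = n) (hp : p + 1 = p') (hq : q + 1 = q')
    (h₁ : p' + q = n') (h₂ : p + q' = n') (m : X.X x.1 p) (b : Y.X x.2 q) :
    boxD X Y x hn (GTensor.mk h m b) =
      GTensor.mk h₁ (X.d hp m) b + koszulSign k p • GTensor.mk h₂ m (Y.d hq b) := by
  subst hp hq
  simp [boxD, GTensor.lift_mk]

/-- The action on the exterior product. -/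
def boxAct (x y : A.Obj × B.Obj) {m n l : ℤ} (hl : m + n = l) :
    GTensor k (X.X y.1) (Y.X y.2) m →ₗ[k] GTensor k (A.Hom x.1 y.1) (B.Hom x.2 y.2) n →ₗ[k]
      GTensor k (X.X x.1) (Y.X x.2) l :=
  GTensor.lift fun p q h => LinearMap.mk₂ k
    (fun f g => GTensor.lift fun p' q' h' => koszulSign k (q * p') •
      (GTensor.mk (by omega : (p + p') + (q + q') = l)).compl₁₂ (X.act rfl f) (Y.act rfl g))
    (fun _ _ _ => gtensor_hom_ext fun _ _ _ _ _ => by simp [GTensor.lift_mk])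
    (fun c _ _ => gtensor_hom_ext fun _ _ _ _ _ => by simp [GTensor.lift_mk, smul_comm c])
    (fun _ _ _ => gtensor_hom_ext fun _ _ _ _ _ => by simp [GTensor.lift_mk])
    (fun c _ _ => gtensor_hom_ext fun _ _ _ _ _ => by simp [GTensor.lift_mk, smul_comm c])

theorem boxAct_mk (x y : A.Obj × B.Obj) {m n l p q p' q' p'' q'' : ℤ} (hl : m + n = l)
    (h : p + q = m) (h' : p' + q' = n) (hp : p + p' = p'') (hq : q + q' = q'')
    (h'' : p'' + q'' = l) (v : X.X y.1 p) (w : Y.X y.2 q) (f : A.Hom x.1 y.1 p')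
    (g : B.Hom x.2 y.2 q') :
    boxAct X Y x y hl (GTensor.mk h v w) (GTensor.mk h' f g) =
      koszulSign k (q * p') • GTensor.mk h'' (X.act hp v f) (Y.act hq w g) := by
  subst hp hq
  simp [boxAct, GTensor.lift_mk]

/-- The exterior product `X ⊠ Y`, with
`(v ⊗ w) · (f ⊗ g) = (-1)^{|w||f|} (v · f) ⊗ (w · g)`. -/
def box : DGModule (A.tensor B) where
  X x n := GTensor k (X.X x.1) (Y.X x.2) n
  d {x _ _} h := boxD X Y x h
  act {x y _ _ _} h := boxAct X Y x y h
  d_d {x} {n n' n''} hn hn' z := by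
    subst hn hn'
    induction z using GTensor.induction with
    | hmk p q h v w =>
      rw [boxD_mk X Y x _ _ rfl rfl (by omega) (by omega), map_add, map_smul,
        boxD_mk X Y x _ _ rfl rfl (by omega) (by omega),
        boxD_mk X Y x _ _ rfl rfl (by omega) (by omega)]
      simp only [X.d_d, Y.d_d, koszulSign_succ, map_zero, LinearMap.zero_apply, smul_zero,
        zero_add, add_zero]
      rw [neg_smul, neg_add_cancel]
    | hadd x y hx hy => simp only [map_add, hx, hy, add_zero]
  act_id {x} {n} hn z := by
    induction z using GTensor.induction with
    | hmk p q h v w =>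
      rw [boxAct_mk X Y x x hn h _ (add_zero p) (add_zero q) h, X.act_id, Y.act_id]
      simp [koszulSign_zero]
    | hadd x y hx hy => simp only [map_add, LinearMap.add_apply, hx, hy]
  act_act {x y z} {a b c ab bc n} hab hbc hn hn' u f g := by
    induction u using GTensor.induction with
    | hadd x x' hx hx' => simp only [map_add, LinearMap.add_apply, hx, hx']
    | hmk p₁ q₁ h₁ v₁ w₁ =>
      induction f using GTensor.induction with
      | hadd y y' hy hy' => simp only [map_add, LinearMap.add_apply, hy, hy']
      | hmk p₂ q₂ h₂ v₂ w₂ =>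
        induction g using GTensor.induction with
        | hadd z z' hz hz' => simp only [map_add, hz, hz']
        | hmk p₃ q₃ h₃ v₃ w₃ =>
          rw [boxAct_mk X Y y z hab h₁ h₂ rfl rfl (by omega),
            A.tensorComp_mk B x y z hbc h₂ h₃ rfl rfl (by omega)]
          simp only [map_smul, LinearMap.smul_apply]
          rw [boxAct_mk X Y x y hn _ h₃ rfl rfl (by omega),
            boxAct_mk X Y x z hn' h₁ _ (add_assoc p₁ p₂ p₃).symm (add_assoc q₁ q₂ q₃).symm
              (by omega),
            X.act_act rfl rfl rfl (by omega), Y.act_act rfl rfl rfl (by omega),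
            smul_smul, smul_smul, koszulSign_mul, koszulSign_mul]
          congr 2
          ring
  leibniz {x y} {a b n a' b' n'} h hn ha hb h₁ h₂ u z := by
    induction u using GTensor.induction with
    | hadd x x' hx hx' =>
      simp only [map_add, LinearMap.add_apply, smul_add, hx, hx']
      abel
    | hmk p q h₃ v w =>
      induction z using GTensor.induction with
      | hadd y y' hy hy' =>
        simp only [map_add, smul_add, hy, hy']
        abel
      | hmk p' q' h₄ f g =>
        rw [boxAct_mk X Y x y h h₃ h₄ rfl rfl (by omega), map_smul,
          boxD_mk X Y x hn _ rfl rfl (by omega) (by omega),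
          boxD_mk X Y y ha h₃ rfl rfl (by omega) (by omega),
          A.tensorD_mk B x y hb h₄ rfl rfl (by omega) (by omega)]
        simp only [map_add, map_smul, LinearMap.add_apply, LinearMap.smul_apply]
        rw [boxAct_mk X Y x y h₁ _ h₄ (p'' := p + p' + 1) (by omega) rfl (by omega),
          boxAct_mk X Y x y h₁ _ h₄ rfl (q'' := q + q' + 1) (by omega) (by omega),
          boxAct_mk X Y x y h₂ h₃ _ (p'' := p + p' + 1) (by omega) rfl (by omega),
          boxAct_mk X Y x y h₂ h₃ _ rfl (q'' := q + q' + 1) (by omega) (by omega),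
          X.leibniz (n' := p + p' + 1) rfl rfl rfl rfl (by omega) (by omega),
          Y.leibniz (n' := q + q' + 1) rfl rfl rfl rfl (by omega) (by omega)]
        rw [show koszulSign k a = koszulSign k (p + q) from congrArg _ h₃.symm]
        simp only [map_add, map_smul, LinearMap.add_apply, LinearMap.smul_apply, smul_add,
          smul_smul, koszulSign_mul]
        rw [koszulSign_congr (k := k) (m := p + (q + 1) * p') (n := q * p' + (p + p'))
            ⟨0, by ring⟩,
          koszulSign_congr (k := k) (m := p + q + q * (p' + 1)) (n := q * p' + p)
            ⟨q, by ring⟩,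
          koszulSign_congr (k := k) (m := p + q + (p' + q * p')) (n := q * p' + (p + p' + q))
            ⟨0, by ring⟩]
        rw [add_add_add_comm]

/-- The element `v ⊗ w` of the exterior product. -/
def boxMk (x : A.Obj × B.Obj) {p q n : ℤ} (h : p + q = n) :
    X.X x.1 p →ₗ[k] Y.X x.2 q →ₗ[k] (box X Y).X x n :=
  GTensor.mk h

variable {X Y}

theorem d_boxMk (x : A.Obj × B.Obj) {n n' p q p' q' : ℤ}
    (hn : n + 1 = n') (h : p + q = n) (hp : p + 1 = p') (hq : q + 1 = q')
    (h₁ : p' + q = n') (h₂ : p + q' = n') (m : X.X x.1 p) (b : Y.X x.2 q) :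
    (box X Y).d hn (boxMk X Y x h m b) =
      boxMk X Y x h₁ (X.d hp m) b + koszulSign k p • boxMk X Y x h₂ m (Y.d hq b) :=
  boxD_mk X Y x hn h hp hq h₁ h₂ m b

theorem act_boxMk {x y : A.Obj × B.Obj} {m n l p q p' q' p'' q'' : ℤ} (hl : m + n = l)
    (h : p + q = m) (h' : p' + q' = n) (hp : p + p' = p'') (hq : q + q' = q'')
    (h'' : p'' + q'' = l) (v : X.X y.1 p) (w : Y.X y.2 q) (f : A.Hom x.1 y.1 p')
    (g : B.Hom x.2 y.2 q') :
    (box X Y).act (a := x) (b := y) hl (boxMk X Y y h v w) (GTensor.mk h' f g) =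
      koszulSign k (q * p') • boxMk X Y x h'' (X.act hp v f) (Y.act hq w g) :=
  boxAct_mk X Y x y hl h h' hp hq h'' v w f g

theorem box_induction {x : A.Obj × B.Obj} {n : ℤ} {P : (box X Y).X x n → Prop}
    (hmk : ∀ (p q : ℤ) (h : p + q = n) (v : X.X x.1 p) (w : Y.X x.2 q), P (boxMk X Y x h v w))
    (hadd : ∀ x y, P x → P y → P (x + y)) (z : (box X Y).X x n) : P z :=
  GTensor.induction hmk hadd z

/-- Linear maps out of the exterior product. -/
def boxLift {U : Type u} [AddCommGroup U] [Module k U] (x : A.Obj × B.Obj) (n : ℤ)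
    (φ : ∀ p q : ℤ, p + q = n → X.X x.1 p →ₗ[k] Y.X x.2 q →ₗ[k] U) : (box X Y).X x n →ₗ[k] U :=
  GTensor.lift φ

theorem boxLift_mk {U : Type u} [AddCommGroup U] [Module k U] (x : A.Obj × B.Obj) {n : ℤ}
    (φ : ∀ p q : ℤ, p + q = n → X.X x.1 p →ₗ[k] Y.X x.2 q →ₗ[k] U) {p q : ℤ} (h : p + q = n)
    (v : X.X x.1 p) (w : Y.X x.2 q) : boxLift x n φ (boxMk X Y x h v w) = φ p q h v w :=
  GTensor.lift_mk φ h v w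

/-- Acyclic complexes of vector spaces are contractible, and a contraction `σ` of the first factor
gives the contraction `σ ⊗ 1` of the tensor product. -/
theorem IsAcyclicAt.box {x : A.Obj × B.Obj} (hX : X.IsAcyclicAt x.1) :
    (box X Y).IsAcyclicAt x := by
  obtain ⟨σ⟩ := hX.nonempty_contraction
  refine Contraction.isAcyclicAt ⟨fun {n n'} h => boxLift x n fun p q hpq =>
    (boxMk X Y x (by omega : (p - 1) + q = n')) ∘ₗ σ.s (sub_add_cancel p 1), ?_⟩
  intro n n' n'' h h' z
  induction z using box_induction with
  | hadd y z hy hz =>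
    refine Eq.trans ?_ (congrArg₂ (· + ·) hy hz)
    simp only [map_add]
    abel
  | hmk p q hpq v w =>
    rw [boxLift_mk, d_boxMk x h' hpq rfl rfl (by omega) (by omega), map_add, map_smul,
      boxLift_mk, boxLift_mk]
    simp only [LinearMap.comp_apply]
    rw [d_boxMk x h _ (sub_add_cancel p 1) (rfl : q + 1 = q + 1) hpq (by omega)]
    rw [koszulSign_of_succ (sub_add_cancel p 1)]
    have e := σ.eq (sub_add_cancel p 1) rfl v
    have e' : σ.s (sub_add_cancel (p + 1) 1) (X.d rfl v) =
      X.cast x.1 (by omega) (σ.s (rfl : p + 1 = p + 1) (X.d rfl v)) := by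
        have : ∀ (r : ℤ) (hr : r + 1 = p + 1) (hr' : p = r) (y : X.X x.1 (p + 1)),
          σ.s hr y = X.cast x.1 hr' (σ.s rfl y) := by
            intro r hr hr' y; subst hr'; rfl
        exact this _ _ _ _
    have e'' : ∀ (r : ℤ) (hr : p = r) (hr' : r + q = n) (y : X.X x.1 p),
        boxMk X Y x hr' (X.cast x.1 hr y) w = boxMk X Y x hpq y w := by
      intro r hr hr' y; subst hr; rfl
    rw [e', e'']
    have e₃ := congrArg (fun y => boxMk X Y x hpq y w) e
    simp only [map_add, LinearMap.add_apply] at e₃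
    rw [← e₃, neg_smul]
    abel

end Box

end DGModule

end

/-! ### The exterior product with a representable as left adjoint of restriction to a slice. -/

noncomputable section

namespace DGModule


variable {k : Type u} [Field k] {A B : DGCat.{u} k}

/-! ### Slices of a tensor product -/

variable (A B) in
/-- The dg functor `a ↦ (a, y)`. -/
def slice (y : B.Obj) : DGFunctor A (A.tensor B) where
  obj a := (a, y)
  map {_ _ p} := (GTensor.mk (add_zero p)).flip (B.id y)
  map_d {a a' p q} h f := by
    simp only [LinearMap.flip_apply]
    refine Eq.trans ?_ (A.tensorD_mk B (a, y) (a', y) h (add_zero p) h (zero_add 1) (add_zero q) h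
      f (B.id y)).symm
    rw [B.d_id, map_zero, smul_zero, add_zero]
  map_id _ := rfl
  map_comp {a a' a'' p q n} h f g := by
    simp only [LinearMap.flip_apply]
    refine Eq.trans ?_ (A.tensorComp_mk B (a, y) (a', y) (a'', y) h (add_zero p) (add_zero q) h
      (add_zero 0) (add_zero n) f (B.id y) g (B.id y)).symm
    rw [zero_mul, koszulSign_zero, one_smul, B.id_comp]

variable (A B) in
/-- The dg functor `b ↦ (x, b)`. -/
def coslice (x : A.Obj) : DGFunctor B (A.tensor B) where
  obj b := (x, b)
  map {_ _ p} := GTensor.mk (zero_add p) (A.id x)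
  map_d {b b' p q} h f := by
    refine Eq.trans ?_ (A.tensorD_mk B (x, b) (x, b') h (zero_add p) (zero_add 1) h
      ((add_comm 1 p).trans h) (zero_add q) (A.id x) f).symm
    rw [A.d_id, map_zero, LinearMap.zero_apply, zero_add, koszulSign_zero, one_smul]
  map_id _ := rfl
  map_comp {b b' b'' p q n} h f g := by
    refine Eq.trans ?_ (A.tensorComp_mk B (x, b) (x, b') (x, b'') h (zero_add p) (zero_add q)
      (add_zero 0) h (zero_add n) (A.id x) f (A.id x) g).symm
    rw [mul_zero, koszulSign_zero, one_smul, A.id_comp]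

/-- In this order the factorization carries no Koszul sign; with additivity, it reduces linearity
over the tensor product to the morphisms `f ⊗ 1` and `1 ⊗ g`. -/
theorem slice_comp_coslice {a a' : A.Obj} {b b' : B.Obj} {p q n : ℤ} (h : p + q = n)
    (f : A.Hom a a' p) (g : B.Hom b b' q) :
    (A.tensor B).comp (X := (a, b)) (Y := (a, b')) (Z := (a', b')) h ((slice A B b').map f)
      ((coslice A B a).map g) = GTensor.mk h f g := by
  refine (A.tensorComp_mk B (a, b) (a, b') (a', b') h (add_zero p) (zero_add q)
    (add_zero p) (zero_add q) h f (B.id b') (A.id a) g).trans ?_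
  rw [zero_mul, koszulSign_zero, one_smul, A.comp_id, B.id_comp]

/-! ### Extension of maps to exterior products with representables -/

section BoxExt

variable {X : DGModule A} {y : B.Obj} {N : DGModule (A.tensor B)} {c : ℤ}
  (ψ : ∀ (a : A.Obj) {p p' : ℤ}, p' + c = p → X.X a p →ₗ[k] N.X (a, y) p')

variable (A) in
/-- The morphisms `1 ⊗ g`. -/
def corep (a : A.Obj) (b : B.Obj) (q : ℤ) :
    (B.representable y).X b q →ₗ[k] (A.tensor B).Hom (a, b) (a, y) q :=
  (coslice A B a).map (X := b) (Y := y)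

/-- The maps `v ⊗ g ↦ ψ(v) · (1 ⊗ g)`. -/
def boxExt (x : A.Obj × B.Obj) {n n' : ℤ} (h : n' + c = n) :
    (box X (B.representable y)).X x n →ₗ[k] N.X x n' :=
  boxLift x n fun p q hpq =>
    ((N.act (a := x) (b := (x.1, y)) (by omega : (p - c) + q = n')).compl₂
      (corep A x.1 x.2 q)).comp (ψ x.1 (sub_add_cancel p c))

theorem boxExt_mk (x : A.Obj × B.Obj) {n n' p q p' : ℤ} (h : n' + c = n) (hpq : p + q = n)
    (hp : p' + c = p) (h' : p' + q = n') (v : X.X x.1 p) (g : (B.representable y).X x.2 q) :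
    boxExt ψ x h (boxMk X (B.representable y) x hpq v g) =
      N.act (a := x) (b := (x.1, y)) h' (ψ x.1 hp v) (corep A x.1 x.2 q g) := by
  obtain rfl : p' = p - c := by omega
  rw [boxExt, boxLift_mk]
  rfl

/-- Linearity of ψ along the slice suffices, because the morphisms `1 ⊗ g` commute with `f ⊗ 1` up
to the sign built into the exterior product. The degree offset `c` lets one extension serve
morphisms (`c = 0`) and homotopies (`c = 1`). -/
theorem boxExt_act
    (hψ : ∀ {a b : A.Obj} {p q n p' n' : ℤ} (h : p + q = n) (hp : p' + c = p)
      (hn : n' + c = n) (h' : p' + q = n') (m : X.X b p) (f : A.Hom a b q),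
      ψ a hn (X.act h m f) = N.act (a := (a, y)) (b := (b, y)) h' (ψ b hp m) ((slice A B y).map f))
    {x z : A.Obj × B.Obj} {p q n p' n' : ℤ} (h : p + q = n) (hp : p' + c = p)
      (hn : n' + c = n) (h' : p' + q = n') (m : (box X (B.representable y)).X z p)
      (f : (A.tensor B).Hom x z q) :
    boxExt ψ x hn ((box X (B.representable y)).act h m f) = N.act h' (boxExt ψ z hp m) f := by
  induction m using box_induction with
  | hadd m m' hm hm' => simp only [map_add, LinearMap.add_apply, hm, hm']
  | hmk r s hrs v w =>
    induction f using GTensor.induction with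
    | hadd f f' hf hf' => simp only [map_add, hf, hf']
    | hmk r' s' hrs' f g =>
      rw [boxExt_mk ψ z hp hrs (sub_add_cancel r c) (by omega),
        act_boxMk h hrs hrs' (rfl : r + r' = r + r') (rfl : s + s' = s + s') (by omega), map_smul,
        boxExt_mk ψ x hn (by omega : r + r' + (s + s') = n)
          (by omega : r + r' - c + c = r + r') (by omega),
        hψ rfl (sub_add_cancel r c) _ (by omega : r - c + r' = r + r' - c) v f]
      refine (congrArg (koszulSign k (s * r') • ·) (N.act_act (a := x) (b := (x.1, y))
        (c := (z.1, y)) _ (by omega : r' + (s + s') = r' + (s + s')) _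
        (by omega : r - c + (r' + (s + s')) = n') _ _ _)).trans ?_
      refine Eq.trans ?_ (N.act_act (a := x) (b := z) (c := (z.1, y)) (p := r - c) (q := s)
        (r := q) _ (by omega : s + q = r' + (s + s')) _ (by omega) _ _ _).symm
      refine (map_smul _ _ _).symm.trans (congrArg _ ?_)
      refine (congrArg _ (slice_comp_coslice (A := A) (B := B)
        (by omega : r' + (s + s') = r' + (s + s')) f
        ((B.representable y).act (rfl : s + s' = s + s') w g))).trans ?_
      refine Eq.symm ((A.tensorComp_mk B x z (z.1, y)
        (by omega : s + q = r' + (s + s')) (zero_add s) hrs' (zero_add r')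
        (rfl : s + s' = s + s') (by omega) (A.id z.1) w f g).trans ?_)
      rw [A.id_comp]
      rfl

/-- To be compared with `boxExt_d_mk`: the terms in which g is differentiated agree for `c = 0` and
cancel in `d s + s d` for `c = 1`, leaving only the relation between ψ and the differentials. -/
theorem d_boxExt_mk (x : A.Obj × B.Obj) {n n' n₂ p q p' p₂ q' : ℤ} (h : n' + c = n)
    (h₁ : n' + 1 = n₂) (hpq : p + q = n) (hp : p' + c = p) (hp₂ : p' + 1 = p₂) (hq : q + 1 = q')
    (h₄ : p₂ + q = n₂) (h₅ : p' + q' = n₂) (v : X.X x.1 p) (g : (B.representable y).X x.2 q) :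
    N.d h₁ (boxExt ψ x h (boxMk X (B.representable y) x hpq v g)) =
      N.act (a := x) (b := (x.1, y)) h₄ (N.d hp₂ (ψ x.1 hp v)) (corep A x.1 x.2 q g) +
      koszulSign k p' • N.act (a := x) (b := (x.1, y)) h₅ (ψ x.1 hp v)
        (corep A x.1 x.2 q' ((B.representable y).d hq g)) := by
  rw [boxExt_mk ψ x h hpq hp (by omega) v g, N.leibniz (a := x) (b := (x.1, y)) _ h₁ hp₂ hq h₄ h₅]
  exact congrArg (fun t => _ + koszulSign k p' • N.act (a := x) (b := (x.1, y)) _ (ψ x.1 hp v) t)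
    ((coslice A B x.1).map_d (X := x.2) (Y := y) hq g).symm

theorem boxExt_d_mk (x : A.Obj × B.Obj) {n n₁ n₂ p q p₁ p₂ p' q' : ℤ}
    (h₂ : n + 1 = n₁) (h₃ : n₂ + c = n₁) (hpq : p + q = n) (hp : p' + c = p)
    (hp₁ : p + 1 = p₁) (hp₂ : p₂ + c = p₁) (hq : q + 1 = q')
    (h₄ : p₂ + q = n₂) (h₅ : p' + q' = n₂) (v : X.X x.1 p) (g : (B.representable y).X x.2 q) :
    boxExt ψ x h₃ ((box X (B.representable y)).d h₂
        (boxMk X (B.representable y) x hpq v g)) =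
      N.act (a := x) (b := (x.1, y)) h₄ (ψ x.1 hp₂ (X.d hp₁ v)) (corep A x.1 x.2 q g) +
      koszulSign k p • N.act (a := x) (b := (x.1, y)) h₅ (ψ x.1 hp v)
        (corep A x.1 x.2 q' ((B.representable y).d hq g)) := by
  rw [d_boxMk x h₂ hpq hp₁ hq (by omega) (by omega), map_add, map_smul,
    boxExt_mk ψ x h₃ _ hp₂ h₄, boxExt_mk ψ x h₃ _ hp h₅]

end BoxExt

section BoxHom

variable {X : DGModule A} {y : B.Obj} {N : DGModule (A.tensor B)}

variable (X y) in
/-- The morphism `v ↦ v ⊗ 1`. -/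
def boxUnit : X ⟶ (box X (B.representable y)).restrict (slice A B y) :=
  Hom.mk (fun a p => (boxMk X (B.representable y) (a, y) (add_zero p)).flip (B.id y))
    (fun {a p q} h m => by
      refine Eq.symm ((d_boxMk (X := X) (Y := B.representable y) (a, y) h (add_zero p) h
        (zero_add 1) (add_zero q) h m (B.id y)).trans ?_)
      rw [show (B.representable y).d (zero_add 1) (B.id y) = 0 from B.d_id y _, map_zero,
        smul_zero, add_zero]
      rfl)
    (fun {a b p q n} h m f => by
      refine Eq.symm ((act_boxMk (X := X) (Y := B.representable y) (x := (a, y)) (y := (b, y)) h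
        (add_zero p) (add_zero q) h (add_zero 0) (add_zero n) m (B.id y) f (B.id y)).trans ?_)
      rw [zero_mul, koszulSign_zero, one_smul,
        show (B.representable y).act (add_zero 0) (B.id y) (B.id y) = B.id y from B.comp_id _ _]
      rfl)

/-- The elements `v ⊗ 1` generate the exterior product, so a morphism out of it is determined by its
composite with `boxUnit`. -/
theorem boxMk_eq_act (x : A.Obj × B.Obj) {p q n : ℤ} (h : p + q = n) (v : X.X x.1 p)
    (g : (B.representable y).X x.2 q) :
    boxMk X (B.representable y) x h v g = (box X (B.representable y)).act (a := x) (b := (x.1, y)) h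
      (boxMk X (B.representable y) (x.1, y) (add_zero p) v (B.id y)) (corep A x.1 x.2 q g) := by
  refine Eq.symm ((act_boxMk (X := X) (Y := B.representable y) (x := x) (y := (x.1, y)) h
    (add_zero p) (zero_add q) (add_zero p) (zero_add q) h v (B.id y) (A.id x.1) g).trans ?_)
  rw [zero_mul, koszulSign_zero, one_smul, X.act_id]
  exact congrArg _ (B.id_comp _ _)

/-- A morphism `X ⟶ N(-, y)` extends to `X ⊠ h^y ⟶ N`. -/
theorem exists_boxUnit_comp_eq (φ : X ⟶ N.restrict (slice A B y)) :
    ∃ f : box X (B.representable y) ⟶ N, boxUnit X y ≫ restrictMap (slice A B y) f = φ := by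
  let ψ : ∀ (a : A.Obj) {p p' : ℤ}, p' + 0 = p → X.X a p →ₗ[k] N.X (a, y) p' := fun a p p' h =>
    N.cast (a, y) (by omega) ∘ₗ φ.app a p
  refine ⟨Hom.mk (fun x n => boxExt ψ x (add_zero n)) ?_ ?_, ?_⟩
  · intro x n n' h m
    induction m using box_induction with
    | hadd m m' hm hm' => simp only [map_add, hm, hm']
    | hmk p q hpq v w =>
      rw [d_boxExt_mk ψ x (add_zero n) h hpq (add_zero p) rfl rfl (by omega) (by omega),
        boxExt_d_mk ψ x h (add_zero n') hpq (add_zero p) rfl (add_zero (p + 1)) rfl (by omega)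
          (by omega)]
      exact congrArg (fun t => N.act (a := x) (b := (x.1, y)) _ t _ + _) (φ.app_d rfl v)
  · intro x z p q n h m f
    refine boxExt_act ψ ?_ h _ _ h m f
    intro a b p q n p' n' h hp hn h' m f
    obtain rfl : p = p' := by omega
    obtain rfl : n = n' := by omega
    exact φ.app_act h m f
  · refine Hom.ext ?_
    funext a p
    refine LinearMap.ext fun m => ?_
    refine (boxExt_mk ψ (a, y) (add_zero p) (add_zero p) (add_zero p) (add_zero p) m
      (B.id y)).trans ?_
    exact N.act_id _ _

/-- A morphism out of `X ⊠ h^y` is null-homotopic if it is so on `X`. -/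
theorem isNullHomotopic_of_boxUnit (f : box X (B.representable y) ⟶ N)
    (h : IsNullHomotopic (boxUnit X y ≫ restrictMap (slice A B y) f)) : IsNullHomotopic f := by
  obtain ⟨s, hs⟩ := h
  let ψ : ∀ (a : A.Obj) {p p' : ℤ}, p' + 1 = p → X.X a p →ₗ[k] N.X (a, y) p' := fun a p p' h =>
    s.app a h
  refine ⟨⟨fun x n n' h => boxExt ψ x h, ?_⟩, ?_⟩
  · intro x z p q n p' n' h hp hn h' m g
    exact boxExt_act ψ (fun h hp hn h' m f => s.app_act h hp hn h' m f) h hp hn h' m g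
  · intro x n n' n'' h h' m
    induction m using box_induction with
    | hadd m m' hm hm' =>
      rw [map_add, hm, hm']
      simp only [map_add]
      abel
    | hmk p q hpq v w =>
      rw [d_boxExt_mk ψ x h h hpq (sub_add_cancel p 1) (sub_add_cancel p 1) rfl hpq (by omega),
        boxExt_d_mk ψ x h' h' hpq (sub_add_cancel p 1) rfl rfl rfl hpq (by omega),
        koszulSign_of_succ (sub_add_cancel p 1), boxMk_eq_act, f.app_act]
      have e := hs x.1 (sub_add_cancel p 1) rfl v
      have e' : f.app (x.1, y) p (boxMk X (B.representable y) (x.1, y) (add_zero p) v (B.id y)) =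
          N.d (sub_add_cancel p 1) (ψ x.1 (sub_add_cancel p 1) v) + ψ x.1 rfl (X.d rfl v) := e
      rw [e', map_add, LinearMap.add_apply, neg_smul]
      abel

/-- The left adjoint, exterior product with the module represented by `y`, preserves acyclic modules
since the tensor product is over a field. -/
theorem IsKInj.restrict_slice (hN : N.IsKInj) : (N.restrict (slice A B y)).IsKInj := by
  intro X hX φ
  obtain ⟨f, rfl⟩ := exists_boxUnit_comp_eq φ
  exact ((hN _ (fun x => (hX x.1).box) f).restrict (slice A B y)).comp_left _

/-- The exterior product of a perfect module and a representable module is perfect. -/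
theorem IsPerfect.box (hX : X.IsPerfect) (y : B.Obj) :
    (box X (B.representable y)).IsPerfect := by
  -- The criterion for `boxUnit` holds because morphisms from `X ⊠ h^y` to a K-injective `I` are, up
  -- to homotopy, morphisms from `X` to `I(-, y)`, which is again K-injective.
  refine isPerfect_of_faithful (slice A B y) hX (boxUnit X y) fun N f hf => ?_
  obtain ⟨I, ι, hI, hι⟩ := exists_isKInj_resolution N
  have := hι.isIso_toD
  obtain ⟨g, hg⟩ := exists_toD_map_eq hI (f ≫ (toD _).map ι)
  have h₀ : IsNullHomotopic (boxUnit X y ≫ restrictMap (slice A B y) g) := by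
    refine isNullHomotopic_of_toD_map_eq_zero (hI.restrict_slice (y := y)) ?_
    rw [Functor.map_comp, ← resMap_map, hg, resMap_comp, ← Category.assoc, hf, zero_comp]
  have h₁ := toD_map_eq_zero (isNullHomotopic_of_boxUnit g h₀)
  rw [hg] at h₁
  rw [← cancel_mono ((toD _).map ι), h₁, zero_comp]

end BoxHom

end DGModule

end

/-! ### Invariance of perfection; acyclic and representable modules are perfect. -/

noncomputable section

namespace DGModule


variable {k : Type u} [Field k] {A B : DGCat.{u} k}

/-! ### Invariance of perfection -/

section Invariance

variable {M N : DGModule A}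

theorem IsPerfect.of_isIso (hM : M.IsPerfect) (e : (toD A).obj M ⟶ (toD A).obj N) [IsIso e] :
    N.IsPerfect := isPerfect_iff.2 fun J L f => by
  have := comp_mem_finHom (inv e) (isPerfect_iff.1 hM J L (e ≫ f))
  rwa [IsIso.inv_hom_id_assoc] at this

theorem IsPerfect.of_quasiIso (hM : M.IsPerfect) {f : M ⟶ N} (hf : IsQuasiIso f) : N.IsPerfect :=
  have := hf.isIso_toD
  hM.of_isIso ((toD A).map f)

theorem IsPerfect.of_quasiIso' (hN : N.IsPerfect) {f : M ⟶ N} (hf : IsQuasiIso f) :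
    M.IsPerfect :=
  have := hf.isIso_toD
  hN.of_isIso (inv ((toD A).map f))

theorem isQuasiIso_of_bijective (f : M ⟶ N) (hf : ∀ a p, Function.Bijective (f.app a p)) :
    IsQuasiIso f where
  surj a p q r hq hr y hy := by
    obtain ⟨x, rfl⟩ := (hf a p).2 y
    refine ⟨x, 0, (hf a r).1 ?_, by rw [map_zero, add_zero]⟩
    rw [f.app_d, hy, map_zero]
  inj a p q r hq hr x z hx h := by
    obtain ⟨w, rfl⟩ := (hf a q).2 z
    exact ⟨w, (hf a p).1 (by rw [h, f.app_d])⟩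

/-- The zero endomorphism of an acyclic module is a quasi-isomorphism, so zero is invertible in the
derived category. -/
theorem IsAcyclic.toD_id_eq_zero (hM : M.IsAcyclic) : 𝟙 ((toD A).obj M) = 0 := by
  have h : IsQuasiIso (0 : M ⟶ M) :=
    ⟨fun a p q r hq hr y hy => by
        obtain ⟨w, hw⟩ := hM a hq hr y hy
        exact ⟨0, w, map_zero _, by rw [map_zero, zero_add, hw]⟩,
      fun a p q r hq hr x _ hx _ => hM a hq hr x hx⟩
  have := h.isIso_toD
  rw [Functor.map_zero] at this
  rw [← IsIso.hom_inv_id (0 : (toD A).obj M ⟶ (toD A).obj M), zero_comp]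

theorem IsAcyclic.isPerfect (hM : M.IsAcyclic) : M.IsPerfect := isPerfect_iff.2 fun J L f => by
  rw [← Category.id_comp f, hM.toD_id_eq_zero, zero_comp]
  exact zero_mem _

theorem IsQuasiIso.isAcyclicAt {f : M ⟶ N} (hf : IsQuasiIso f) {a : A.Obj}
    (hM : M.IsAcyclicAt a) : N.IsAcyclicAt a := fun p q r hq hr y hy => by
  obtain ⟨x, z, hx, rfl⟩ := hf.surj a hq hr y hy
  obtain ⟨w, rfl⟩ := hM hq hr x hx
  exact ⟨f.app a q w + z, by rw [map_add, f.app_d]⟩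

theorem Orthogonal.of_retract {M' : DGModule A} (h : Orthogonal M N) (i : M ⟶ M') (j : M' ⟶ M)
    (hij : j ≫ i = 𝟙 M') : Orthogonal M' N := fun f => by
  have := (h (i ≫ f)).comp_left j
  rwa [← Category.assoc, hij, Category.id_comp] at this

end Invariance

/-! ### Representable modules -/

section Representable

variable {N : DGModule A} {a : A.Obj}

/-- The components of a morphism out of a representable module. -/
def repApp (f : A.representable a ⟶ N) (b : A.Obj) (p : ℤ) : A.Hom b a p →ₗ[k] N.X b p :=
  f.app b p

theorem repApp_eq (f : A.representable a ⟶ N) {b : A.Obj} {p : ℤ} (g : A.Hom b a p) :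
    repApp f b p g = N.act (zero_add p) (repApp f a 0 (A.id a)) g :=
  (congrArg (f.app b p) (A.id_comp (zero_add p) g).symm).trans
    (f.app_act (zero_add p) (A.id a) g)

theorem d_repApp_id (f : A.representable a ⟶ N) {q : ℤ} (h : 0 + 1 = q) :
    N.d h (repApp f a 0 (A.id a)) = 0 :=
  (f.app_d h (A.id a)).symm.trans ((congrArg (f.app a q) (A.d_id a h)).trans (map_zero _))

/-- The morphism `g ↦ x · g` defined by a cocycle `x`. -/
def yoneda (x : N.X a 0) (hx : N.d (zero_add 1) x = 0) : A.representable a ⟶ N :=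
  Hom.mk (fun b p => (N.act (zero_add p) x : A.Hom b a p →ₗ[k] N.X b p))
    (fun {b p q} h (g : A.Hom b a p) => by
      refine Eq.symm ((N.leibniz (zero_add p) h (zero_add 1) h ((add_comm 1 p).trans h)
        (zero_add q) x g).trans ?_)
      rw [hx, map_zero, koszulSign_zero, one_smul]
      exact zero_add _)
    (fun h g f => (N.act_act _ h h _ x g f).symm)

/-- If the image of the identity is `d w`, then `g ↦ w · g` is a null-homotopy; the Leibniz sign is
`-1` because `w` has degree `-1`. -/
theorem isNullHomotopic_of_apply_id (f : A.representable a ⟶ N) {q : ℤ} (hq : q + 1 = 0)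
    (w : N.X a q) (hw : repApp f a 0 (A.id a) = N.d hq w) : IsNullHomotopic f := by
  refine ⟨⟨fun b p p' h => (N.act (by omega : q + p = p') w : A.Hom b a p →ₗ[k] N.X b p'), ?_⟩, ?_⟩
  · intro b c p r n p' n' h hp hn h' g e
    exact (N.act_act _ h h' _ w g e).symm
  · intro b p p' p'' h h' (g : A.Hom b a p)
    have e := N.leibniz (by omega : q + p = p') h hq h' (zero_add p) (by omega : q + p'' = p) w g
    have e' : repApp f b p g = N.d h (N.act (by omega : q + p = p') w g) +
        N.act (by omega : q + p'' = p) w (A.d h' g) := by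
      have hs : koszulSign k q = -1 := by
        rw [eq_neg_iff_add_eq_zero, add_comm, ← neg_neg (koszulSign k q),
          ← koszulSign_of_succ hq, koszulSign_zero, add_neg_cancel]
      rw [repApp_eq, hw, e, hs, neg_one_smul, neg_add_cancel_right]
    exact e'

/-- By the Yoneda lemma, homotopy classes of morphisms from the module represented by `a` are the
degree zero cohomology at `a`, so acyclicity at the single object `a` is enough. -/
theorem orthogonal_representable (hN : N.IsAcyclicAt a) : Orthogonal (A.representable a) N := by
  intro f
  obtain ⟨w, hw⟩ := hN (by omega : (-1 : ℤ) + 1 = 0) (zero_add 1) (repApp f a 0 (A.id a))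
    (d_repApp_id f _)
  exact isNullHomotopic_of_apply_id f _ w hw

theorem sum_app {M N : DGModule A} {J : Type u} (S : Finset J) (f : J → (M ⟶ N)) (a : A.Obj)
    (p : ℤ) (m : M.X a p) : (∑ j ∈ S, f j).app a p m = ∑ j ∈ S, (f j).app a p m := by
  classical
  induction S using Finset.induction_on with
  | empty => rfl
  | insert j S hj ih => rw [Finset.sum_insert hj, Finset.sum_insert hj, add_app, ih]

/-- In the derived category, a morphism from a representable module to a direct sum is given by a
cocycle of the direct sum, and such an element has finite support. -/
theorem isPerfect_representable (a : A.Obj) : (A.representable a).IsPerfect := by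
  refine isPerfect_iff.2 fun J N f => ?_
  obtain ⟨I, ι, hI, hι⟩ := exists_isKInj_resolution (dsum N)
  have := hι.isIso_toD
  obtain ⟨g, hg⟩ := exists_toD_map_eq hI (f ≫ (toD A).map ι)
  -- The class of the image of the identity in the resolution `I` comes from a cocycle `x` of the
  -- direct sum itself.
  obtain ⟨x, w, hx, hw⟩ := hι.surj a (by omega : (-1 : ℤ) + 1 = 0) (zero_add 1)
    (repApp g a 0 (A.id a)) (d_repApp_id g _)
  have h₁ : IsNullHomotopic (g - yoneda x hx ≫ ι) := by
    refine isNullHomotopic_of_apply_id _ (by omega : (-1 : ℤ) + 1 = 0) w ?_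
    refine (sub_app g (yoneda x hx ≫ ι) a 0 (A.id a)).trans (sub_eq_of_eq_add' (hw.trans ?_))
    exact congrArg (fun y => ι.app a 0 y + _) ((dsum N).act_id (zero_add 0) x).symm
  have h₂ : f = (toD A).map (yoneda x hx) := by
    rw [← cancel_mono ((toD A).map ι), ← hg, toD_map_congr h₁, Functor.map_comp]
  rw [h₂]
  obtain ⟨S, hS⟩ := dsum_eq_sum x
  refine mem_finHom_of_eq_sum S ?_
  simp only [← Functor.map_comp]
  rw [← Functor.map_sum]
  congr 1
  refine Hom.ext ?_
  funext b p
  refine LinearMap.ext fun (e : A.Hom b a p) => ?_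
  refine Eq.trans ?_ (sum_app (M := A.representable a) S
    (fun j => yoneda x hx ≫ dsumProj N j ≫ dsumIncl N j) b p e).symm
  have e₁ : (dsum N).act (zero_add p) x e =
      ∑ j ∈ S, (dsumProj N j ≫ dsumIncl N j).app b p ((dsum N).act (zero_add p) x e) := by
    conv_lhs => rw [hS, map_sum, LinearMap.sum_apply]
    exact Finset.sum_congr rfl fun j _ =>
      ((dsumProj N j ≫ dsumIncl N j).app_act (zero_add p) x e).symm
  exact e₁

end Representable

end DGModule

end

/-! ### Testing orthogonality over a tensor product one slice at a time. -/

noncomputable section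

namespace DGModule


/-! ### The cobar resolution relative to the slices of a tensor product -/

section Coslice

variable {k : Type u} [Field k] {A B : DGCat.{u} k} {X : DGModule (A.tensor B)}

/-- The dg functors `b ↦ (t, b)`. -/
abbrev coslices (A B : DGCat.{u} k) (t : A.Obj) : DGFunctor B (A.tensor B) := coslice A B t

variable {b : B.Obj} {p p' : ℤ} (x : A.Obj)

/-- Evaluation of the elements of the cobar construction. -/
def coEv {x : A.Obj × B.Obj} (t : A.Obj) (y : B.Obj) {q n : ℤ} (h : p + q = n + 1) :
    (cobarStep (coslices A B) X).X x p →ₗ[k] (A.tensor B).Hom (t, y) x q →ₗ[k] X.X (t, y) n :=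
  cobarEv (coslices A B) t y h

theorem coEv_ext {x : A.Obj × B.Obj} {φ ψ : (cobarStep (coslices A B) X).X x p}
    (h : ∀ t y q n (hn : p + q = n + 1) (f : (A.tensor B).Hom (t, y) x q),
      coEv t y hn φ f = coEv t y hn ψ f) : φ = ψ :=
  cobar_ext h

/-- The values of an element of the cobar construction at `f ⊗ 1`. -/
def cobarSlice (φ : (cobarStep (coslices A B) X).X (x, b) p) (t : A.Obj) {q n : ℤ}
    (h : p + q = n + 1) : A.Hom t x q →ₗ[k] X.X (t, b) n :=
  coEv t b h φ ∘ₗ (slice A B b).map (X := t) (Y := x)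

variable {x}

/-- Since `f ⊗ g = (f ⊗ 1) ∘ (1 ⊗ g)` and φ is linear over `B`, φ is determined by its values at the
morphisms `f ⊗ 1`, which keep the second coordinate `b` fixed. -/
theorem coEv_eq (φ : (cobarStep (coslices A B) X).X (x, b) p) (t : A.Obj) (y : B.Obj)
    {q r s n m : ℤ} (h : p + q = n + 1) (hrs : r + s = q) (h' : p + r = m + 1) (hm : m + s = n)
    (f : A.Hom t x r) (g : B.Hom y b s) :
    coEv t y h φ (GTensor.mk hrs f g) = X.act (a := (t, y)) (b := (t, b)) hm
      (cobarSlice x φ t h' f) ((coslice A B t).map (X := y) (Y := b) g) :=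
  (congrArg (coEv t y h φ) (slice_comp_coslice hrs f g)).symm.trans
    (cobarEv_comp φ t h' hrs h hm ((slice A B b).map f) g)

theorem cobarSlice_ext {φ ψ : (cobarStep (coslices A B) X).X (x, b) p}
    (h : ∀ (t : A.Obj) (q n : ℤ) (h : p + q = n + 1) (f : A.Hom t x q),
      cobarSlice x φ t h f = cobarSlice x ψ t h f) : φ = ψ := by
  refine coEv_ext fun t y q n hn f => ?_
  induction f using GTensor.induction with
  | hadd f f' hf hf' => simp only [map_add, hf, hf']
  | hmk r s hrs f g =>
    rw [coEv_eq φ t y hn hrs (m := n - s) (by omega) (by omega),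
      coEv_eq ψ t y hn hrs (m := n - s) (by omega) (by omega), h]

theorem cobarSlice_d (h : p + 1 = p') (φ : (cobarStep (coslices A B) X).X (x, b) p) (t : A.Obj)
    {q q' n n' : ℤ} (hq : q + 1 = q') (hn : n + 1 = n') (h1 : p' + q = n' + 1)
    (h2 : p + q = n + 1) (h3 : p + q' = n' + 1) (f : A.Hom t x q) :
    cobarSlice x ((cobarStep (coslices A B) X).d h φ) t h1 f =
      -X.d hn (cobarSlice x φ t h2 f) - koszulSign k p • cobarSlice x φ t h3 (A.d hq f) := by
  refine (cobarEv_d h φ t b hq hn h1 h2 h3 ((slice A B b).map f)).trans ?_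
  exact congrArg (fun e => -X.d hn (cobarSlice x φ t h2 f) - koszulSign k p • coEv t b h3 φ e)
    ((slice A B b).map_d hq f).symm

/-- Construction of elements of the cobar construction from their values at `f ⊗ 1`. -/
theorem exists_cobarSlice_eq
    (β : ∀ (t : A.Obj) (q n : ℤ), p + q = n + 1 → A.Hom t x q →ₗ[k] X.X (t, b) n) :
    ∃ φ : (cobarStep (coslices A B) X).X (x, b) p,
      ∀ t q n h f, cobarSlice x φ t h f = β t q n h f := by
  -- The forced extension: `f ⊗ g` goes to `β f · (1 ⊗ g)`.
  let γ : ∀ (t : A.Obj) (y : B.Obj) (q n : ℤ), p + q = n + 1 →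
      (A.tensor B).Hom (t, y) (x, b) q →ₗ[k] X.X (t, y) n := fun t y q n h =>
    GTensor.lift fun r s hrs =>
      ((X.act (a := (t, y)) (b := (t, b)) (by omega : (p + r - 1) + s = n)).compl₂
        (coslice A B t).map).comp (β t r (p + r - 1) (by omega))
  have hγ : ∀ (t : A.Obj) (y : B.Obj) {q n r s m : ℤ} (h : p + q = n + 1) (hrs : r + s = q)
      (h' : p + r = m + 1) (hm : m + s = n) (f : A.Hom t x r) (g : B.Hom y b s),
      γ t y q n h (GTensor.mk hrs f g) = X.act (a := (t, y)) (b := (t, b)) hm (β t r m h' f)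
        ((coslice A B t).map (X := y) (Y := b) g) := by
    intro t y q n r s m h hrs h' hm f g
    obtain rfl : m = p + r - 1 := by omega
    exact GTensor.lift_mk _ _ _ _
  have hγ' : ∀ (t : A.Obj) (y y' : B.Obj) (q r qr n n' : ℤ) (h : p + q = n + 1) (hqr : q + r = qr)
      (h' : p + qr = n' + 1) (hn : n + r = n') (f : (A.tensor B).Hom (t, y) (x, b) q)
      (g : B.Hom y' y r) (e : (A.tensor B).Hom (t, y') (t, y) r), e = (coslice A B t).map g →
      γ t y' qr n' h' ((A.tensor B).comp hqr f e) = X.act hn (γ t y q n h f) e := by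
    intro t y y' q r qr n n' h hqr h' hn f g e he
    induction f using GTensor.induction with
    | hadd f f' hf hf' => simp only [map_add, LinearMap.add_apply, hf, hf']
    | hmk r₁ s₁ hrs f f' =>
      refine Eq.trans ?_ (congrArg (fun z => X.act hn z e) (hγ t y h hrs (m := n - s₁) (by omega)
        (by omega) f f')).symm
      refine Eq.trans ?_ (X.act_act (a := (t, y')) (b := (t, y)) (c := (t, b)) _
        (rfl : s₁ + r = s₁ + r) _ (by omega) _ _ _).symm
      subst he
      refine (congrArg (γ t y' qr n' h') (A.tensorComp_mk B (t, y') (t, y) (x, b) hqr hrs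
        (zero_add r) (add_zero r₁) rfl (by omega) f f' (A.id t) g)).trans ?_
      rw [mul_zero, koszulSign_zero, one_smul, A.comp_id,
        hγ t y' h' _ (m := n - s₁) (by omega) (by omega)]
      exact congrArg _ ((coslice A B t).map_comp rfl f' g)
  let φ := cobarLift (V := k) (F := coslices A B) (X := X) (a := (x, b)) (p := p)
    (fun t y q n h => LinearMap.toSpanSingleton k _ (γ t y q n h))
    (fun t y y' q r qr n n' h hqr h' hn v f g =>
      (congrArg (v • ·) (hγ' t y y' q r qr n n' h hqr h' hn f g _ rfl)).trans
        (LinearMap.map_smul₂ (X.act (a := (t, y')) (b := (t, y)) hn) v _ _).symm)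
  refine ⟨φ 1, fun t q n h f => ?_⟩
  refine (congrArg (fun e : (A.tensor B).Hom (t, b) (x, b) q →ₗ[k] X.X (t, b) n =>
    e ((slice A B b).map (X := t) (Y := x) f)) (one_smul k (γ t b q n h))).trans ?_
  refine (hγ t b h (add_zero q) h (add_zero n) f (B.id b)).trans ?_
  exact X.act_id _ _

/-- Up to a shift, the complex at (x, b) is ∏_t Hom_k(A(t, x), X(t, b)), which involves `X` only at
objects with the same `b`; contractions of the complexes X(t, b), applied to the values of φ, show
that it is acyclic. -/
theorem isAcyclicAt_cobarStep (hX : ∀ t : A.Obj, X.IsAcyclicAt (t, b)) :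
    (cobarStep (coslices A B) X).IsAcyclicAt (x, b) := by
  have σ := fun t => (hX t).nonempty_contraction.some
  intro p q r hq hr φ hφ
  obtain ⟨ψ, hψ⟩ := exists_cobarSlice_eq (p := q) (x := x) (b := b) (X := X) fun t m n h =>
    -((σ t).s rfl ∘ₗ cobarSlice x φ t (by omega : p + m = n + 1 + 1))
  have hψ' : ∀ (t : A.Obj) {m n n' : ℤ} (h : q + m = n + 1) (hn : n + 1 = n')
      (h' : p + m = n' + 1) (f : A.Hom t x m), cobarSlice x ψ t h f =
        -(σ t).s hn (cobarSlice x φ t h' f) := by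
    intro t m n n' h hn h' f
    subst hn
    exact hψ t m n h f
  refine ⟨ψ, cobarSlice_ext fun t m n h f => ?_⟩
  rw [cobarSlice_d hq ψ t rfl (sub_add_cancel n 1) h (by omega) (by omega),
    hψ' t (n' := n) _ (sub_add_cancel n 1) h, hψ' t (n' := n + 1) _ rfl (by omega)]
  have e := cobarSlice_d hr φ t (rfl : m + 1 = m + 1) (rfl : n + 1 = n + 1) (by omega) h
    (by omega) f
  rw [hφ] at e
  have e₀ : cobarSlice x (0 : (cobarStep (coslices A B) X).X (x, b) r) t
      (by omega : r + m = n + 1 + 1) f = 0 := by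
    exact congrArg (fun l : (A.tensor B).Hom (t, b) (x, b) m →ₗ[k] X.X (t, b) (n + 1) =>
      l ((slice A B b).map (X := t) (Y := x) f)) (map_zero (coEv (X := X) (x := (x, b)) t b
        (by omega : r + m = n + 1 + 1)))
  rw [e₀, eq_comm, sub_eq_zero] at e
  have e₂ := (σ t).eq (sub_add_cancel n 1) (rfl : n + 1 = n + 1) (cobarSlice x φ t h f)
  rw [neg_eq_iff_eq_neg.1 e] at e₂
  refine e₂.symm.trans ?_
  rw [koszulSign_of_succ hq]
  simp only [map_neg, map_smul, smul_neg, neg_smul, neg_neg, sub_neg_eq_add]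

/-- A module that is orthogonal to `N` along the slices is orthogonal to `N`, for `N` K-injective
and acyclic at the objects `(t, b)` with `S b`. -/
theorem IsKInj.orthogonal_of_coslice {N M : DGModule (A.tensor B)} (hN : N.IsKInj)
    (S : B.Obj → Prop) (hS : ∀ t b, S b → N.IsAcyclicAt (t, b))
    (hM : ∀ (t : A.Obj) (L : DGModule B), (∀ b, S b → L.IsAcyclicAt b) →
      Orthogonal (M.restrict (coslice A B t)) L) : Orthogonal M N := by
  -- Acyclicity at the objects with second coordinate in `S` passes to every term of the cobar
  -- complex relative to the functors `b ↦ (t, b)`.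
  have hW : ∀ n t b, S b → (cobarW (coslices A B) N n).IsAcyclicAt (t, b) := by
    intro n
    induction n with
    | zero => exact hS
    | succ n ih =>
      exact fun t b hb => isAcyclicAt_cobarStep (X := cobarW (coslices A B) N n)
        (fun t => ih t b hb)
  have h : Orthogonal M (cobar (coslices A B) N) :=
    orthogonal_cobar (coslices A B) fun n t => hM t _ fun b hb => hW n t b hb
  -- Since `N` is K-injective, it is a homotopy retract of its cobar complex, and `M` is orthogonal
  -- to the latter.
  obtain ⟨r, hr⟩ := hN.exists_leftInverse
    (isQuasiIso_cobarι (coslices A B) (fun b => ⟨b.1, b.2, rfl⟩) N)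
  intro f
  have h₁ := hr.symm.comp_left f
  rw [Preadditive.comp_sub, Category.comp_id, ← Category.assoc] at h₁
  exact h₁.congr ((h _).comp_right r)

end Coslice

end DGModule

end

/-! ### Full dg subcategories and the half-restricted diagonal bimodule. -/

noncomputable section

namespace DGModule


/-! ### Coinduction along fully faithful dg functors -/

section FullyFaithful

variable {k : Type u} [Field k] {D E : DGCat.{u} k} (F : DGFunctor D E) {z : D.Obj}

/-- `F` is bijective on the morphisms to `z`. -/
def FullyFaithfulAt (z : D.Obj) : Prop :=
  ∀ (x : D.Obj) (p : ℤ), Function.Bijective (F.map (X := x) (Y := z) (p := p))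

variable {F} {L : DGModule D}

/-- Every morphism from `F x` to `F z` is `1 ∘ F g`, so by linearity an element at `F z` is
determined by its value at the identity. -/
theorem FullyFaithfulAt.counit_injective (hF : FullyFaithfulAt F z) {p : ℤ} :
    Function.Injective (resApp (coindCounit F L) z p) := by
  refine (injective_iff_map_eq_zero _).2 fun φ hφ => ?_
  refine coind_ext fun t x q n hn f => ?_
  obtain ⟨g, rfl⟩ := (hF x q).2 f
  have e := coindEv_comp φ t (x := z) (q := 0) (n := p) (by omega) (zero_add q) hn (by omega)
    (E.id (F.obj z)) g
  rw [E.id_comp] at e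
  have hφ' : coindEv (T := PUnit.{u + 1}) 0 (fun _ => F) (fun _ => L) t z
      (by omega : p + 0 = p + 0) φ (E.id (F.obj z)) = 0 := hφ
  rw [e, hφ', map_zero, map_zero]
  rfl

/-- The element `l` is the value at the identity of `F g ↦ l · g`, which is well defined because `F`
is bijective on these morphisms. -/
theorem FullyFaithfulAt.counit_surjective (hF : FullyFaithfulAt F z) {p : ℤ} :
    Function.Surjective (resApp (coindCounit F L) z p) := by
  intro l
  let e := fun (x : D.Obj) (q : ℤ) => LinearEquiv.ofBijective (F.map (X := x) (Y := z)) (hF x q)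
  have he : ∀ (x : D.Obj) (q : ℤ) (g : D.Hom x z q), (e x q).symm (F.map g) = g := fun x q g =>
    (e x q).symm_apply_apply g
  let β : ∀ (x : D.Obj) (q n : ℤ), p + q = n + 0 → E.Hom (F.obj x) (F.obj z) q →ₗ[k] L.X x n :=
    fun x q n h => (L.act (by omega : p + q = n) l) ∘ₗ (e x q).symm.toLinearMap
  have hβ : ∀ (x y : D.Obj) (q r qr n n' : ℤ) (h : p + q = n + 0) (hqr : q + r = qr)
      (h' : p + qr = n' + 0) (hn : n + r = n') (f : E.Hom (F.obj x) (F.obj z) q) (g : D.Hom y x r),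
      β y qr n' h' (E.comp hqr f (F.map g)) = L.act hn (β x q n h f) g := by
    intro x y q r qr n n' h hqr h' hn f g
    obtain ⟨f, rfl⟩ := (hF x q).2 f
    rw [← F.map_comp]
    simp only [β, LinearMap.comp_apply, LinearEquiv.coe_coe, he]
    exact (L.act_act _ hqr hn _ l f g).symm
  refine ⟨coindOneMk β hβ, (coindOneEv_mk β hβ z (by omega : p + 0 = p + 0)
    (E.id (F.obj z))).trans ?_⟩
  simp only [β, LinearMap.comp_apply, LinearEquiv.coe_coe]
  rw [← F.map_id, he, L.act_id]

/-- At `F z` the counit is an isomorphism, and its composite with `toCoind F b` is `b`, a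
quasi-isomorphism. -/
theorem FullyFaithfulAt.isAcyclicAt_fib (hF : FullyFaithfulAt F z) {N : DGModule E}
    {b : N.restrict F ⟶ L} (hb : IsQuasiIso b) : (fib (toCoind F b)).IsAcyclicAt (F.obj z) := by
  have hε : ∀ (p : ℤ) (y : N.X (F.obj z) p),
      resApp (coindCounit F L) z p ((toCoind F b).app (F.obj z) p y) = b.app z p y := fun p y =>
    congrArg (fun g : N.restrict F ⟶ L => g.app z p y) (toCoind_counit F b)
  refine DGModule.isAcyclicAt_fib _ _ ?_ ?_
  · intro p q r hq hr y hy
    obtain ⟨x, w, hx, hw⟩ := hb.surj z hq hr (resApp (coindCounit F L) z p y) (by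
      rw [← resApp_d, hy, map_zero])
    obtain ⟨w', rfl⟩ := hF.counit_surjective w
    refine ⟨x, w', hx, hF.counit_injective ?_⟩
    rw [map_add, resApp_d, hw]
    exact congrArg (· + _) (hε p x).symm
  · intro p q r hq hr x y hx h
    refine hb.inj z hq hr x (resApp (coindCounit F L) z q y) hx ?_
    rw [← resApp_d, ← h]
    exact (hε p x).symm

/-- If nothing maps from the image of F to e, then F_* L vanishes at e, and the fibre there is
acyclic because N is. -/
theorem isAcyclicAt_fib_toCoind_of_hom_eq_zero {e : E.Obj}
    (he : ∀ (x : D.Obj) (p : ℤ) (f : E.Hom (F.obj x) e p), f = 0) {N : DGModule E}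
    (hN : N.IsAcyclicAt e) (b : N.restrict F ⟶ L) : (fib (toCoind F b)).IsAcyclicAt e := by
  have h0 : ∀ (p : ℤ) (y y' : (coindOne F L).X e p), y = y' := fun p y y' =>
    coind_ext fun t x q n hn f => by rw [he x q f, map_zero, map_zero]
  exact DGModule.isAcyclicAt_fib _ _ (fun hq hr y hy => ⟨0, 0, map_zero _, h0 _ _ _⟩)
    (fun hq hr x y hx _ => hN hq hr x hx)

end FullyFaithful

/-! ### Full subcategories and tensor products -/

section Full

variable {k : Type u} [Field k] (C : DGCat.{u} k) (P : C.Obj → Prop) (B : DGCat.{u} k)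

/-- The dg functor `C' ⊗ B → C ⊗ B` for a full dg subcategory `C'` of `C`. -/
def fullTensor : DGFunctor ((C.full P).tensor B) (C.tensor B) where
  obj x := (x.1.1, x.2)
  map := LinearMap.id
  map_d _ _ := rfl
  map_id _ := rfl
  map_comp _ _ _ := rfl

/-- The dg functor `B ⊗ C'ᵒᵖ → B ⊗ Cᵒᵖ` for a full dg subcategory `C'` of `C`. -/
def tensorFullOp : DGFunctor (B.tensor (C.full P).op) (B.tensor C.op) where
  obj x := (x.1, x.2.1)
  map := LinearMap.id
  map_d _ _ := rfl
  map_id _ := rfl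
  map_comp _ _ _ := rfl

variable {C P B}

theorem fullyFaithfulAt_fullTensor (z : ((C.full P).tensor B).Obj) :
    FullyFaithfulAt (fullTensor C P B) z := fun _ _ => Function.bijective_id

theorem fullyFaithfulAt_tensorFullOp (z : (B.tensor (C.full P).op).Obj) :
    FullyFaithfulAt (tensorFullOp C P B) z := fun _ _ => Function.bijective_id

variable (C P)

/-- The diagonal bimodule of `C`, restricted to a full dg subcategory in the contravariant
variable. -/
abbrev halfDiagonal : DGBimodule C (C.full P) := DGBimodule.res C.idFunctor (C.fullIncl P)

/-- The restriction of the diagonal bimodule of `C`. -/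
def restrictDiagonal : C.diagonal.restrict (fullTensor C P C.op) ⟶ halfDiagonal C P :=
  Hom.mk (fun _ _ => LinearMap.id) (fun _ _ => rfl) (fun _ _ _ => rfl)

/-- The diagonal bimodule of a full dg subcategory. -/
def diagonalFull : (C.full P).diagonal ⟶ (halfDiagonal C P).restrict (tensorFullOp C P (C.full P)) :=
  Hom.mk (fun _ _ => LinearMap.id) (fun _ _ => rfl) (fun _ _ _ => rfl)

variable {C P}

/-- The bimodule `C(x, -)` is corepresentable. -/
def halfDiagonalCoslice (t : (C.full P).Obj) :
    C.op.representable t.1 ⟶ (halfDiagonal C P).restrict (coslice (C.full P) C.op t) :=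
  Hom.mk (fun _ _ => LinearMap.id) (fun _ _ => rfl) (fun {y z p q n} h m f => by
    refine Eq.symm ((DGBimodule.resAct_mk C.idFunctor (C.fullIncl P) (t, y) (t, z) h (zero_add q)
      (add_zero p) ((add_comm q p).trans h) m (C.id t.1) f).trans ?_)
    refine (congrArg (fun e => koszulSign k (q * (p + 0)) •
      C.comp ((add_comm q p).trans h) f e) (C.comp_id (add_zero p) m)).trans ?_
    rw [add_zero, mul_comm]
    rfl)

/-- For `t` in the subcategory, the slice C(t, -) is a representable module over `C.op`, orthogonal
to anything acyclic at `t`. Thus acyclicity of `N` on pairs of objects of the subcategory suffices.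
-/
theorem orthogonal_halfDiagonal {N : DGModule ((C.full P).tensor C.op)} (hN : N.IsKInj)
    (h : ∀ x a : (C.full P).Obj, N.IsAcyclicAt (x, a.1)) : Orthogonal (halfDiagonal C P) N :=
  hN.orthogonal_of_coslice P (fun t b hb => h t ⟨b, hb⟩) fun t _ hL =>
    (orthogonal_representable (hL t.1 t.2)).of_retract (halfDiagonalCoslice t)
      (Hom.mk (fun _ _ => LinearMap.id) (fun _ _ => rfl)
        (fun h m f => ((halfDiagonalCoslice t).app_act h m f).symm)) rfl

/-- The restriction of the diagonal bimodule of `C` to a smooth full dg subcategory is perfect. -/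
theorem isPerfect_halfDiagonal (h : (C.full P).IsSmooth) : (halfDiagonal C P).IsPerfect := by
  have hη : IsQuasiIso (diagonalFull C P) :=
    isQuasiIso_of_bijective _ fun _ _ => Function.bijective_id
  have := hη.isIso_toD
  refine isPerfect_of_faithful (tensorFullOp C P (C.full P)) h (diagonalFull C P) fun N f hf => ?_
  obtain ⟨I, ι, hI, hι⟩ := exists_isKInj_resolution N
  have := hι.isIso_toD
  obtain ⟨g, hg⟩ := exists_toD_map_eq hI (f ≫ (toD _).map ι)
  suffices hg₀ : (toD _).map g = 0 by rw [← cancel_mono ((toD _).map ι), ← hg, hg₀, zero_comp]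
  -- Let F be the inclusion of the tensor product of the subcategory with its opposite. The
  -- restriction of `g` along F vanishes in the derived category, so by adjunction `g` becomes
  -- null-homotopic in F_* J.
  obtain ⟨J, b, hJ, hb⟩ := exists_isKInj_resolution (I.restrict (tensorFullOp C P (C.full P)))
  have h₁ : (toD _).map (restrictMap (tensorFullOp C P (C.full P)) g) = 0 := by
    have hf' : resMap (tensorFullOp C P (C.full P)) f = 0 := by
      rw [← cancel_epi ((toD _).map (diagonalFull C P)), hf, comp_zero]
    rw [← resMap_map, hg, resMap_comp, hf', zero_comp]
  have h₂ : IsNullHomotopic (restrictMap (tensorFullOp C P (C.full P)) g ≫ b) :=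
    isNullHomotopic_of_toD_map_eq_zero hJ (by rw [Functor.map_comp, h₁, zero_comp])
  have h₃ : IsNullHomotopic (g ≫ toCoind _ b) := by
    rw [← counit_toCoind _ (g ≫ toCoind _ b)]
    refine IsNullHomotopic.toCoind _ ?_
    have e : restrictMap (tensorFullOp C P (C.full P)) (g ≫ toCoind _ b) ≫ coindCounit _ J =
        restrictMap (tensorFullOp C P (C.full P)) g ≫ b :=
      congrArg (restrictMap (tensorFullOp C P (C.full P)) g ≫ ·) (toCoind_counit _ b)
    rwa [e]
  -- Hence `g` factors through the fibre of `I → F_* J`. As F is fully faithful, this fibre is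
  -- acyclic on pairs of objects of the subcategory, so `orthogonal_halfDiagonal`, applied to a
  -- K-injective resolution of it, kills the lift.
  obtain ⟨g', rfl⟩ := exists_lift_fib _ g h₃
  obtain ⟨K, κ, hK, hκ⟩ := exists_isKInj_resolution
    (fib (toCoind (tensorFullOp C P (C.full P)) b))
  have := hκ.isIso_toD
  have h₄ : IsNullHomotopic (g' ≫ κ) := orthogonal_halfDiagonal hK (fun x a =>
    hκ.isAcyclicAt ((fullyFaithfulAt_tensorFullOp (x, a)).isAcyclicAt_fib hb)) _
  have h₅ := toD_map_eq_zero h₄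
  rw [Functor.map_comp] at h₅
  have h₆ : (toD _).map g' = 0 := by rw [← cancel_mono ((toD _).map κ), h₅, zero_comp]
  rw [Functor.map_comp, h₆, zero_comp]

end Full

end DGModule

end

/-! ### The filtration of a directed dg category by its blocks. -/

noncomputable section

namespace DGModule


/-! ### Directed dg categories -/

section Directed

variable {k : Type u} [Field k] {C : DGCat.{u} k}

/-- The exterior product of the restriction of a representable module with a representable
module is the restriction of a representable module. -/
def boxRepRes (P : C.Obj → Prop) (B : DGCat.{u} k) (c : C.Obj) (y : B.Obj) :
    box (repRes (C.fullIncl P) c) (B.representable y) ⟶ repRes (fullTensor C P B) (c, y) :=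
  Hom.mk (fun _ _ => LinearMap.id) (fun _ _ => rfl) (fun _ _ _ => rfl)

/-- The restricted representable module splits as the exterior product of `repRes (C.fullIncl P) c`
with the module represented by `y`. -/
theorem isPerfect_repRes_fullTensor {P : C.Obj → Prop} {c : C.Obj}
    (hc : (repRes (C.fullIncl P) c).IsPerfect) (B : DGCat.{u} k) (y : B.Obj) :
    (repRes (fullTensor C P B) (c, y)).IsPerfect :=
  (hc.box y).of_quasiIso (isQuasiIso_of_bijective (boxRepRes P B c y) fun _ _ =>
    Function.bijective_id)

variable {n : ℕ} (D : DirectedDecomposition C n)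

/-- The right module `φ(-, c)` for the bimodule `φ = φ_ij`. -/
def rightRepRes (i j : Fin n) (c : (D.block i).Obj) :
    (D.bimodule i j).right c ⟶ repRes (D.incl j) c.1 :=
  Hom.mk (fun _ _ => LinearMap.id) (fun _ _ => rfl) (fun {a b p q r} h m f => by
    refine (DGBimodule.resAct_mk (D.incl i) (D.incl j) (a, c) (b, c) h (add_zero q) h
      (zero_add r) m f ((D.block i).id c)).trans ?_
    rw [zero_mul, koszulSign_zero, one_smul]
    exact C.id_comp _ _)

-- This is where directedness and right perfection meet: C(-, c) on A_i is zero for c in a lower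
-- block, representable for c in A_i, and of the form φ(-, c) for c in a higher block.
variable {D} in
theorem isPerfect_repRes_incl
    (hperfect : ∀ i j : Fin n, j < i → (D.bimodule i j).IsRightPerfect) (i : Fin n) (c : C.Obj) :
    (repRes (D.incl i) c).IsPerfect := by
  rcases lt_trichotomy (D.index c) i with h | h | h
  · refine IsAcyclic.isPerfect fun a p q r hq hr x _ => ⟨0, ?_⟩
    rw [map_zero]
    exact D.hom_eq_zero a.1 c (by rw [a.2]; exact h) p x
  · refine (isPerfect_representable (A := D.block i) ⟨c, h⟩).of_quasiIso
      (isQuasiIso_of_bijective (Hom.mk (fun _ _ => LinearMap.id) (fun _ _ => rfl)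
        (fun _ _ _ => rfl)) fun _ _ => Function.bijective_id)
  · exact (hperfect (D.index c) i h ⟨c, rfl⟩).of_quasiIso
      (isQuasiIso_of_bijective (rightRepRes D (D.index c) i ⟨c, rfl⟩) fun _ _ =>
        Function.bijective_id)

-- Induction on the number `m` of blocks, counted from the top, on which the target modules may fail
-- to be acyclic in the first variable.
variable {D} in
theorem isSmooth_of_directed (hsmooth : ∀ i : Fin n, (D.block i).IsSmooth)
    (hperfect : ∀ i j : Fin n, j < i → (D.bimodule i j).IsRightPerfect) : C.IsSmooth := by
  -- For `m = n` the acyclicity condition is void, so the claim is perfection of the diagonal. For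
  -- `m = 0` the modules are acyclic everywhere.
  suffices key : ∀ m ≤ n, ∀ (J : Type u) (N : J → DGModule (C.tensor C.op)),
      (∀ j x y, (D.index x : ℕ) + m < n → (N j).IsAcyclicAt (x, y)) →
      ∀ f : (toD _).obj C.diagonal ⟶ (toD _).obj (dsum N), f ∈ finHom C.diagonal N by
    exact isPerfect_iff.2 fun J N f => key n le_rfl J N
      (fun j x y h => absurd h (by omega)) f
  intro m
  induction m with
  | zero =>
    intro _ J N hN f
    -- A direct sum of zero objects of the derived category is zero.
    have h₀ : 𝟙 ((toD _).obj (dsum N)) = 0 := eq_zero_of_dsumIncl_comp fun j => by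
      have hj : (N j).IsAcyclic := fun e => hN j e.1 e.2 (D.index e.1).2
      rw [Category.comp_id, ← Category.id_comp ((toD _).map (dsumIncl N j)), hj.toD_id_eq_zero,
        zero_comp]
    rw [← Category.comp_id f, h₀, comp_zero]
    exact zero_mem _
  | succ m ih =>
    intro hm J N hN f
    -- The lowest block not known to be acyclic; passing to the fibre of `N j → F_* (I j)` removes
    -- it.
    let i : Fin n := ⟨n - (m + 1), by omega⟩
    let F := fullTensor C (fun X => D.index X = i) C.op
    choose I b hI hb using fun j => exists_isKInj_resolution ((N j).restrict F)
    have hM : (C.diagonal.restrict F).IsPerfect :=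
      (isPerfect_halfDiagonal (hsmooth i)).of_quasiIso' (isQuasiIso_of_bijective
        (restrictDiagonal C fun X => D.index X = i) fun _ _ => Function.bijective_id)
    refine IsPerfect.mem_finHom_of_fib (F := F)
      (fun e => isPerfect_repRes_fullTensor (isPerfect_repRes_incl hperfect i e.1) C.op e.2)
      hM hI b (fun f => ih (by omega) J _ (fun j x y hx => ?_) f) f
    -- Acyclicity of the fibre at an object of index at most `i`. Below `i` the coinduced module
    -- vanishes, by directedness; at `i` the functor is fully faithful.
    rcases lt_or_eq_of_le (show (D.index x : ℕ) ≤ i by show _ ≤ n - (m + 1); omega) with h | h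
    · refine isAcyclicAt_fib_toCoind_of_hom_eq_zero ?_
        (hN j x y (by change _ < n - (m + 1) at h; omega)) (b j)
      intro z p g
      induction g using GTensor.induction with
      | hadd g g' hg hg' => rw [hg, hg', add_zero]
      | hmk p q hpq u v =>
        have hu : u = 0 := D.hom_eq_zero z.1.1 x (by rw [z.1.2]; exact h) p u
        rw [hu, map_zero, LinearMap.zero_apply]
    · exact (fullyFaithfulAt_fullTensor (P := fun X => D.index X = i) (B := C.op)
        (⟨x, Fin.ext h⟩, y)).isAcyclicAt_fib (hb j)

-- C(a, b) is C(-, b), restricted to the block of `a` and then to the point `a`. The first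
-- restriction is perfect, and the second preserves perfection because it sends representable
-- modules to complexes of morphisms of a proper block.
variable {D} in
theorem isProper_of_directed (hperfect : ∀ i j : Fin n, j < i → (D.bimodule i j).IsRightPerfect)
    (hproper : ∀ i : Fin n, (D.block i).IsProper) : C.IsProper := fun a b =>
  (IsPerfect.restrict (F := (D.block (D.index a)).point ⟨a, rfl⟩)
    (hproper (D.index a) ⟨a, rfl⟩) (isPerfect_repRes_incl hperfect (D.index a) b)).of_quasiIso
    (isQuasiIso_of_bijective (Hom.mk (fun _ _ => LinearMap.id) (fun _ _ => rfl)
        (fun _ _ _ => rfl)) fun _ _ => Function.bijective_id)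

end Directed

end DGModule

end

theorem mainTheorem6 {k : Type u} [Field k] [CharZero k] (n : ℕ) (C : DGCat.{u} k)
    (D : DirectedDecomposition C n)
    (hsmooth : ∀ i : Fin n, (D.block i).IsSmooth)
    (hperfect : ∀ i j : Fin n, j < i → (D.bimodule i j).IsRightPerfect) :
    C.IsSmooth ∧ ((∀ i : Fin n, (D.block i).IsProper) → C.IsProper) :=
  ⟨DGModule.isSmooth_of_directed hsmooth hperfect, DGModule.isProper_of_directed hperfect⟩
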